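/- Let $P\subset\mathbb{R}^2$ be a finite rooted point set, i.e. a finite point set with a designated point $r\in P$ (the root), in general position (no three points of $P$ are collinear). A geometric graph on $P$ is a graph with vertex set $P$ whose edges are straight line segments between points of $P$; its cost is the sum of the Euclidean lengths of its edges. For a Cartesian system $x'y'$ (a pair of orthogonal axes), a path $(w_0,\dots,w_l)$ is $x'y'$-monotone if the sequence of the $x'$-coordinates of its vertices is monotone (non-decreasing or non-increasing) and so is the sequence of their $y'$-coordinates. A geometric graph on $P$ is rooted $x'y'$-monotone if $r$ is connected with every point of $P$ by an $x'y'$-monotone path of the graph, and it is rooted uniform 2D-monotone if it is rooted $x'y'$-monotone for some Cartesian system $x'y'$. A rooted uniform 2D-monotone minimum spanning tree (rooted 2D-UMMST) of $P$ is a rooted uniform 2D-monotone spanning tree of $P$ whose cost is minimum among all rooted uniform 2D-monotone geometric graphs with vertex set $P$. Theorem. There is an algorithm on the real RAM (exact real arithmetic $+,-,\cdot,/$, square roots and comparisons of real numbers, and addition, subtraction, comparison and indirect addressing for integers, each in unit time) which, given any rooted point set $P$ in general position, halts with the list of the edges of a rooted 2D-UMMST $T$ of $P$, together with the unit direction vectors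 of the axes of a Cartesian system $x'y'$ for which $T$ is rooted $x'y'$-monotone, and which takes $O(|P|^2\log|P|)$ time: there is a constant $C$ such that it makes at most $C\,|P|^2\log|P|$ steps whenever $|P|\ge 2$. -/

import Mathlib

/-! ### Rooted point sets, geometric graphs and monotonicity -/

/-- The Euclidean plane. -/
abbrev Plane : Type := EuclideanSpace ℝ (Fin 2)

/-- A rooted point set with `n` points, listed in an arbitrary order as `pt 0, …, pt (n - 1)`,
with a designated root, in general position (no three of its points are collinear). -/
structure RootedPointSet (n : ℕ) where
  pt : Fin n → Plane
  root : Fin n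
  pt_injective : Function.Injective pt
  generalPosition : ∀ i j k : Fin n, i ≠ j → i ≠ k → j ≠ k →
    ¬ Collinear ℝ ({pt i, pt j, pt k} : Set Plane)

/-- A Cartesian system `x'y'`, given by the unit vectors of its `x'` axis (index `0`) and of its
`y'` axis (index `1`). The place of its origin is irrelevant for monotonicity. -/
abbrev CartesianSystem : Type := OrthonormalBasis (Fin 2) ℝ Plane

/-- The geometric path with the given list of vertices is monotone in the direction `u`. -/
def MonotoneAlong (u : Plane) (w : List Plane) : Prop :=
  w.IsChain (fun p q => inner ℝ u p ≤ inner ℝ u q) ∨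
    w.IsChain (fun p q => inner ℝ u q ≤ inner ℝ u p)

/-- The geometric path with the given list of vertices is `x'y'`-monotone. -/
def XYMonotone (b : CartesianSystem) (w : List Plane) : Prop :=
  MonotoneAlong (b 0) w ∧ MonotoneAlong (b 1) w

namespace RootedPointSet

/-- The geometric graph on the vertex set `P` with edge set `G` is rooted `x'y'`-monotone: the
root is connected with every point by an `x'y'`-monotone path of the graph. -/
def RootedXYMonotone {n : ℕ} (P : RootedPointSet n) (b : CartesianSystem)
    (G : SimpleGraph (Fin n)) : Prop :=
  ∀ v : Fin n, ∃ w : G.Walk P.root v, w.IsPath ∧ XYMonotone b (w.support.map P.pt)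

/-- The geometric graph is rooted uniform 2D-monotone: one Cartesian system serves all points. -/
def RootedUniform2DMonotone {n : ℕ} (P : RootedPointSet n) (G : SimpleGraph (Fin n)) : Prop :=
  ∃ b : CartesianSystem, P.RootedXYMonotone b G

/-- The length of the segment that joins two points of `P`. -/
noncomputable def edgeLength {n : ℕ} (P : RootedPointSet n) : Sym2 (Fin n) → ℝ :=
  Sym2.lift ⟨fun i j => dist (P.pt i) (P.pt j), fun _ _ => dist_comm _ _⟩

open Classical in
/-- The cost of a geometric graph: the sum of the Euclidean lengths of its edges. -/
noncomputable def cost {n : ℕ} (P : RootedPointSet n) (G : SimpleGraph (Fin n)) : ℝ :=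
  ∑ e ∈ G.edgeFinset, P.edgeLength e

/-- `G` is a rooted uniform 2D-monotone minimum spanning tree of `P`: it is a rooted uniform
2D-monotone spanning tree, and no rooted uniform 2D-monotone spanning graph of `P` (tree or not)
is cheaper. -/
def IsUniform2DMonotoneMST {n : ℕ} (P : RootedPointSet n) (G : SimpleGraph (Fin n)) : Prop :=
  G.IsTree ∧ P.RootedUniform2DMonotone G ∧
    ∀ H : SimpleGraph (Fin n), P.RootedUniform2DMonotone H → P.cost G ≤ P.cost H

end RootedPointSet

/-! ### The real random access machine

Programs are `while` programs over a memory that consists of arrays of natural numbers and arrays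
of real numbers. Array names are literals of the program; a cell of an array is addressed by the
value of an index expression (indirect addressing). Natural numbers can be added, subtracted and
compared; real numbers can be added, subtracted, multiplied, divided and compared, and square
roots can be taken. All real operations are exact; there is no rounding and no conversion
between the two sorts. Every operation, memory access, constant and test takes one step. -/

namespace RealRAM

/-- A memory state: `nat a i` and `real a i` are the `i`-th cells of the `a`-th arrays. -/
structure Mem where
  nat : ℕ → ℕ → ℕ
  real : ℕ → ℕ → ℝ

/-- Expressions for natural numbers (`sub` is truncated). -/
inductive NatExpr : Type
  | const (k : ℕ)
  | get (a : ℕ) (i : NatExpr)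
  | add (e f : NatExpr)
  | sub (e f : NatExpr)

/-- Expressions for real numbers. -/
inductive RealExpr : Type
  | const (k : ℕ)
  | get (a : ℕ) (i : NatExpr)
  | add (e f : RealExpr)
  | sub (e f : RealExpr)
  | mul (e f : RealExpr)
  | div (e f : RealExpr)
  | sqrt (e : RealExpr)

/-- Tests. -/
inductive Test : Type
  | natLe (e f : NatExpr)
  | realLe (e f : RealExpr)
  | not (c : Test)
  | and (c d : Test)

/-- Programs. -/
inductive Prog : Type
  | skip
  | setNat (a : ℕ) (i e : NatExpr)
  | setReal (a : ℕ) (i : NatExpr) (e : RealExpr)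
  | seq (p q : Prog)
  | ite (c : Test) (p q : Prog)
  | while (c : Test) (p : Prog)

/-- The value of an expression. -/
def NatExpr.eval (s : Mem) : NatExpr → ℕ
  | const k => k
  | get a i => s.nat a (i.eval s)
  | add e f => e.eval s + f.eval s
  | sub e f => e.eval s - f.eval s

/-- The number of steps that the evaluation of an expression takes. -/
def NatExpr.time : NatExpr → ℕ
  | const _ => 1
  | get _ i => i.time + 1
  | add e f => e.time + f.time + 1
  | sub e f => e.time + f.time + 1

/-- The value of an expression (`x / 0` and square roots of negative numbers have the value `0`). -/
noncomputable def RealExpr.eval (s : Mem) : RealExpr → ℝ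
  | const k => (k : ℝ)
  | get a i => s.real a (i.eval s)
  | add e f => e.eval s + f.eval s
  | sub e f => e.eval s - f.eval s
  | mul e f => e.eval s * f.eval s
  | div e f => e.eval s / f.eval s
  | sqrt e => Real.sqrt (e.eval s)

/-- The number of steps that the evaluation of an expression takes. -/
def RealExpr.time : RealExpr → ℕ
  | const _ => 1
  | get _ i => i.time + 1
  | add e f => e.time + f.time + 1
  | sub e f => e.time + f.time + 1
  | mul e f => e.time + f.time + 1
  | div e f => e.time + f.time + 1
  | sqrt e => e.time + 1

/-- The test succeeds. -/
def Test.Holds (s : Mem) : Test → Prop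
  | natLe e f => e.eval s ≤ f.eval s
  | realLe e f => e.eval s ≤ f.eval s
  | not c => ¬ c.Holds s
  | and c d => c.Holds s ∧ d.Holds s

/-- The number of steps that a test takes. -/
def Test.time : Test → ℕ
  | natLe e f => e.time + f.time + 1
  | realLe e f => e.time + f.time + 1
  | not c => c.time + 1
  | and c d => c.time + d.time + 1

/-- Write a natural number into a cell. -/
def Mem.setNat (s : Mem) (a i v : ℕ) : Mem :=
  { s with nat := Function.update s.nat a (Function.update (s.nat a) i v) }

/-- Write a real number into a cell. -/
noncomputable def Mem.setReal (s : Mem) (a i : ℕ) (v : ℝ) : Mem :=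
  { s with real := Function.update s.real a (Function.update (s.real a) i v) }

/-- `Runs p s s' t`: the program `p`, started in the memory state `s`, halts after exactly `t`
steps in the memory state `s'`. -/
inductive Runs : Prog → Mem → Mem → ℕ → Prop
  | skip (s : Mem) : Runs Prog.skip s s 1
  | setNat (s : Mem) (a : ℕ) (i e : NatExpr) :
      Runs (Prog.setNat a i e) s (s.setNat a (i.eval s) (e.eval s)) (i.time + e.time + 1)
  | setReal (s : Mem) (a : ℕ) (i : NatExpr) (e : RealExpr) :
      Runs (Prog.setReal a i e) s (s.setReal a (i.eval s) (e.eval s)) (i.time + e.time + 1)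
  | seq {p q : Prog} {s s' s'' : Mem} {t t' : ℕ} (hp : Runs p s s' t) (hq : Runs q s' s'' t') :
      Runs (Prog.seq p q) s s'' (t + t')
  | ite_true {c : Test} {p q : Prog} {s s' : Mem} {t : ℕ} (hc : c.Holds s) (hp : Runs p s s' t) :
      Runs (Prog.ite c p q) s s' (c.time + t)
  | ite_false {c : Test} {p q : Prog} {s s' : Mem} {t : ℕ} (hc : ¬ c.Holds s)
      (hq : Runs q s s' t) : Runs (Prog.ite c p q) s s' (c.time + t)
  | while_false {c : Test} {p : Prog} {s : Mem} (hc : ¬ c.Holds s) :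
      Runs (Prog.while c p) s s c.time
  | while_true {c : Test} {p : Prog} {s s' s'' : Mem} {t t' : ℕ} (hc : c.Holds s)
      (hp : Runs p s s' t) (hw : Runs (Prog.while c p) s' s'' t') :
      Runs (Prog.while c p) s s'' (c.time + t + t')

/-- The initial memory for a rooted point set: cells `0` and `1` of the natural array `0` hold the
number of points and the index of the root, the real arrays `0` and `1` hold the two coordinates
of the points; all other cells are `0`. -/
noncomputable def input {n : ℕ} (P : RootedPointSet n) : Mem where
  nat a i := if a = 0 ∧ i = 0 then n else if a = 0 ∧ i = 1 then (P.root : ℕ) else 0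
  real a i :=
    if h : i < n then if a = 0 then P.pt ⟨i, h⟩ 0 else if a = 1 then P.pt ⟨i, h⟩ 1 else 0
    else 0

/-- The number of edges in the edge list that a final memory state holds. -/
def outputEdgeCount (s : Mem) : ℕ := s.nat 1 0

/-- The graph that a final memory state holds: the endpoints of the `k`-th edge of its edge list
are in the `k`-th cells of the natural arrays `2` and `3`. -/
def outputGraph (n : ℕ) (s : Mem) : SimpleGraph (Fin n) :=
  SimpleGraph.fromRel fun i j : Fin n =>
    ∃ k < outputEdgeCount s, s.nat 2 k = (i : ℕ) ∧ s.nat 3 k = (j : ℕ)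

/-- The vectors of the `x'` axis and of the `y'` axis that a final memory state holds, in the
cells `0` and `1` of the real array `2` and of the real array `3`. -/
noncomputable def outputAxes (s : Mem) : Fin 2 → Plane :=
  ![!₂[s.real 2 0, s.real 2 1], !₂[s.real 3 0, s.real 3 1]]

end RealRAM

/-! Fix a Cartesian system. In a rooted monotone graph the vertex `q` that precedes `v` on its path
from the root lies in the axis-parallel rectangle spanned by the root and `v`. Lying in this
rectangle is an antisymmetric relation, so the edges chosen in this way for different `v` are
distinct, and the cost is at least the sum over `v` of the distance to a nearest other point of its
rectangle (`RootedXYMonotone.sum_le_cost`). Joining every `v` to such a nearest point attains the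
sum, and it gives a monotone tree because the ℓ¹-distance from the root decreases strictly from a
vertex to its parent (`exists_walk_parentGraph`, `isTree_parentGraph`). So greedy parents are
optimal for each system, and only the system remains to be optimised.

Up to swapping and reversing the axes, a system is a slope `t ≥ 0` (`exists_slope`). For a pair `(v,
q)`, membership of `q` in the rectangle of `v` can change only when `q - r` or `v - q` becomes
orthogonal to an axis, hence only at two critical slopes. Rectangles are closed, so membership may
be gained at a critical slope but is not lost there. An admissible pair has the value `|vq|`, any
other pair has the value `|vr|`; the root is always admissible, and an admissible `q` is never
farther from `v` than the root is. Hence the value of a pair is a function of `t` that is constant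
between critical slopes and lower semicontinuous at them (`controls_leafVal`). The cost of a slope
is the sum over `v` of the minimum over `q` of these values.

A sweep over `t` has four events per pair: the values at the two critical slopes, and the values
just after them. Events are ordered by slope; at equal slopes, values at the slope come before
values after it. After every prefix of events the stored values are upper bounds for those at the
slope of the last event (`State.le`), and one particular prefix yields exactly the values at a given
`t` (`State.eq_of_eventsUpTo`). Therefore the least cost seen over all prefixes is the optimum, the
slope recorded with it attains it, and half-processed ties do no harm.

The next event comes from a tournament tree over all `4n²` events, and the minimum for each `v` is
kept in a tournament tree of its own. An event changes one leaf in two trees, which takes `O(log n)`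
steps. The parents for the best slope are then found by inspecting all `n²` pairs. -/

namespace RealRAM

/-! ### A program logic for the real RAM -/

/-- The program, started in `s`, halts within `T` steps in a state that satisfies `Q`. -/
def Ends (p : Prog) (s : Mem) (T : ℕ) (Q : Mem → Prop) : Prop :=
  ∃ s' t, Runs p s s' t ∧ t ≤ T ∧ Q s'

/-- The program contains an assignment to the natural array `a`. -/
def Prog.WritesNat (a : ℕ) : Prog → Prop
  | skip => False
  | setNat b _ _ => a = b
  | setReal _ _ _ => False
  | seq p q => p.WritesNat a ∨ q.WritesNat a
  | ite _ p q => p.WritesNat a ∨ q.WritesNat a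
  | .while _ p => p.WritesNat a

/-- The program contains an assignment to the real array `a`. -/
def Prog.WritesReal (a : ℕ) : Prog → Prop
  | skip => False
  | setNat _ _ _ => False
  | setReal b _ _ => a = b
  | seq p q => p.WritesReal a ∨ q.WritesReal a
  | ite _ p q => p.WritesReal a ∨ q.WritesReal a
  | .while _ p => p.WritesReal a

/-- The states `s` and `s'` agree on the arrays that `p` does not write to. -/
def Frame (p : Prog) (s s' : Mem) : Prop :=
  (∀ a, ¬ p.WritesNat a → s'.nat a = s.nat a) ∧ ∀ a, ¬ p.WritesReal a → s'.real a = s.real a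

lemma Frame.refl (p : Prog) (s : Mem) : Frame p s s := ⟨fun _ _ => rfl, fun _ _ => rfl⟩

lemma Frame.trans {p : Prog} {s s' s'' : Mem} (h : Frame p s s') (h' : Frame p s' s'') :
    Frame p s s'' :=
  ⟨fun a ha => (h'.1 a ha).trans (h.1 a ha), fun a ha => (h'.2 a ha).trans (h.2 a ha)⟩

lemma Frame.mono {p q : Prog} {s s' : Mem} (h : Frame p s s')
    (hn : ∀ a, p.WritesNat a → q.WritesNat a) (hr : ∀ a, p.WritesReal a → q.WritesReal a) :
    Frame q s s' :=
  ⟨fun a ha => h.1 a fun h' => ha (hn a h'), fun a ha => h.2 a fun h' => ha (hr a h')⟩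

/-- Being unassigned in the program text is a syntactic condition that `simp` decides. Loop
invariants therefore need to mention only the arrays that the loop body writes. -/
lemma Runs.frame {p : Prog} {s s' : Mem} {t : ℕ} (h : Runs p s s' t) : Frame p s s' := by
  induction h with
  | skip s => exact Frame.refl _ _
  | setNat s a i e =>
    refine ⟨fun b hb => ?_, fun b _ => rfl⟩
    exact Function.update_of_ne (by simpa [Prog.WritesNat] using hb) _ _
  | setReal s a i e =>
    refine ⟨fun b _ => rfl, fun b hb => ?_⟩
    exact Function.update_of_ne (by simpa [Prog.WritesReal] using hb) _ _
  | seq _ _ ihp ihq =>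
    exact (ihp.mono (fun _ => Or.inl) fun _ => Or.inl).trans
      (ihq.mono (fun _ => Or.inr) fun _ => Or.inr)
  | ite_true _ _ ih => exact ih.mono (fun _ => Or.inl) fun _ => Or.inl
  | ite_false _ _ ih => exact ih.mono (fun _ => Or.inr) fun _ => Or.inr
  | while_false _ => exact Frame.refl _ _
  | while_true _ _ _ ihp ihw => exact ihp.trans ihw

lemma Ends.mono {p : Prog} {s : Mem} {T T' : ℕ} {Q Q' : Mem → Prop} (h : Ends p s T Q)
    (hT : T ≤ T') (hQ : ∀ s', Frame p s s' → Q s' → Q' s') : Ends p s T' Q' := by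
  obtain ⟨s', t, hr, ht, hq⟩ := h
  exact ⟨s', t, hr, ht.trans hT, hQ s' hr.frame hq⟩

lemma Ends.seq {p q : Prog} {s : Mem} {T T' : ℕ} {Q R : Mem → Prop} (hp : Ends p s T Q)
    (hq : ∀ s', Frame p s s' → Q s' → Ends q s' T' R) : Ends (Prog.seq p q) s (T + T') R := by
  obtain ⟨s', t, hr, ht, hQ⟩ := hp
  obtain ⟨s'', t', hr', ht', hR⟩ := hq s' hr.frame hQ
  exact ⟨s'', t + t', Runs.seq hr hr', Nat.add_le_add ht ht', hR⟩

/-- The rule for a loop with a known number `K` of iterations. -/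
lemma ends_while {c : Test} {p : Prog} {s : Mem} (K T : ℕ) (I : ℕ → Mem → Prop) (h0 : I 0 s)
    (hstep : ∀ k s', k < K → Frame p s s' → I k s' → c.Holds s' ∧ Ends p s' T (I (k + 1)))
    (hend : ∀ s', Frame p s s' → I K s' → ¬ c.Holds s') :
    Ends (Prog.while c p) s (K * (c.time + T) + c.time) (I K) := by
  -- Induction on the number `m` of remaining iterations, from an arbitrary intermediate state.
  have key : ∀ m k s', k + m = K → Frame p s s' → I k s' →
      Ends (Prog.while c p) s' (m * (c.time + T) + c.time) (I K) := by
    intro m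
    induction m with
    | zero =>
      intro k s' hk hf hI
      obtain rfl : k = K := by omega
      exact ⟨s', c.time, Runs.while_false (hend s' hf hI), by simp, hI⟩
    | succ m ih =>
      intro k s' hk hf hI
      obtain ⟨hc, s'', t, hr, ht, hI'⟩ := hstep k s' (by omega) hf hI
      obtain ⟨s₃, t', hr', ht', hQ⟩ := ih (k + 1) s'' (by omega) (hf.trans hr.frame) hI'
      refine ⟨s₃, c.time + t + t', Runs.while_true hc hr hr', ?_, hQ⟩
      have : (m + 1) * (c.time + T) = m * (c.time + T) + (c.time + T) := by ring
      omega
  exact key K 0 s (by omega) (Frame.refl _ _) h0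

/-- The program contains no loop. -/
def Prog.LoopFree : Prog → Prop
  | seq p q => p.LoopFree ∧ q.LoopFree
  | ite _ p q => p.LoopFree ∧ q.LoopFree
  | .while _ _ => False
  | _ => True

open Classical in
/-- The final state of a program without loops. -/
noncomputable def Prog.exec : Prog → Mem → Mem
  | skip, s => s
  | setNat a i e, s => s.setNat a (i.eval s) (e.eval s)
  | setReal a i e, s => s.setReal a (i.eval s) (e.eval s)
  | seq p q, s => q.exec (p.exec s)
  | ite c p q, s => if c.Holds s then p.exec s else q.exec s
  | .while _ _, s => s

/-- A bound for the running time of a program without loops. -/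
def Prog.maxTime : Prog → ℕ
  | skip => 1
  | setNat _ i e => i.time + e.time + 1
  | setReal _ i e => i.time + e.time + 1
  | seq p q => p.maxTime + q.maxTime
  | ite c p q => c.time + (p.maxTime + q.maxTime)
  | .while _ _ => 0

/-- Reduces a block without loops to the evaluation of `exec`, which `simp` carries out. Since
`maxTime` charges both branches of a conditional, it bounds the time whichever branch is taken. -/
lemma ends_of_loopFree {p : Prog} (hp : p.LoopFree) {s : Mem} {Q : Mem → Prop}
    (hQ : Q (p.exec s)) : Ends p s p.maxTime Q := by
  have key : ∀ s, ∃ t ≤ p.maxTime, Runs p s (p.exec s) t := by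
    clear hQ s
    induction p with
    | skip => exact fun s => ⟨_, le_rfl, Runs.skip s⟩
    | setNat a i e => exact fun s => ⟨_, le_rfl, Runs.setNat s a i e⟩
    | setReal a i e => exact fun s => ⟨_, le_rfl, Runs.setReal s a i e⟩
    | seq p q ihp ihq =>
      intro s
      obtain ⟨t, ht, hr⟩ := ihp hp.1 s
      obtain ⟨t', ht', hr'⟩ := ihq hp.2 (p.exec s)
      exact ⟨t + t', Nat.add_le_add ht ht', Runs.seq hr hr'⟩
    | ite c p q ihp ihq =>
      intro s
      by_cases hc : c.Holds s
      · obtain ⟨t, ht, hr⟩ := ihp hp.1 s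
        refine ⟨c.time + t, by simp only [Prog.maxTime]; omega, ?_⟩
        simpa only [Prog.exec, if_pos hc] using Runs.ite_true hc hr
      · obtain ⟨t, ht, hr⟩ := ihq hp.2 s
        refine ⟨c.time + t, by simp only [Prog.maxTime]; omega, ?_⟩
        simpa only [Prog.exec, if_neg hc] using Runs.ite_false hc hr
    | _ c p => exact False.elim hp
  obtain ⟨t, ht, hr⟩ := key s
  exact ⟨_, t, hr, ht, hQ⟩

/-! ### Reading memory after a write, and shorthand for registers and blocks -/

@[simp] lemma Mem.setNat_real (s : Mem) (a i v : ℕ) : (s.setNat a i v).real = s.real := rfl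

@[simp] lemma Mem.setReal_nat (s : Mem) (a i : ℕ) (v : ℝ) : (s.setReal a i v).nat = s.nat := rfl

@[simp] lemma Mem.setNat_nat_self (s : Mem) (a i v : ℕ) :
    (s.setNat a i v).nat a = Function.update (s.nat a) i v := by simp [Mem.setNat]

@[simp] lemma Mem.setReal_real_self (s : Mem) (a i : ℕ) (v : ℝ) :
    (s.setReal a i v).real a = Function.update (s.real a) i v := by simp [Mem.setReal]

@[simp] lemma Mem.setNat_nat_of_ne (s : Mem) {a b : ℕ} (i v : ℕ) (h : b ≠ a) :
    (s.setNat a i v).nat b = s.nat b := by simp [Mem.setNat, h]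

@[simp] lemma Mem.setReal_real_of_ne (s : Mem) {a b : ℕ} (i : ℕ) (v : ℝ) (h : b ≠ a) :
    (s.setReal a i v).real b = s.real b := by simp [Mem.setReal, h]

/-- The natural register `a`: the cell `0` of the natural array `a`. -/
abbrev reg (a : ℕ) : NatExpr := .get a (.const 0)

/-- The real register `a`: the cell `0` of the real array `a`. -/
abbrev rreg (a : ℕ) : RealExpr := .get a (.const 0)

/-- The program that runs the given programs one after the other. -/
abbrev block : List Prog → Prog
  | [] => .skip
  | [p] => p
  | p :: l => .seq p (block l)

end RealRAM

/-! ### Rooted monotone spanning trees for a fixed Cartesian system -/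

/-- The point `q` lies in the closed rectangle with sides parallel to the axes of `b` and with
opposite corners `r` and `v`. -/
def InRect (b : CartesianSystem) (r q v : Plane) : Prop :=
  ∀ i, 0 ≤ inner ℝ (b i) (q - r) * inner ℝ (b i) (v - q)

lemma OrthonormalBasis.eq_of_inner (b : CartesianSystem) {p q : Plane}
    (h : ∀ i, inner ℝ (b i) p = inner ℝ (b i) q) : p = q :=
  b.repr.injective <| PiLp.ext fun i => by simpa only [b.repr_apply_apply] using h i

/-- In each coordinate the two nonnegative products add up to minus the square of the difference of
`q` and `v`. -/
lemma InRect.eq_of_inRect {b : CartesianSystem} {r q v : Plane} (h : InRect b r q v)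
    (h' : InRect b r v q) : q = v := by
  refine b.eq_of_inner fun i => ?_
  have h1 := h i
  have h2 := h' i
  simp only [inner_sub_right] at h1 h2
  nlinarith [sq_nonneg (inner ℝ (b i) q - inner ℝ (b i) v)]

lemma xyMonotone_iff {b : CartesianSystem} {w : List Plane} :
    XYMonotone b w ↔ ∀ i, MonotoneAlong (b i) w := by
  simp [XYMonotone, Fin.forall_fin_two]

/-- The `ℓ¹`-distance from `r` in the coordinates of `b`. -/
noncomputable def boxNorm (b : CartesianSystem) (r v : Plane) : ℝ :=
  |inner ℝ (b 0) (v - r)| + |inner ℝ (b 1) (v - r)|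

lemma abs_add_of_mul_nonneg {x y : ℝ} (h : 0 ≤ x * y) : |x + y| = |x| + |y| := by
  rw [abs_add_eq_add_abs_iff]
  exact mul_nonneg_iff.mp h

/-- In each coordinate `q` is between `r` and `v`, so absolute differences add up. This is the
measure along which parents decrease, and it rules out cycles. -/
lemma InRect.boxNorm_lt {b : CartesianSystem} {r q v : Plane} (h : InRect b r q v) (hq : q ≠ v) :
    boxNorm b r q < boxNorm b r v := by
  have key : ∀ i, |inner ℝ (b i) (v - r)| = |inner ℝ (b i) (q - r)| + |inner ℝ (b i) (v - q)| := by
    intro i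
    rw [← abs_add_of_mul_nonneg (h i), ← inner_add_right]
    congr 3
    abel
  have hne : ∃ i, inner ℝ (b i) (v - q) ≠ 0 := by
    by_contra! h0
    refine hq (b.eq_of_inner fun i => ?_)
    have := h0 i
    rw [inner_sub_right] at this
    linarith
  have hpos : 0 < |inner ℝ (b 0) (v - q)| + |inner ℝ (b 1) (v - q)| := by
    obtain ⟨i, hi⟩ := hne
    fin_cases i
    · exact add_pos_of_pos_of_nonneg (abs_pos.mpr hi) (abs_nonneg _)
    · exact add_pos_of_nonneg_of_pos (abs_nonneg _) (abs_pos.mpr hi)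
  rw [boxNorm, boxNorm, key 0, key 1]
  linarith

namespace RootedPointSet

variable {n : ℕ} {P : RootedPointSet n} {b : CartesianSystem}

/-- The vertex `q` is the penultimate vertex of the monotone path: in both coordinates it is between
the first and the last vertex of the path. -/
lemma RootedXYMonotone.exists_adj {H : SimpleGraph (Fin n)} (h : P.RootedXYMonotone b H)
    {v : Fin n} (hv : v ≠ P.root) :
    ∃ q, H.Adj q v ∧ InRect b (P.pt P.root) (P.pt q) (P.pt v) := by
  obtain ⟨w, -, hw⟩ := h v
  have hnil : ¬ w.Nil := fun hn => hv hn.eq.symm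
  refine ⟨w.penultimate, w.adj_penultimate hnil, fun i => ?_⟩
  have hm := xyMonotone_iff.mp hw i
  have hsupp : w.support = w.dropLast.support ++ [v] := by
    conv_lhs => rw [← w.concat_dropLast (w.adj_penultimate hnil)]
    exact SimpleGraph.Walk.support_concat ..
  -- One argument for `≤` and for `≥`: by transitivity, a chain relates its first, penultimate and
  -- last vertices.
  have key : ∀ R : Plane → Plane → Prop, (∀ x, R x x) → (∀ x y z, R x y → R y z → R x z) →
      (w.support.map P.pt).IsChain R →
      R (P.pt P.root) (P.pt w.penultimate) ∧ R (P.pt w.penultimate) (P.pt v) := by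
    intro R hrefl htrans hc
    have : IsTrans Plane R := ⟨htrans⟩
    have hp := List.isChain_iff_pairwise.mp hc
    rw [List.pairwise_map] at hp
    constructor
    · have hmem : w.penultimate ∈ w.support := w.getVert_mem_support _
      rw [← SimpleGraph.Walk.cons_tail_support] at hp hmem
      rcases List.mem_cons.mp hmem with he | he
      · rw [he]; exact hrefl _
      · exact (List.pairwise_cons.mp hp).1 _ he
    · rw [hsupp] at hp
      exact (List.pairwise_append.mp hp).2.2 _ (SimpleGraph.Walk.end_mem_support _) v (by simp)
  simp only [inner_sub_right]
  rcases hm with hm | hm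
  · obtain ⟨h1, h2⟩ := key (fun p q => inner ℝ (b i) p ≤ inner ℝ (b i) q) (fun _ => le_rfl)
      (fun _ _ _ => le_trans) hm
    exact mul_nonneg (sub_nonneg.mpr h1) (sub_nonneg.mpr h2)
  · obtain ⟨h1, h2⟩ := key (fun p q => inner ℝ (b i) q ≤ inner ℝ (b i) p) (fun _ => le_rfl)
      (fun _ _ _ h h' => le_trans h' h) hm
    exact mul_nonneg_of_nonpos_of_nonpos (sub_nonpos.mpr h1) (sub_nonpos.mpr h2)

/-- A lower bound for the cost of rooted monotone graphs. -/
lemma RootedXYMonotone.sum_le_cost {H : SimpleGraph (Fin n)} (h : P.RootedXYMonotone b H)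
    (f : Fin n → ℝ) (hf : ∀ v q, v ≠ P.root → q ≠ v →
      InRect b (P.pt P.root) (P.pt q) (P.pt v) → f v ≤ dist (P.pt v) (P.pt q)) :
    ∑ v ∈ Finset.univ.erase P.root, f v ≤ P.cost H := by
  classical
  have hex : ∀ v, ∃ q, v ≠ P.root → H.Adj q v ∧ InRect b (P.pt P.root) (P.pt q) (P.pt v) := by
    intro v
    by_cases hv : v = P.root
    · exact ⟨v, fun h => absurd hv h⟩
    · obtain ⟨q, hq⟩ := h.exists_adj hv
      exact ⟨q, fun _ => hq⟩
  choose q hq using hex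
  -- If `v` and `v'` chose the same edge from opposite ends, each would lie in the rectangle of the
  -- other.
  have hinj : Set.InjOn (fun v => s(v, q v)) (Finset.univ.erase P.root : Finset (Fin n)) := by
    intro v hv v' hv' he
    have hv0 : v ≠ P.root := by simpa using hv
    have hv0' : v' ≠ P.root := by simpa using hv'
    rcases Sym2.eq_iff.mp he with h1 | ⟨h1, h2⟩
    · exact h1.1
    · have h3 := (hq v hv0).2
      have h4 := (hq v' hv0').2
      rw [h2] at h3
      rw [← h1] at h4
      exact (P.pt_injective (h3.eq_of_inRect h4)).symm
  calc ∑ v ∈ Finset.univ.erase P.root, f v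
      ≤ ∑ v ∈ Finset.univ.erase P.root, P.edgeLength s(v, q v) := by
        refine Finset.sum_le_sum fun v hv => ?_
        have hv0 : v ≠ P.root := by simpa using hv
        exact hf v (q v) hv0 (hq v hv0).1.ne (hq v hv0).2
    _ = ∑ e ∈ (Finset.univ.erase P.root).image (fun v => s(v, q v)), P.edgeLength e :=
        (Finset.sum_image hinj).symm
    _ ≤ P.cost H := by
        refine Finset.sum_le_sum_of_subset_of_nonneg ?_ ?_
        · intro e he
          obtain ⟨v, hv, rfl⟩ := Finset.mem_image.mp he
          have hv0 : v ≠ P.root := by simpa using hv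
          rw [SimpleGraph.mem_edgeFinset]
          exact (hq v hv0).1.symm
        · intro e _ _
          induction e with
          | _ x y => exact (dist_nonneg : 0 ≤ dist (P.pt x) (P.pt y))

/-! ### Trees given by parents -/

/-- The graph in which every vertex but the root is joined to its parent. -/
def parentGraph (P : RootedPointSet n) (par : Fin n → Fin n) : SimpleGraph (Fin n) :=
  SimpleGraph.fromRel fun i j => i ≠ P.root ∧ par i = j

variable {par : Fin n → Fin n}

/-- Recursion along parents, by the ℓ¹-distance from the root. The bound on the vertices of the walk
keeps it a path when `v` is appended. The direction of monotonicity is tied to the sign of the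
coordinate of `v`, not left as a disjunction: a parent level with the root admits both directions,
and the next edge may need either of them. -/
lemma exists_walk_parentGraph (hpar : ∀ v, v ≠ P.root → par v ≠ v ∧
      InRect b (P.pt P.root) (P.pt (par v)) (P.pt v)) (v : Fin n) :
    ∃ w : (P.parentGraph par).Walk P.root v, w.IsPath ∧
      (∀ x ∈ w.support, boxNorm b (P.pt P.root) (P.pt x) ≤ boxNorm b (P.pt P.root) (P.pt v)) ∧
      ∀ i, (0 ≤ inner ℝ (b i) (P.pt v - P.pt P.root) →
          (w.support.map P.pt).IsChain fun p q => inner ℝ (b i) p ≤ inner ℝ (b i) q) ∧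
        (inner ℝ (b i) (P.pt v - P.pt P.root) ≤ 0 →
          (w.support.map P.pt).IsChain fun p q => inner ℝ (b i) q ≤ inner ℝ (b i) p) := by
  have hwf : WellFounded fun x y : Fin n =>
      boxNorm b (P.pt P.root) (P.pt x) < boxNorm b (P.pt P.root) (P.pt y) := by
    have : IsTrans (Fin n) fun x y : Fin n =>
      boxNorm b (P.pt P.root) (P.pt x) < boxNorm b (P.pt P.root) (P.pt y) :=
        ⟨fun _ _ _ => lt_trans⟩
    have : Std.Irrefl fun x y : Fin n =>
      boxNorm b (P.pt P.root) (P.pt x) < boxNorm b (P.pt P.root) (P.pt y) :=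
        ⟨fun _ => lt_irrefl _⟩
    exact Finite.wellFounded_of_trans_of_irrefl _
  induction v using hwf.induction with
  | _ v ih =>
    by_cases hv : v = P.root
    · subst hv
      exact ⟨.nil, by simp, by simp, fun i => by simp⟩
    · obtain ⟨hne, hrect⟩ := hpar v hv
      have hlt := hrect.boxNorm_lt fun h => hne (P.pt_injective h)
      obtain ⟨w, hw, hle, hmon⟩ := ih (par v) hlt
      have hadj : (P.parentGraph par).Adj (par v) v := by
        rw [parentGraph, SimpleGraph.fromRel_adj]
        exact ⟨hne, Or.inr ⟨hv, rfl⟩⟩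
      have hchain : ∀ R : Plane → Plane → Prop, (w.support.map P.pt).IsChain R →
          R (P.pt (par v)) (P.pt v) → ((w.concat hadj).support.map P.pt).IsChain R := by
        intro R hR hR'
        rw [SimpleGraph.Walk.support_concat, List.map_append, List.isChain_append]
        refine ⟨hR, by simp, ?_⟩
        intro x hx y hy
        simp only [List.getLast?_map, List.map_cons, List.map_nil, List.head?_cons,
          Option.mem_def, Option.some.injEq] at hx hy
        rw [List.getLast?_eq_some_getLast w.support_ne_nil, SimpleGraph.Walk.getLast_support] at hx
        simp only [Option.map_some, Option.some.injEq] at hx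
        rw [← hx, ← hy]
        exact hR'
      refine ⟨w.concat hadj, ?_, ?_, fun i => ⟨fun h0 => ?_, fun h0 => ?_⟩⟩
      -- All vertices on the walk to the parent are strictly closer to the root than `v`.
      · exact hw.concat (fun hmem => absurd (hle v hmem) (not_le.mpr hlt)) hadj
      · intro x hx
        rw [SimpleGraph.Walk.support_concat, List.mem_append] at hx
        rcases hx with hx | hx
        · exact (hle x hx).trans hlt.le
        · rw [List.mem_singleton.mp hx]
      all_goals
        have hi := hrect i
        simp only [inner_sub_right] at hi h0
        have h1 := hmon i
        simp only [inner_sub_right] at h1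
      · have h2 : 0 ≤ inner ℝ (b i) (P.pt (par v)) - inner ℝ (b i) (P.pt P.root) ∧
            inner ℝ (b i) (P.pt (par v)) ≤ inner ℝ (b i) (P.pt v) := by
          rcases mul_nonneg_iff.mp hi with ⟨h3, h4⟩ | ⟨h3, h4⟩ <;> constructor <;> linarith
        exact hchain _ (h1.1 h2.1) h2.2
      · have h2 : inner ℝ (b i) (P.pt (par v)) - inner ℝ (b i) (P.pt P.root) ≤ 0 ∧
            inner ℝ (b i) (P.pt v) ≤ inner ℝ (b i) (P.pt (par v)) := by
          rcases mul_nonneg_iff.mp hi with ⟨h3, h4⟩ | ⟨h3, h4⟩ <;> constructor <;> linarith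
        exact hchain _ (h1.2 h2.1) h2.2

lemma rootedXYMonotone_parentGraph (hpar : ∀ v, v ≠ P.root → par v ≠ v ∧
      InRect b (P.pt P.root) (P.pt (par v)) (P.pt v)) :
    P.RootedXYMonotone b (P.parentGraph par) := by
  intro v
  obtain ⟨w, hw, -, hmon⟩ := exists_walk_parentGraph hpar v
  refine ⟨w, hw, xyMonotone_iff.mpr fun i => ?_⟩
  rcases le_total 0 (inner ℝ (b i) (P.pt v - P.pt P.root)) with h | h
  · exact Or.inl ((hmon i).1 h)
  · exact Or.inr ((hmon i).2 h)

open Classical in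
lemma edgeFinset_parentGraph_subset :
    (P.parentGraph par).edgeFinset ⊆
      (Finset.univ.erase P.root).image fun v => s(v, par v) := by
  intro e he
  rw [SimpleGraph.mem_edgeFinset] at he
  induction e with
  | _ x y =>
    rw [SimpleGraph.mem_edgeSet, parentGraph, SimpleGraph.fromRel_adj] at he
    rcases he.2 with ⟨h1, h2⟩ | ⟨h1, h2⟩
    · exact Finset.mem_image.mpr ⟨x, by simpa using h1, by rw [h2]⟩
    · exact Finset.mem_image.mpr ⟨y, by simpa using h1, by rw [h2, Sym2.eq_swap]⟩

/-- The graph is connected, and it has at most one edge for each vertex other than the root. -/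
lemma isTree_parentGraph (hpar : ∀ v, v ≠ P.root → par v ≠ v ∧
      InRect b (P.pt P.root) (P.pt (par v)) (P.pt v)) : (P.parentGraph par).IsTree := by
  classical
  have hconn : (P.parentGraph par).Connected := by
    rw [SimpleGraph.connected_iff_exists_forall_reachable]
    exact ⟨P.root, fun v => (exists_walk_parentGraph hpar v).choose.reachable⟩
  rw [SimpleGraph.isTree_iff_connected_and_card]
  refine ⟨hconn, le_antisymm ?_ hconn.card_vert_le_card_edgeSet_add_one⟩
  rw [Nat.card_eq_fintype_card, ← SimpleGraph.edgeFinset_card, Nat.card_eq_fintype_card]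
  have h1 := (Finset.card_le_card (edgeFinset_parentGraph_subset (P := P) (par := par))).trans
    Finset.card_image_le
  rw [Finset.card_erase_of_mem (Finset.mem_univ _), Finset.card_univ] at h1
  have : 0 < Fintype.card (Fin n) := Fintype.card_pos_iff.mpr ⟨P.root⟩
  omega

lemma cost_parentGraph_le :
    P.cost (P.parentGraph par) ≤
      ∑ v ∈ Finset.univ.erase P.root, dist (P.pt v) (P.pt (par v)) := by
  classical
  have h0 : ∀ e, 0 ≤ P.edgeLength e := by
    intro e
    induction e with
    | _ x y => exact (dist_nonneg : 0 ≤ dist (P.pt x) (P.pt y))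
  calc P.cost (P.parentGraph par)
      ≤ ∑ e ∈ (Finset.univ.erase P.root).image (fun v => s(v, par v)), P.edgeLength e :=
        Finset.sum_le_sum_of_subset_of_nonneg edgeFinset_parentGraph_subset fun e _ _ => h0 e
    _ ≤ ∑ v ∈ Finset.univ.erase P.root, P.edgeLength s(v, par v) :=
        Finset.sum_image_le_of_nonneg fun e _ => h0 e

/-- A criterion for minimality. The number `m b' v` is the distance of `v` from a nearest point
of the rectangle that `v` spans with the root in the system `b'`. -/
lemma isUniform2DMonotoneMST_parentGraph (m : CartesianSystem → Fin n → ℝ)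
    (hpar : ∀ v, v ≠ P.root → par v ≠ v ∧ InRect b (P.pt P.root) (P.pt (par v)) (P.pt v))
    (hm : ∀ b' v q, v ≠ P.root → q ≠ v →
      InRect b' (P.pt P.root) (P.pt q) (P.pt v) → m b' v ≤ dist (P.pt v) (P.pt q))
    (hmin : ∀ b', ∑ v ∈ Finset.univ.erase P.root, dist (P.pt v) (P.pt (par v)) ≤
      ∑ v ∈ Finset.univ.erase P.root, m b' v) :
    P.IsUniform2DMonotoneMST (P.parentGraph par) := by
  refine ⟨isTree_parentGraph hpar, ⟨b, rootedXYMonotone_parentGraph hpar⟩, ?_⟩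
  rintro H ⟨b', hb'⟩
  exact cost_parentGraph_le.trans ((hmin b').trans (hb'.sum_le_cost (m b') (hm b')))

end RootedPointSet

/-! ### Slopes and critical slopes -/

/-- The only nonnegative slope `t` for which a nonzero vector `(x, y)` can be orthogonal
to `(1, t)` or to `(-t, 1)`. -/
noncomputable def critSlope (x y : ℝ) : ℝ := if 0 ≤ x * y then y / x else -x / y

lemma critSlope_nonneg (x y : ℝ) : 0 ≤ critSlope x y := by
  unfold critSlope
  split_ifs with h
  · rcases mul_nonneg_iff.mp h with h | h
    · exact div_nonneg h.2 h.1
    · exact div_nonneg_of_nonpos h.2 h.1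
  · rcases mul_neg_iff.mp (not_le.mp h) with h | h
    · exact div_nonneg_of_nonpos (by linarith) h.2.le
    · exact div_nonneg (by linarith) h.2.le

/-- For `t ≥ 0`, the equation `x + t * y = 0` forces `x * y ≤ 0`, and `y = t * x` forces `x * y ≥
0`. So the sign of `x * y` tells which equation can hold. -/
lemma eq_critSlope {x y t : ℝ} (h0 : x ≠ 0 ∨ y ≠ 0) (ht : 0 ≤ t)
    (h : x + t * y = 0 ∨ y - t * x = 0) : t = critSlope x y := by
  unfold critSlope
  rcases h with h | h
  · have hx : x = -(t * y) := by linarith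
    have hy : y ≠ 0 := by
      rintro rfl
      simp [hx] at h0
    subst hx
    -- Here `x * y = -t * y²`, which is nonnegative only if `t = 0`. Then `x = 0`, and the
    -- convention `y / 0 = 0` gives the right slope.
    split_ifs with h1
    · have h2 : t = 0 := by
        by_contra h3
        have : 0 < t := lt_of_le_of_ne ht (Ne.symm h3)
        have := mul_pos this (mul_self_pos.mpr hy)
        nlinarith
      simp [h2]
    · field_simp
  · have hy : y = t * x := by linarith
    have hx : x ≠ 0 := by
      rintro rfl
      simp [hy] at h0
    subst hy
    rw [if_pos (by nlinarith [mul_self_nonneg x, mul_nonneg ht (mul_self_nonneg x)])]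
    field_simp

/-- An affine function of the slope changes sign only at its root `z`: the product equals `y² (τ -
z) (s - z)`. If it were negative, `z` would be strictly between two nonnegative slopes, hence
nonnegative and equal to `σ`. -/
lemma mul_nonneg_of_root_not_between {x y τ s σ : ℝ} (hτ : 0 ≤ τ) (hs : 0 ≤ s)
    (hσ : ∀ t, 0 ≤ t → (x ≠ 0 ∨ y ≠ 0) → x + t * y = 0 → t = σ) (h : 0 ≤ (τ - σ) * (s - σ)) :
    0 ≤ (x + τ * y) * (x + s * y) := by
  by_contra! hneg
  have hy : y ≠ 0 := by
    rintro rfl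
    nlinarith [mul_self_nonneg x]
  have hz : x + -x / y * y = 0 := by field_simp; ring
  set z := -x / y with hz'
  have hx : x = -(z * y) := by linarith
  have h1 : (τ - z) * (s - z) * (y * y) < 0 := by
    calc (τ - z) * (s - z) * (y * y) = (x + τ * y) * (x + s * y) := by rw [hx]; ring
      _ < 0 := hneg
  have h2 : (τ - z) * (s - z) < 0 := by
    by_contra! h3
    nlinarith [mul_nonneg h3 (mul_self_nonneg y)]
  have hz0 : 0 ≤ z := by
    by_contra! h3
    nlinarith [mul_nonneg hτ hs, mul_nonneg hτ (neg_nonneg.mpr h3.le),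
      mul_nonneg hs (neg_nonneg.mpr h3.le), mul_self_nonneg z]
  rw [hσ z hz0 (Or.inr hy) hz] at h2
  linarith

/-- The vectors `a` and `c` lie in a common closed quadrant of the Cartesian system with
axes `(1, t)` and `(-t, 1)`. -/
def Aligned (a₁ a₂ c₁ c₂ t : ℝ) : Prop :=
  0 ≤ (a₁ + t * a₂) * (c₁ + t * c₂) ∧ 0 ≤ (a₂ - t * a₁) * (c₂ - t * c₁)

/-- With `A` and `C` nonzero, divide `(A * A') * (C * C')` by `A * C > 0`. In the other cases `A'`
or `C'` vanishes. -/
lemma mul_nonneg_transfer {A A' C C' : ℝ} (hA : 0 ≤ A * A') (hC : 0 ≤ C * C')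
    (hA0 : A ≠ 0 ∨ A' = 0) (hC0 : C ≠ 0 ∨ C' = 0) (h : 0 ≤ A * C) : 0 ≤ A' * C' := by
  rcases hA0 with hA0 | hA0
  · rcases hC0 with hC0 | hC0
    · have h1 : 0 < A * C := lt_of_le_of_ne h (mul_ne_zero hA0 hC0).symm
      refine nonneg_of_mul_nonneg_right ?_ h1
      calc 0 ≤ A * A' * (C * C') := mul_nonneg hA hC
        _ = A * C * (A' * C') := by ring
    · simp [hC0]
  · simp [hA0]

/-- At the noncritical slope `τ` each coordinate is nonzero or belongs to a zero vector, and no sign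
is reversed on the way to `s`. The slope `s` may itself be critical, which is why the statement goes
one way only: alignment can be gained there. -/
lemma Aligned.of_not_between {a₁ a₂ c₁ c₂ τ s : ℝ} (hτ : 0 ≤ τ) (hs : 0 ≤ s)
    (ha : τ ≠ critSlope a₁ a₂) (hc : τ ≠ critSlope c₁ c₂)
    (ha' : 0 ≤ (τ - critSlope a₁ a₂) * (s - critSlope a₁ a₂))
    (hc' : 0 ≤ (τ - critSlope c₁ c₂) * (s - critSlope c₁ c₂))
    (h : Aligned a₁ a₂ c₁ c₂ τ) : Aligned a₁ a₂ c₁ c₂ s := by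
  have key1 : ∀ x y, 0 ≤ (τ - critSlope x y) * (s - critSlope x y) →
      0 ≤ (x + τ * y) * (x + s * y) := fun x y h =>
    mul_nonneg_of_root_not_between hτ hs
      (fun t ht h0 h1 => eq_critSlope h0 ht (Or.inl h1)) h
  -- The coordinate along `(-t, 1)` is the coordinate along `(1, t)` of the vector `(y, -x)`.
  have key2 : ∀ x y, 0 ≤ (τ - critSlope x y) * (s - critSlope x y) →
      0 ≤ (y - τ * x) * (y - s * x) := fun x y h => by
    have := mul_nonneg_of_root_not_between (x := y) (y := -x) hτ hs
      (fun t ht h0 h1 => eq_critSlope (x := x) (y := y) (by simpa [or_comm] using h0) ht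
        (Or.inr (by linarith))) h
    simpa [sub_eq_add_neg] using this
  have nz1 : ∀ x y, τ ≠ critSlope x y → x + τ * y ≠ 0 ∨ x + s * y = 0 := fun x y h => by
    by_cases h0 : x ≠ 0 ∨ y ≠ 0
    · exact Or.inl fun h1 => h (eq_critSlope h0 hτ (Or.inl h1))
    · push Not at h0
      exact Or.inr (by simp [h0])
  have nz2 : ∀ x y, τ ≠ critSlope x y → y - τ * x ≠ 0 ∨ y - s * x = 0 := fun x y h => by
    by_cases h0 : x ≠ 0 ∨ y ≠ 0
    · exact Or.inl fun h1 => h (eq_critSlope h0 hτ (Or.inr h1))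
    · push Not at h0
      exact Or.inr (by simp [h0])
  exact ⟨mul_nonneg_transfer (key1 _ _ ha') (key1 _ _ hc') (nz1 _ _ ha) (nz1 _ _ hc) h.1,
    mul_nonneg_transfer (key2 _ _ ha') (key2 _ _ hc') (nz2 _ _ ha) (nz2 _ _ hc) h.2⟩

/-! ### The value of a pair as a function of the slope -/

/-- The distance of the points with indices `i` and `j`. -/
noncomputable def ptDist (X Y : ℕ → ℝ) (i j : ℕ) : ℝ :=
  √((X i - X j) * (X i - X j) + (Y i - Y j) * (Y i - Y j))

/-- In the system of slope `t`, the point `q` lies in the rectangle of the points `r` and `v`. -/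
def InRectAt (X Y : ℕ → ℝ) (r v q : ℕ) (t : ℝ) : Prop :=
  Aligned (X q - X r) (Y q - Y r) (X v - X q) (Y v - Y q) t

open Classical in
/-- The length of the edge that `q` offers to `v` in the system of slope `t`: it is the distance
of `q` from `v` if `q` may precede `v`, and the distance of the root from `v` otherwise. -/
noncomputable def leafVal (X Y : ℕ → ℝ) (r v q : ℕ) (t : ℝ) : ℝ :=
  if q ≠ v ∧ InRectAt X Y r v q t then ptDist X Y v q else ptDist X Y v r

/-- The two products add up to `1 + t²` times the inner product of `q - r` and `v - q`. This inner
product is therefore nonnegative, and `|v - r|² ≥ |v - q|²` follows on expanding. -/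
lemma InRectAt.ptDist_le {X Y : ℕ → ℝ} {r v q : ℕ} {t : ℝ} (h : InRectAt X Y r v q t) :
    ptDist X Y v q ≤ ptDist X Y v r := by
  refine Real.sqrt_le_sqrt ?_
  obtain ⟨h1, h2⟩ := h
  set a := X q - X r with ha
  set b := Y q - Y r
  set c := X v - X q
  set d := Y v - Y q
  have h3 : 0 ≤ (1 + t * t) * (a * c + b * d) := by nlinarith
  have h4 : 0 ≤ a * c + b * d := nonneg_of_mul_nonneg_right h3 (by nlinarith [mul_self_nonneg t])
  have h5 : X v - X r = a + c := by ring
  have h6 : Y v - Y r = b + d := by ring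
  rw [h5, h6]
  nlinarith [mul_self_nonneg a, mul_self_nonneg b]

/-- The pair of critical slopes `σ`, `σ'` controls `f`: away from them `f` is locally constant
on the nonnegative reals, and at them `f` is lower semicontinuous. -/
def Controls (σ σ' : ℝ) (f : ℝ → ℝ) : Prop :=
  ∀ τ s, 0 ≤ τ → 0 ≤ s → τ ≠ σ → τ ≠ σ' → 0 ≤ (τ - σ) * (s - σ) → 0 ≤ (τ - σ') * (s - σ') →
    f s ≤ f τ

/-- Moving from `τ` to `s` can make `q` admissible, which does not increase the value, but cannot
make it inadmissible. -/
lemma controls_leafVal (X Y : ℕ → ℝ) (r v q : ℕ) :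
    Controls (critSlope (X q - X r) (Y q - Y r)) (critSlope (X v - X q) (Y v - Y q))
      (leafVal X Y r v q) := by
  intro τ s hτ hs h1 h2 h3 h4
  unfold leafVal
  split_ifs with h h' h'
  · exact le_rfl
  · exact h.2.ptDist_le
  · exact absurd ⟨h'.1, Aligned.of_not_between hτ hs h1 h2 h3 h4 h'.2⟩ h
  · exact le_rfl

lemma Controls.symm {σ σ' : ℝ} {f : ℝ → ℝ} (h : Controls σ σ' f) : Controls σ' σ f :=
  fun τ s h1 h2 h3 h4 h5 h6 => h τ s h1 h2 h4 h3 h6 h5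

/-- A number that lies above `x`, but not above `y` if `x < y`. -/
noncomputable def nextSample (x y : ℝ) : ℝ := if x < y then (x + y) / 2 else x + 1

/-- The sample lies in the open cell that starts at `σ`, and `s` lies in the closure of that cell.
-/
lemma Controls.le_nextSample {σ σ' s : ℝ} {f : ℝ → ℝ} (h : Controls σ σ' f) (h0 : 0 ≤ σ)
    (hs : σ ≤ s) (hs' : σ' ≤ σ ∨ s ≤ σ') : f s ≤ f (nextSample σ σ') := by
  unfold nextSample
  split_ifs with hlt
  · have hs'' : s ≤ σ' := hs'.resolve_left (not_le.mpr hlt)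
    refine h _ _ (by linarith) (by linarith) (by intro; linarith) (by intro; linarith) ?_ ?_
    · exact mul_nonneg (by linarith) (by linarith)
    · exact mul_nonneg_of_nonpos_of_nonpos (by linarith) (by linarith)
  · refine h _ _ (by linarith) (by linarith) (by intro; linarith) (by intro; linarith) ?_ ?_
    · exact mul_nonneg (by linarith) (by linarith)
    · exact mul_nonneg (by linarith) (by linarith)

/-- When `s` is also in the open cell, `Controls` applies in both directions. -/
lemma Controls.nextSample_eq {σ σ' s : ℝ} {f : ℝ → ℝ} (h : Controls σ σ' f) (h0 : 0 ≤ σ)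
    (hs : σ < s) (hs' : σ' ≤ σ ∨ s < σ') : f (nextSample σ σ') = f s := by
  refine le_antisymm ?_ (h.le_nextSample h0 hs.le (hs'.imp_right le_of_lt))
  unfold nextSample
  split_ifs with hlt
  · have hs'' : s < σ' := hs'.resolve_left (not_le.mpr hlt)
    refine h _ _ (by linarith) (by linarith) (by intro; linarith) (by intro; linarith) ?_ ?_
    · exact mul_nonneg (by linarith) (by linarith)
    · exact mul_nonneg_of_nonpos_of_nonpos (by linarith) (by linarith)
  · refine h _ _ (by linarith) (by linarith) (by intro; linarith) (by intro; linarith) ?_ ?_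
    · exact mul_nonneg (by linarith) (by linarith)
    · exact mul_nonneg (by linarith) (by linarith)

lemma Controls.le_zero {σ σ' s : ℝ} {f : ℝ → ℝ} (h : Controls σ σ' f) (h0 : 0 ≤ s)
    (hs : s ≤ σ) (hs' : s ≤ σ') : f s ≤ f 0 := by
  rcases h0.eq_or_lt with rfl | h0'
  · exact le_rfl
  · exact h _ _ le_rfl h0 (by intro; linarith) (by intro; linarith)
      (mul_nonneg_of_nonpos_of_nonpos (by linarith) (by linarith))
      (mul_nonneg_of_nonpos_of_nonpos (by linarith) (by linarith))

lemma Controls.zero_eq {σ σ' s : ℝ} {f : ℝ → ℝ} (h : Controls σ σ' f) (h0 : 0 ≤ s)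
    (hs : s < σ) (hs' : s < σ') : f 0 = f s :=
  le_antisymm (h _ _ h0 le_rfl hs.ne hs'.ne
      (mul_nonneg_of_nonpos_of_nonpos (by linarith) (by linarith))
      (mul_nonneg_of_nonpos_of_nonpos (by linarith) (by linarith)))
    (h.le_zero h0 hs.le hs'.le)

/-! ### Events -/

/-- The data of a sweep: for each pair `p < N` two critical slopes and a function that they
control. Each pair has the four events `p`, `p + N`, `p + 2 * N`, `p + 3 * N`. -/
structure Sweep where
  N : ℕ
  sa : ℕ → ℝ
  sc : ℕ → ℝ
  f : ℕ → ℝ → ℝ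
  sa_nonneg : ∀ p, 0 ≤ sa p
  sc_nonneg : ∀ p, 0 ≤ sc p
  controls : ∀ p, Controls (sa p) (sc p) (f p)

namespace Sweep

variable (S : Sweep)

/-- The slope at which an event happens. -/
noncomputable def slope (e : ℕ) : ℝ :=
  if e / S.N % 2 = 0 then S.sa (e % S.N) else S.sc (e % S.N)

/-- The value that an event assigns to its pair. -/
noncomputable def newVal (e : ℕ) : ℝ :=
  if e / S.N = 0 then S.f (e % S.N) (S.sa (e % S.N))
  else if e / S.N = 1 then S.f (e % S.N) (S.sc (e % S.N))
  else if e / S.N = 2 then S.f (e % S.N) (nextSample (S.sa (e % S.N)) (S.sc (e % S.N)))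
  else S.f (e % S.N) (nextSample (S.sc (e % S.N)) (S.sa (e % S.N)))

/-- The order in which the events are processed. -/
noncomputable def key (e : ℕ) : ℝ ×ₗ ℕ := toLex (S.slope e, e)

/-- `D` consists of the first events. -/
def IsPrefix (D : Finset ℕ) : Prop :=
  (∀ d ∈ D, d < 4 * S.N) ∧ ∀ d ∈ D, ∀ e < 4 * S.N, e ∉ D → S.key d < S.key e

/-- After the events in `D` the value of the pair `p` is `x`. -/
def State (D : Finset ℕ) (p : ℕ) (x : ℝ) : Prop :=
  ((∀ e ∈ D, e % S.N ≠ p) ∧ x = S.f p 0) ∨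
    ∃ e ∈ D, e % S.N = p ∧ (∀ e' ∈ D, e' % S.N = p → S.key e' ≤ S.key e) ∧ x = S.newVal e

variable {S}

lemma slope_nonneg (e : ℕ) : 0 ≤ S.slope e := by
  unfold slope
  split_ifs
  · exact S.sa_nonneg _
  · exact S.sc_nonneg _

lemma add_mul_div_eq {p N : ℕ} (g : ℕ) (hp : p < N) : (p + g * N) / N = g := by
  rw [Nat.add_mul_div_right _ _ (by omega), Nat.div_eq_of_lt hp, zero_add]

lemma add_mul_mod_eq {p N : ℕ} (g : ℕ) (hp : p < N) : (p + g * N) % N = p := by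
  rw [Nat.add_mul_mod_self_right, Nat.mod_eq_of_lt hp]

lemma slope_add {p : ℕ} (g : ℕ) (hp : p < S.N) :
    S.slope (p + g * S.N) = if g % 2 = 0 then S.sa p else S.sc p := by
  rw [slope, add_mul_div_eq g hp, add_mul_mod_eq g hp]

lemma newVal_add {p : ℕ} (g : ℕ) (hp : p < S.N) :
    S.newVal (p + g * S.N) = if g = 0 then S.f p (S.sa p) else if g = 1 then S.f p (S.sc p)
      else if g = 2 then S.f p (nextSample (S.sa p) (S.sc p))
      else S.f p (nextSample (S.sc p) (S.sa p)) := by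
  rw [newVal, add_mul_div_eq g hp, add_mul_mod_eq g hp]

lemma exists_eq_add {e : ℕ} (he : e < 4 * S.N) : ∃ g < 4, e = e % S.N + g * S.N := by
  refine ⟨e / S.N, Nat.div_lt_of_lt_mul (by linarith), ?_⟩
  rw [mul_comm]
  exact (Nat.mod_add_div e S.N).symm

lemma key_lt_key {e e' : ℕ} :
    S.key e < S.key e' ↔ S.slope e < S.slope e' ∨ S.slope e = S.slope e' ∧ e < e' := by
  simp [key, Prod.Lex.toLex_lt_toLex]

lemma slope_le_of_key_le {e e' : ℕ} (h : S.key e ≤ S.key e') : S.slope e ≤ S.slope e' := by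
  simp only [key, Prod.Lex.toLex_le_toLex] at h
  rcases h with h | h
  · exact h.le
  · exact h.1.le

/-- The value of a pair with critical slopes `σ` and `σ'` is its initial value, or has been assigned
by an event at `σ`; the later events of the pair have not happened yet. The events `e₁` and `e₃`
happen at `σ`, and the events `e₂` and `e₄` at `σ'`. -/
lemma State.cases {D : Finset ℕ} {p : ℕ} {x : ℝ} (hD : ∀ d ∈ D, d < 4 * S.N) (hp : p < S.N)
    (h : S.State D p x) :
    (∃ (σ σ' : ℝ) (e₁ e₂ e₃ e₄ : ℕ), 0 ≤ σ ∧ 0 ≤ σ' ∧ Controls σ σ' (S.f p) ∧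
      (e₁ < 2 * S.N ∧ e₂ < 2 * S.N ∧ 2 * S.N ≤ e₃ ∧ e₃ < 4 * S.N ∧ 2 * S.N ≤ e₄ ∧ e₄ < 4 * S.N) ∧
      (S.slope e₁ = σ ∧ S.slope e₃ = σ ∧ S.slope e₂ = σ' ∧ S.slope e₄ = σ') ∧
      ((e₁ ∉ D ∧ e₂ ∉ D ∧ e₃ ∉ D ∧ e₄ ∉ D ∧ x = S.f p 0) ∨
        (e₁ ∈ D ∧ e₃ ∉ D ∧ x = S.f p σ) ∨
        (e₃ ∈ D ∧ (σ' ≤ σ ∨ e₂ ∉ D) ∧ x = S.f p (nextSample σ σ')))) := by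
  have hs0 := slope_add (S := S) 0 hp
  have hs1 := slope_add (S := S) 1 hp
  have hs2 := slope_add (S := S) 2 hp
  have hs3 := slope_add (S := S) 3 hp
  have hm := fun g => add_mul_mod_eq (N := S.N) g hp
  norm_num at hs0 hs1 hs2 hs3
  rcases h with ⟨h1, h2⟩ | ⟨e, he, hep, hmax, hx⟩
  · refine ⟨S.sa p, S.sc p, p, p + S.N, p + 2 * S.N, p + 3 * S.N, S.sa_nonneg p, S.sc_nonneg p,
      S.controls p, by omega, ⟨hs0, hs2, hs1, hs3⟩, Or.inl ⟨?_, ?_, ?_, ?_, h2⟩⟩ <;>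
    intro hmem
    · exact h1 _ hmem (by simpa using hm 0)
    · exact h1 _ hmem (by simpa using hm 1)
    · exact h1 _ hmem (hm 2)
    · exact h1 _ hmem (hm 3)
  · obtain ⟨g, hg, hge⟩ := exists_eq_add (hD e he)
    rw [hep] at hge
    have hnv := newVal_add (S := S) g hp
    rw [← hge, ← hx] at hnv
    have hnot : ∀ e', e' % S.N = p → S.key e < S.key e' → e' ∉ D := fun e' h1 h2 h3 =>
      absurd (hmax e' h3 h1) (not_le.mpr h2)
    simp only [key_lt_key] at hnot
    -- The kinds `0` and `2` happen at `sa p`, the kinds `1` and `3` at `sc p`; for the latter the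
    -- two slopes exchange roles.
    interval_cases g
    · norm_num at hnv hge
      subst hge
      refine ⟨S.sa e, S.sc e, e, e + S.N, e + 2 * S.N, e + 3 * S.N, S.sa_nonneg e, S.sc_nonneg e,
        S.controls e, by omega, ⟨hs0, hs2, hs1, hs3⟩, Or.inr (Or.inl ⟨he, ?_, hnv⟩)⟩
      exact hnot _ (hm 2) (Or.inr ⟨by rw [hs0, hs2], by omega⟩)
    · norm_num at hnv hge
      subst hge
      refine ⟨S.sc p, S.sa p, p + S.N, p, p + 3 * S.N, p + 2 * S.N, S.sc_nonneg p, S.sa_nonneg p,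
        (S.controls p).symm, by omega, ⟨hs1, hs3, hs0, hs2⟩, Or.inr (Or.inl ⟨he, ?_, hnv⟩)⟩
      exact hnot _ (hm 3) (Or.inr ⟨by rw [hs1, hs3], by omega⟩)
    · norm_num at hnv hge
      subst hge
      refine ⟨S.sa p, S.sc p, p, p + S.N, p + 2 * S.N, p + 3 * S.N, S.sa_nonneg p, S.sc_nonneg p,
        S.controls p, by omega, ⟨hs0, hs2, hs1, hs3⟩, Or.inr (Or.inr ⟨he, ?_, hnv⟩)⟩
      -- If the other critical slope is larger, its first event comes after `e`, the last processed
      -- event of the pair.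
      refine (le_or_gt (S.sc p) (S.sa p)).imp_right fun hlt => ?_
      exact hnot _ (by simpa using hm 1) (Or.inl (by rwa [hs1, hs2]))
    · norm_num at hnv hge
      subst hge
      refine ⟨S.sc p, S.sa p, p + S.N, p, p + 3 * S.N, p + 2 * S.N, S.sc_nonneg p, S.sa_nonneg p,
        (S.controls p).symm, by omega, ⟨hs1, hs3, hs0, hs2⟩, Or.inr (Or.inr ⟨he, ?_, hnv⟩)⟩
      refine (le_or_gt (S.sa p) (S.sc p)).imp_right fun hlt => ?_
      exact hnot _ (by simpa using hm 0) (Or.inl (by rwa [hs0, hs3]))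

/-- The values after a prefix are upper bounds for the values at the slope of its last event. -/
lemma State.le {D : Finset ℕ} (hD : S.IsPrefix D) {e : ℕ} (he : e ∈ D)
    (hmax : ∀ d ∈ D, S.key d ≤ S.key e) {p : ℕ} (hp : p < S.N) {x : ℝ} (h : S.State D p x) :
    S.f p (S.slope e) ≤ x := by
  have hin : ∀ d ∈ D, S.slope d ≤ S.slope e := fun d hd => slope_le_of_key_le (hmax d hd)
  have hout : ∀ d < 4 * S.N, d ∉ D → S.slope e ≤ S.slope d := fun d hd hd' =>
    slope_le_of_key_le (hD.2 e he d hd hd').le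
  obtain ⟨σ, σ', e₁, e₂, e₃, e₄, h0, h0', hc, hlt, ⟨hs1, hs3, hs2, hs4⟩, hcase⟩ := h.cases hD.1 hp
  rcases hcase with ⟨h1, h2, h3, h4, rfl⟩ | ⟨h1, h3, rfl⟩ | ⟨h3, h2, rfl⟩
  · exact hc.le_zero (slope_nonneg _) (hs1 ▸ hout e₁ (by omega) h1) (hs2 ▸ hout e₂ (by omega) h2)
  · have : S.slope e = σ := le_antisymm (hs3 ▸ hout e₃ (by omega) h3) (hs1 ▸ hin e₁ h1)
    rw [this]
  · exact hc.le_nextSample h0 (hs3 ▸ hin e₃ h3)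
      (h2.imp_right fun h2 => hs2 ▸ hout e₂ (by omega) h2)

/-- The events before slope `t`, and those of the first two kinds at slope `t`. -/
noncomputable def eventsUpTo (S : Sweep) (t : ℝ) : Finset ℕ :=
  open Classical in (Finset.range (4 * S.N)).filter fun e =>
    S.slope e < t ∨ S.slope e = t ∧ e < 2 * S.N

lemma mem_eventsUpTo {t : ℝ} {e : ℕ} : e ∈ S.eventsUpTo t ↔
    e < 4 * S.N ∧ (S.slope e < t ∨ S.slope e = t ∧ e < 2 * S.N) := by
  simp [eventsUpTo]

lemma isPrefix_eventsUpTo (t : ℝ) : S.IsPrefix (S.eventsUpTo t) := by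
  refine ⟨fun d hd => (mem_eventsUpTo.mp hd).1, fun d hd e he hne => ?_⟩
  have hd' := (mem_eventsUpTo.mp hd).2
  have h1 : ¬ (S.slope e < t ∨ S.slope e = t ∧ e < 2 * S.N) := fun h =>
    hne (mem_eventsUpTo.mpr ⟨he, h⟩)
  push Not at h1
  rw [key_lt_key]
  rcases hd' with h | ⟨h, h'⟩
  · exact Or.inl (h.trans_le h1.1)
  · rcases h1.1.eq_or_lt with h2 | h2
    · exact Or.inr ⟨h.trans h2, h'.trans_le (h1.2 h2.symm)⟩
    · exact Or.inl (h.trans_lt h2)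

/-- The values after the events up to slope `t` are the values at `t`. -/
lemma State.eq_of_eventsUpTo {t : ℝ} (ht : 0 ≤ t) {p : ℕ} (hp : p < S.N) {x : ℝ}
    (h : S.State (S.eventsUpTo t) p x) : x = S.f p t := by
  obtain ⟨σ, σ', e₁, e₂, e₃, e₄, h0, h0', hc, hlt, ⟨hs1, hs3, hs2, hs4⟩, hcase⟩ :=
    h.cases (isPrefix_eventsUpTo t).1 hp
  have hout : ∀ d < 2 * S.N, d ∉ S.eventsUpTo t → t < S.slope d := fun d hd hd' => by
    by_contra! hle
    refine hd' (mem_eventsUpTo.mpr ⟨by omega, ?_⟩)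
    exact hle.lt_or_eq.imp_right fun h => ⟨h, hd⟩
  rcases hcase with ⟨h1, h2, h3, h4, rfl⟩ | ⟨h1, h3, rfl⟩ | ⟨h3, h2, rfl⟩
  · exact hc.zero_eq ht (hs1 ▸ hout e₁ (by omega) h1) (hs2 ▸ hout e₂ (by omega) h2)
  -- The later event at `σ` would have been processed if `σ < t`, so `σ = t` and the stored value is
  -- the one at `t`.
  · have h5 : ¬ σ < t := fun hlt' => h3 (mem_eventsUpTo.mpr ⟨by omega, Or.inl (hs3 ▸ hlt')⟩)
    have h6 := (mem_eventsUpTo.mp h1).2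
    rw [hs1] at h6
    rw [(h6.resolve_left h5).1]
  · have h6 := (mem_eventsUpTo.mp h3).2
    rw [hs3] at h6
    refine hc.nextSample_eq h0 (h6.resolve_right fun h => by omega) ?_
    exact h2.imp_right fun h2 => hs2 ▸ hout e₂ (by omega) h2

lemma state_empty (p : ℕ) : S.State ∅ p (S.f p 0) := Or.inl ⟨by simp, rfl⟩

lemma isPrefix_empty : S.IsPrefix ∅ := ⟨by simp, by simp⟩

/-- The event `e` is the next one after those in `D`. -/
def IsNext (S : Sweep) (D : Finset ℕ) (e : ℕ) : Prop :=
  e < 4 * S.N ∧ e ∉ D ∧ ∀ e' < 4 * S.N, e' ∉ D → S.key e ≤ S.key e'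

lemma isPrefix_insert {D : Finset ℕ} (hD : S.IsPrefix D) {e : ℕ} (he : S.IsNext D e) :
    S.IsPrefix (insert e D) := by
  refine ⟨fun d hd => ?_, fun d hd e' he' hne => ?_⟩
  · rcases Finset.mem_insert.mp hd with rfl | hd
    · exact he.1
    · exact hD.1 d hd
  · rw [Finset.mem_insert, not_or] at hne
    rcases Finset.mem_insert.mp hd with rfl | hd
    · refine lt_of_le_of_ne (he.2.2 e' he' hne.2) fun h => hne.1 ?_
      exact (congrArg (fun z => (ofLex z).2) h).symm
    · exact hD.2 d hd e' he' hne.2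

lemma IsPrefix.key_le_of_isNext {D : Finset ℕ} (hD : S.IsPrefix D) {e : ℕ} (he : S.IsNext D e) :
    ∀ d ∈ insert e D, S.key d ≤ S.key e := by
  intro d hd
  rcases Finset.mem_insert.mp hd with rfl | hd
  · exact le_rfl
  · exact (hD.2 d hd e he.1 he.2.1).le

lemma state_insert {D : Finset ℕ} (hD : S.IsPrefix D) {e : ℕ} (he : S.IsNext D e) :
    S.State (insert e D) (e % S.N) (S.newVal e) :=
  Or.inr ⟨e, Finset.mem_insert_self _ _, rfl, fun e' he' _ => hD.key_le_of_isNext he e' he', rfl⟩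

lemma State.insert_of_ne {D : Finset ℕ} {p : ℕ} {x : ℝ} (h : S.State D p x) {e : ℕ}
    (hp : e % S.N ≠ p) : S.State (insert e D) p x := by
  rcases h with ⟨h1, h2⟩ | ⟨d, hd, hdp, hmax, hx⟩
  · refine Or.inl ⟨fun e' he' => ?_, h2⟩
    rcases Finset.mem_insert.mp he' with rfl | he'
    · exact hp
    · exact h1 e' he'
  · refine Or.inr ⟨d, Finset.mem_insert_of_mem hd, hdp, fun e' he' hep => ?_, hx⟩
    rcases Finset.mem_insert.mp he' with rfl | he'
    · exact absurd hep hp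
    · exact hmax e' he' hep

/-- A prefix of a prefix that has grown by one event has not grown or is everything. -/
lemma IsPrefix.subset_or_eq {D D' : Finset ℕ} (hD : S.IsPrefix D) (hD' : S.IsPrefix D') {e : ℕ}
    (he : S.IsNext D e) (hsub : D' ⊆ insert e D) : D' ⊆ D ∨ D' = insert e D := by
  by_cases hmem : e ∈ D'
  · refine Or.inr (hsub.antisymm fun d hd => ?_)
    by_contra hd'
    have h1 := hD'.2 e hmem d ((isPrefix_insert hD he).1 d hd) hd'
    exact absurd (hD.key_le_of_isNext he d hd) (not_le.mpr h1)
  · refine Or.inl fun d hd => ?_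
    rcases Finset.mem_insert.mp (hsub hd) with rfl | h
    · exact absurd hd hmem
    · exact h

end Sweep

namespace RealRAM

/-! ### Tournament trees -/

/-- The nodes `1, …, N - 1` hold the minima of their children; the leaf `N + x` holds `f x`. -/
def IsTournament (A : ℕ → ℝ ×ₗ ℕ) (N : ℕ) (f : ℕ → ℝ ×ₗ ℕ) : Prop :=
  (∀ j, 1 ≤ j → j < N → A j = min (A (2 * j)) (A (2 * j + 1))) ∧ ∀ x < N, A (N + x) = f x

/-- Climb from `j` to `j / 2` until the root `1` is reached. The number `N` of leaves need not be a
power of two. -/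
lemma IsTournament.le {A : ℕ → ℝ ×ₗ ℕ} {N : ℕ} {f : ℕ → ℝ ×ₗ ℕ} (h : IsTournament A N f) :
    ∀ j, 1 ≤ j → j < 2 * N → A 1 ≤ A j := by
  intro j
  induction j using Nat.strong_induction_on with
  | _ j ih =>
    intro hj hjN
    rcases hj.eq_or_lt with rfl | hj'
    · exact le_rfl
    · refine (ih (j / 2) (by omega) (by omega) (by omega)).trans ?_
      rw [h.1 (j / 2) (by omega) (by omega)]
      rcases Nat.even_or_odd' j with ⟨c, rfl | rfl⟩
      · rw [show 2 * c / 2 = c by omega]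
        exact min_le_left _ _
      · rw [show (2 * c + 1) / 2 = c by omega]
        exact min_le_right _ _

/-- Descend to the child that supplies the minimum; the distance `m` of the index from `2 * N`
decreases. -/
lemma IsTournament.exists_eq {A : ℕ → ℝ ×ₗ ℕ} {N : ℕ} {f : ℕ → ℝ ×ₗ ℕ} (h : IsTournament A N f) :
    ∀ m j, 1 ≤ j → j + m = 2 * N → j < 2 * N → ∃ x < N, A j = f x := by
  intro m
  induction m using Nat.strong_induction_on with
  | _ m ih =>
    intro j hj hm hjN
    by_cases hjN' : j < N
    · rw [h.1 j hj hjN']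
      rcases min_choice (A (2 * j)) (A (2 * j + 1)) with h' | h' <;> rw [h']
      · exact ih (2 * N - 2 * j) (by omega) _ (by omega) (by omega) (by omega)
      · exact ih (2 * N - (2 * j + 1)) (by omega) _ (by omega) (by omega) (by omega)
    · refine ⟨j - N, by omega, ?_⟩
      rw [← h.2 _ (by omega)]
      congr 1
      omega

lemma IsTournament.root_le {A : ℕ → ℝ ×ₗ ℕ} {N : ℕ} {f : ℕ → ℝ ×ₗ ℕ} (h : IsTournament A N f)
    {x : ℕ} (hx : x < N) : A 1 ≤ f x := by
  rw [← h.2 x hx]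
  exact h.le _ (by omega) (by omega)

lemma IsTournament.exists_root_eq {A : ℕ → ℝ ×ₗ ℕ} {N : ℕ} {f : ℕ → ℝ ×ₗ ℕ}
    (h : IsTournament A N f) (hN : 0 < N) : ∃ x < N, A 1 = f x :=
  h.exists_eq (2 * N - 1) 1 le_rfl (by omega) (by omega)

lemma IsTournament.congr {A A' : ℕ → ℝ ×ₗ ℕ} {N : ℕ} {f : ℕ → ℝ ×ₗ ℕ} (h : IsTournament A N f)
    (hA : ∀ j, 1 ≤ j → j < 2 * N → A' j = A j) : IsTournament A' N f := by
  refine ⟨fun j h1 h2 => ?_, fun x hx => ?_⟩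
  · rw [hA _ h1 (by omega), hA _ (by omega) (by omega), hA _ (by omega) (by omega), h.1 j h1 h2]
  · rw [hA _ (by omega) (by omega), h.2 x hx]

/-- The node `j` of the tournament tree at address `β` in the arrays `tA` and `iA`. -/
noncomputable def Mem.node (s : Mem) (tA iA β j : ℕ) : ℝ ×ₗ ℕ :=
  toLex (s.real tA (β + j), s.nat iA (β + j))

/-- The first cells of the natural array `15` hold the halves of their indices. -/
def HalfTable (s : Mem) (m : ℕ) : Prop := ∀ j < m, s.nat 15 j = j / 2

/-- The address of the current node. -/
abbrev nodeAddr : NatExpr := .add (reg 16) (reg 17)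

/-- The address of the left child of the current node. -/
abbrev leftAddr : NatExpr := .add (reg 16) (.add (reg 17) (reg 17))

/-- The address of the right child of the current node. -/
abbrev rightAddr : NatExpr := .add (reg 16) (.add (.add (reg 17) (reg 17)) (.const 1))

/-- In the lexicographic order, the left child of the current node is at most the right child. -/
def childTest (tA iA : ℕ) : Test :=
  .and (.realLe (.get tA leftAddr) (.get tA rightAddr))
    (.not (.and (.realLe (.get tA rightAddr) (.get tA leftAddr))
      (.not (.natLe (.get iA leftAddr) (.get iA rightAddr)))))

/-- Recompute the parent of the current node, and make it the current node. -/
def siftStep (tA iA : ℕ) : Prog :=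
  .seq (.setNat 17 (.const 0) (.get 15 (reg 17)))
    (.ite (childTest tA iA)
      (.seq (.setReal tA nodeAddr (.get tA leftAddr)) (.setNat iA nodeAddr (.get iA leftAddr)))
      (.seq (.setReal tA nodeAddr (.get tA rightAddr)) (.setNat iA nodeAddr (.get iA rightAddr))))

/-- Recompute all ancestors of the current node. -/
def sift (tA iA : ℕ) : Prog := .while (.natLe (.const 2) (reg 17)) (siftStep tA iA)

/-- Tests have no disjunction, so the lexicographic order is expressed as `x ≤ y` together with the
negation of "`y ≤ x` and the indices are in the wrong order". -/
lemma childTest_holds {s : Mem} {tA iA β i : ℕ} (hβ : s.nat 16 0 = β) (hi : s.nat 17 0 = i) :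
    (childTest tA iA).Holds s ↔ s.node tA iA β (2 * i) ≤ s.node tA iA β (2 * i + 1) := by
  simp only [childTest, Test.Holds, RealExpr.eval, NatExpr.eval, hβ, hi, Mem.node,
    Prod.Lex.toLex_le_toLex, ← two_mul]
  constructor
  · rintro ⟨h1, h2⟩
    rcases h1.lt_or_eq with h | h
    · exact Or.inl h
    · refine Or.inr ⟨h, ?_⟩
      by_contra h3
      exact h2 ⟨h.ge, h3⟩
  · rintro (h | ⟨h1, h2⟩)
    · exact ⟨h.le, fun h' => absurd h'.1 (not_le.mpr h)⟩
    · exact ⟨h1.le, fun h' => h'.2 h2⟩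

lemma siftStep_spec {s : Mem} {tA iA β i : ℕ} (h17 : iA ≠ 17)
    (hβ : s.nat 16 0 = β) (hi : s.nat 17 0 = i) (hH : s.nat 15 i = i / 2) :
    let s' := (siftStep tA iA).exec s
    s'.nat 17 0 = i / 2 ∧
      s'.node tA iA β (i / 2) =
        min (s.node tA iA β (2 * (i / 2))) (s.node tA iA β (2 * (i / 2) + 1)) ∧
      ∀ a, a ≠ β + i / 2 → s'.real tA a = s.real tA a ∧ s'.nat iA a = s.nat iA a := by
  intro s'
  set s₁ := s.setNat 17 0 (i / 2) with hs₁
  have hn : ∀ a, s₁.real tA a = s.real tA a ∧ s₁.nat iA a = s.nat iA a := fun a => by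
    rw [hs₁, Mem.setNat_nat_of_ne _ _ _ h17]
    exact ⟨rfl, rfl⟩
  have hnode : ∀ j, s₁.node tA iA β j = s.node tA iA β j := fun j => by
    rw [Mem.node, Mem.node, (hn _).1, (hn _).2]
  have hβ₁ : s₁.nat 16 0 = β := by simp [hs₁, hβ]
  have hi₁ : s₁.nat 17 0 = i / 2 := by simp [hs₁]
  have hex : s' = if s₁.node tA iA β (2 * (i / 2)) ≤ s₁.node tA iA β (2 * (i / 2) + 1)
      then (s₁.setReal tA (β + i / 2) (s₁.real tA (β + 2 * (i / 2)))).setNat iA (β + i / 2)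
        (s₁.nat iA (β + 2 * (i / 2)))
      else (s₁.setReal tA (β + i / 2) (s₁.real tA (β + (2 * (i / 2) + 1)))).setNat iA (β + i / 2)
        (s₁.nat iA (β + (2 * (i / 2) + 1))) := by
    have h0 : (Prog.setNat 17 (.const 0) (.get 15 (reg 17))).exec s = s₁ := by
      simp [Prog.exec, NatExpr.eval, hi, hH, hs₁]
    simp only [s', siftStep]
    rw [Prog.exec, h0, Prog.exec]
    simp only [childTest_holds hβ₁ hi₁]
    congr 1 <;>
      simp [Prog.exec, NatExpr.eval, RealExpr.eval, hβ₁, hi₁, two_mul]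
  rw [hex]
  split_ifs with hle
  · rw [hnode, hnode] at hle
    refine ⟨by simp [h17.symm, hi₁], ?_, fun a ha => ?_⟩
    · rw [min_eq_left hle, ← hnode]
      simp [Mem.node]
    · rw [← (hn a).1, ← (hn a).2]
      simp [ha]
  · rw [hnode, hnode] at hle
    refine ⟨by simp [h17.symm, hi₁], ?_, fun a ha => ?_⟩
    · rw [min_eq_right (not_le.mp hle).le, ← hnode]
      simp [Mem.node]
    · rw [← (hn a).1, ← (hn a).2]
      simp [ha]

/-- Throughout, the only nodes that may violate the minimum rule are proper ancestors of the current
node, and at the root there are none. Only internal nodes are written, at the addresses strictly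
between `β` and `β + N`; this keeps the leaves and the neighbouring trees intact. -/
lemma sift_spec {s : Mem} {tA iA β N x m : ℕ} {f : ℕ → ℝ ×ₗ ℕ} (h15 : iA ≠ 15) (h16 : iA ≠ 16)
    (h17 : iA ≠ 17) (hβ : s.nat 16 0 = β) (hi : s.nat 17 0 = N + x) (hx : x < N)
    (hm : 2 * N ≤ m) (hH : HalfTable s m)
    (hnodes : ∀ j, 1 ≤ j → j < N → (∀ k, j ≠ (N + x) / 2 ^ (k + 1)) →
      s.node tA iA β j = min (s.node tA iA β (2 * j)) (s.node tA iA β (2 * j + 1)))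
    (hleaves : ∀ y < N, s.node tA iA β (N + y) = f y) :
    Ends (sift tA iA) s
      (Nat.log 2 m * ((Test.natLe (.const 2) (reg 17)).time + (siftStep tA iA).maxTime) +
        (Test.natLe (.const 2) (reg 17)).time)
      fun s' => IsTournament (s'.node tA iA β) N f ∧
        ∀ a, (a ≤ β ∨ β + N ≤ a) → s'.real tA a = s.real tA a ∧ s'.nat iA a = s.nat iA a := by
  set i₀ := N + x with hi₀
  have hi₀0 : i₀ ≠ 0 := by omega
  refine Ends.mono (ends_while (Nat.log 2 i₀) (siftStep tA iA).maxTime (fun k s' =>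
    s'.nat 17 0 = i₀ / 2 ^ k ∧
    (∀ j, 1 ≤ j → j < N → (∀ l, j ≠ i₀ / 2 ^ k / 2 ^ (l + 1)) →
      s'.node tA iA β j = min (s'.node tA iA β (2 * j)) (s'.node tA iA β (2 * j + 1))) ∧
    (∀ y < N, s'.node tA iA β (N + y) = f y) ∧
    ∀ a, (a ≤ β ∨ β + N ≤ a) → s'.real tA a = s.real tA a ∧ s'.nat iA a = s.nat iA a)
    ?_ ?_ ?_) ?_ ?_
  · refine ⟨by simpa using hi, ?_, hleaves, fun a _ => ⟨rfl, rfl⟩⟩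
    simpa using hnodes
  · rintro k s' hk hf ⟨h1, h2, h3, h4⟩
    set i := i₀ / 2 ^ k with hik
    have hi2 : 2 ≤ i := by
      rw [hik, Nat.le_div_iff_mul_le (by positivity), mul_comm, ← pow_succ]
      exact (Nat.pow_le_pow_right (by norm_num) hk).trans (Nat.pow_log_le_self 2 hi₀0)
    have hilt : i < 2 * N := (Nat.div_le_self _ _).trans_lt (by omega)
    have hβ' : s'.nat 16 0 = β := by
      rw [hf.1 16 (by simp [siftStep, Prog.WritesNat, h16.symm]), hβ]
    have hH' : s'.nat 15 i = i / 2 := by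
      rw [hf.1 15 (by simp [siftStep, Prog.WritesNat, h15.symm]), hH i (by omega)]
    refine ⟨by simpa [Test.Holds, NatExpr.eval, h1] using hi2, ?_⟩
    refine ends_of_loopFree (by simp [siftStep, Prog.LoopFree]) ?_
    obtain ⟨g1, g2, g3⟩ := siftStep_spec (tA := tA) h17 hβ' h1 hH'
    set s'' := (siftStep tA iA).exec s'
    have hnode : ∀ j, j ≠ i / 2 → s''.node tA iA β j = s'.node tA iA β j := fun j hj => by
      obtain ⟨e1, e2⟩ := g3 (β + j) (by omega)
      rw [Mem.node, Mem.node, e1, e2]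
    refine ⟨by rw [g1, hik, Nat.div_div_eq_div_mul, pow_succ], ?_, ?_, ?_⟩
    · intro j hj1 hj2 hj
      have hpow : i₀ / 2 ^ (k + 1) = i / 2 := by rw [hik, Nat.div_div_eq_div_mul, pow_succ]
      rw [hpow] at hj
      have hj' := hj 0
      rw [zero_add, pow_one] at hj'
      rw [hnode (2 * j) (by omega), hnode (2 * j + 1) (by omega)]
      by_cases hji : j = i / 2
      · rw [hji, g2]
      · rw [hnode j hji]
        refine h2 j hj1 hj2 fun l => ?_
        rcases l with _ | l
        · simpa using hji
        · have := hj l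
          rwa [Nat.div_div_eq_div_mul, ← pow_succ'] at this
    · intro y hy
      rw [hnode _ (by omega), h3 y hy]
    · intro a ha
      obtain ⟨e1, e2⟩ := g3 a (by omega)
      rw [e1, e2]
      exact h4 a ha
  · rintro s' hf ⟨h1, -⟩
    have : i₀ < 2 ^ Nat.log 2 i₀ * 2 := by
      rw [← pow_succ]; exact Nat.lt_pow_succ_log_self (by norm_num) _
    have : i₀ / 2 ^ Nat.log 2 i₀ < 2 := Nat.div_lt_of_lt_mul this
    simp only [Test.Holds, NatExpr.eval, h1]
    omega
  · gcongr
    omega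
  · rintro s' hf ⟨h1, h2, h3, h4⟩
    refine ⟨⟨fun j hj1 hj2 => h2 j hj1 hj2 fun l => ?_, h3⟩, h4⟩
    have : i₀ < 2 ^ Nat.log 2 i₀ * 2 := by
      rw [← pow_succ]; exact Nat.lt_pow_succ_log_self (by norm_num) _
    have : i₀ / 2 ^ Nat.log 2 i₀ < 2 := Nat.div_lt_of_lt_mul this
    rw [pow_succ', ← Nat.div_div_eq_div_mul, show i₀ / 2 ^ Nat.log 2 i₀ / 2 = 0 by omega]
    simp
    omega

/-- The number of steps of `sift` for trees with at most `m` nodes. -/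
def siftTime (tA iA m : ℕ) : ℕ :=
  Nat.log 2 m * ((Test.natLe (.const 2) (reg 17)).time + (siftStep tA iA).maxTime) +
    (Test.natLe (.const 2) (reg 17)).time

/-- Restore a tournament tree after its leaf `N + x` has been overwritten. -/
lemma sift_update {s₀ s : Mem} {tA iA β N x m : ℕ} {f : ℕ → ℝ ×ₗ ℕ} (h15 : iA ≠ 15)
    (h16 : iA ≠ 16) (h17 : iA ≠ 17) (hβ : s.nat 16 0 = β) (hi : s.nat 17 0 = N + x) (hx : x < N)
    (hm : 2 * N ≤ m) (hH : HalfTable s m) (hT : IsTournament (s₀.node tA iA β) N f)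
    (hs : ∀ j, 1 ≤ j → j < 2 * N → j ≠ N + x → s.node tA iA β j = s₀.node tA iA β j) :
    Ends (sift tA iA) s (siftTime tA iA m)
      fun s' => IsTournament (s'.node tA iA β) N
          (Function.update f x (s.node tA iA β (N + x))) ∧
        ∀ a, (a ≤ β ∨ β + N ≤ a) → s'.real tA a = s.real tA a ∧ s'.nat iA a = s.nat iA a := by
  refine sift_spec h15 h16 h17 hβ hi hx hm hH ?_ ?_
  · intro j h1 h2 h3
    have h4 := h3 0
    rw [zero_add, pow_one] at h4
    rw [hs j h1 (by omega) (by omega), hs _ (by omega) (by omega) (by omega),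
      hs _ (by omega) (by omega) (by omega), hT.1 j h1 h2]
  · intro y hy
    by_cases hyx : y = x
    · rw [hyx, Function.update_self]
    · rw [Function.update_of_ne hyx, hs _ (by omega) (by omega) (by omega), hT.2 y hy]

end RealRAM

namespace RealRAM

/-! ### Tables of pairs, events and halves -/

/-- The number of points. -/
abbrev numPts : NatExpr := .get 0 (.const 0)

/-- The loop that lists all pairs of points. The pair `p = v * n + q` has the entries `v`, `q`,
`v * (2 * n)` and `n + q` in the natural arrays `10`, `11`, `12` and `13`. -/
def pairStep : Prog :=
  block [.setNat 10 (reg 6) (reg 4), .setNat 11 (reg 6) (reg 5), .setNat 12 (reg 6) (reg 9),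
    .setNat 13 (reg 6) (.add numPts (reg 5)), .setNat 6 (.const 0) (.add (reg 6) (.const 1)),
    .setNat 5 (.const 0) (.add (reg 5) (.const 1)),
    .ite (.natLe numPts (reg 5))
      (block [.setNat 5 (.const 0) (.const 0), .setNat 4 (.const 0) (.add (reg 4) (.const 1)),
        .setNat 9 (.const 0) (.add (reg 9) (.add numPts numPts))]) .skip]

/-- The loop that lists all pairs of points. -/
def pairLoop : Prog := .while (.not (.natLe numPts (reg 4))) pairStep

/-- The pairs below `k` have been listed. -/
def PairTable (n : ℕ) (s : Mem) (k : ℕ) : Prop :=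
  ∀ p < k, s.nat 10 p = p / n ∧ s.nat 11 p = p % n ∧ s.nat 12 p = p / n * (2 * n) ∧
    s.nat 13 p = n + p % n

/-- The machine neither multiplies nor divides natural numbers, so `k / n`, `k % n` and `k / n * (2
* n)` are kept up to date in counters. -/
lemma pairLoop_spec {s : Mem} {n : ℕ} (hn : s.nat 0 0 = n) (h4 : s.nat 4 0 = 0)
    (h5 : s.nat 5 0 = 0) (h6 : s.nat 6 0 = 0) (h9 : s.nat 9 0 = 0) :
    Ends pairLoop s (n * n * ((Test.not (.natLe numPts (reg 4))).time + pairStep.maxTime) +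
        (Test.not (.natLe numPts (reg 4))).time)
      fun s' => s'.nat 6 0 = n * n ∧ PairTable n s' (n * n) := by
  refine Ends.mono (ends_while (n * n) pairStep.maxTime (fun k s' =>
    s'.nat 6 0 = k ∧ s'.nat 4 0 = k / n ∧ s'.nat 5 0 = k % n ∧ s'.nat 9 0 = k / n * (2 * n) ∧
      PairTable n s' k) ?_ ?_ ?_) le_rfl ?_
  · exact ⟨h6, by simpa using h4, by simpa using h5, by simpa using h9, fun p hp => by omega⟩
  · rintro k s' hk hf ⟨g6, g4, g5, g9, gT⟩
    have gn : s'.nat 0 0 = n := by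
      rw [hf.1 0 (by simp [pairStep, block, Prog.WritesNat]), hn]
    have hn0 : 0 < n := Nat.pos_of_ne_zero fun h => by simp [h] at hk
    have hmod := Nat.mod_lt k hn0
    have hdiv : k / n < n := Nat.div_lt_of_lt_mul hk
    have hk' := Nat.div_add_mod k n
    have hT : ∀ (s₁ : Mem), s₁.nat 10 = Function.update (s'.nat 10) k (k / n) →
        s₁.nat 11 = Function.update (s'.nat 11) k (k % n) →
        s₁.nat 12 = Function.update (s'.nat 12) k (k / n * (2 * n)) →
        s₁.nat 13 = Function.update (s'.nat 13) k (n + k % n) → PairTable n s₁ (k + 1) := by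
      intro s₁ e0 e1 e2 e3 p hp
      rw [e0, e1, e2, e3]
      rcases (Nat.lt_succ_iff.mp hp).eq_or_lt with rfl | hp'
      · simp
      · simp only [Function.update_of_ne hp'.ne]
        exact gT p hp'
    refine ⟨by simpa [Test.Holds, NatExpr.eval, gn, g4] using hdiv, ?_⟩
    refine ends_of_loopFree (by simp [pairStep, block, Prog.LoopFree]) ?_
    -- The remainder counter overflows exactly when the first point of the pair changes.
    by_cases hwrap : n ≤ k % n + 1
    · have e1 : (k + 1) / n = k / n + 1 :=
        Nat.div_eq_of_lt_le (by nlinarith) (by nlinarith)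
      have e2 : (k + 1) % n = 0 := by
        have := Nat.div_add_mod (k + 1) n
        rw [e1] at this
        nlinarith
      simp only [pairStep, block, Prog.exec, Test.Holds, NatExpr.eval]
      simp only [ne_eq, not_false_eq_true, Mem.setNat_nat_self,
        Mem.setNat_nat_of_ne, Nat.reduceEqDiff, OfNat.zero_ne_ofNat, Function.update_self, gn, g4,
        g5, g6, g9, hwrap, if_true, e1, e2]
      refine ⟨trivial, trivial, trivial, by ring, hT _ ?_ ?_ ?_ ?_⟩ <;> simp
    · have e1 : (k + 1) / n = k / n :=
        Nat.div_eq_of_lt_le (by nlinarith) (by nlinarith)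
      have e2 : (k + 1) % n = k % n + 1 := by
        have := Nat.div_add_mod (k + 1) n
        rw [e1] at this
        linarith
      simp only [pairStep, block, Prog.exec, Test.Holds, NatExpr.eval]
      simp only [ne_eq, not_false_eq_true, Mem.setNat_nat_self,
        Mem.setNat_nat_of_ne, Nat.reduceEqDiff, OfNat.zero_ne_ofNat, Function.update_self, gn, g4,
        g5, g6, g9, hwrap, if_false, e1, e2]
      refine ⟨trivial, trivial, trivial, trivial, hT _ ?_ ?_ ?_ ?_⟩ <;> simp
  · rintro s' hf ⟨-, g4, -⟩
    have gn : s'.nat 0 0 = n := by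
      rw [hf.1 0 (by simp [pairStep, block, Prog.WritesNat]), hn]
    have : n * n / n = n := by
      rcases Nat.eq_zero_or_pos n with rfl | h
      · simp
      · exact Nat.mul_div_cancel _ h
    simp [Test.Holds, NatExpr.eval, gn, g4, this]
  · rintro s' hf ⟨g6, -, -, -, gT⟩
    exact ⟨g6, gT⟩

/-- Record the numbers of pairs and of events, and reset the counter. -/
def setSizes : Prog :=
  block [.setNat 7 (.const 0) (reg 6),
    .setNat 8 (.const 0) (.add (.add (reg 6) (reg 6)) (.add (reg 6) (reg 6))),
    .setNat 6 (.const 0) (.const 0)]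

/-- One step of the computation of the table of halves. -/
def halfStep : Prog :=
  block [.setNat 15 (.add (reg 6) (reg 6)) (reg 6),
    .setNat 15 (.add (.add (reg 6) (reg 6)) (.const 1)) (reg 6),
    .setNat 6 (.const 0) (.add (reg 6) (.const 1))]

/-- The counter is less than the number of events. -/
abbrev eventsLeft : Test := .not (.natLe (reg 8) (reg 6))

/-- The counter is less than the number of pairs. -/
abbrev pairsLeft : Test := .not (.natLe (reg 7) (reg 6))

/-- A tree with `M` leaves has its nodes below `2 * M`, so with `M` the number of events the table
serves the tree of events; the trees of the points are smaller. -/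
lemma halfLoop_spec {s : Mem} {M : ℕ} (hM : s.nat 8 0 = M) (h6 : s.nat 6 0 = 0) :
    Ends (.while eventsLeft halfStep) s (M * (eventsLeft.time + halfStep.maxTime) + eventsLeft.time)
      fun s' => HalfTable s' (2 * M) := by
  refine Ends.mono (ends_while M halfStep.maxTime (fun k s' =>
    s'.nat 6 0 = k ∧ HalfTable s' (2 * k)) ?_ ?_ ?_) le_rfl (fun _ _ h => h.2)
  · exact ⟨h6, fun p hp => by omega⟩
  · rintro k s' hk hf ⟨g6, gT⟩
    have gM : s'.nat 8 0 = M := by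
      rw [hf.1 8 (by simp [halfStep, block, Prog.WritesNat]), hM]
    refine ⟨by simpa [Test.Holds, NatExpr.eval, gM, g6] using hk, ?_⟩
    refine ends_of_loopFree (by simp [halfStep, block, Prog.LoopFree]) ?_
    simp only [halfStep, block, Prog.exec, NatExpr.eval]
    refine ⟨by simp [g6], fun j hj => ?_⟩
    simp only [ne_eq, not_false_eq_true, Mem.setNat_nat_self,
        Mem.setNat_nat_of_ne, Nat.reduceEqDiff, Function.update_apply, g6]
    split_ifs with h1 h2
    · omega
    · omega
    · exact gT j (by omega)
  · rintro s' hf ⟨g6, -⟩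
    have gM : s'.nat 8 0 = M := by
      rw [hf.1 8 (by simp [halfStep, block, Prog.WritesNat]), hM]
    simp [Test.Holds, NatExpr.eval, gM, g6]

/-- The first point of the current pair. -/
abbrev curV : NatExpr := .get 10 (reg 6)

/-- The second point of the current pair. -/
abbrev curQ : NatExpr := .get 11 (reg 6)

/-- The root. -/
abbrev rootIdx : NatExpr := .get 0 (.const 1)

/-- The difference of the coordinates in the real array `a` of the points `i` and `j`. -/
abbrev diff (a : ℕ) (i j : NatExpr) : RealExpr := .sub (.get a i) (.get a j)

/-- The distance of the points `i` and `j`. -/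
def distExpr (i j : NatExpr) : RealExpr :=
  .sqrt (.add (.mul (diff 0 i j) (diff 0 i j)) (.mul (diff 1 i j) (diff 1 i j)))

lemma eval_distExpr (s : Mem) (i j : NatExpr) :
    (distExpr i j).eval s = ptDist (s.real 0) (s.real 1) (i.eval s) (j.eval s) := rfl

/-- The test whether the second point of the current pair may precede the first one in the
system of slope `t`. -/
def pairTest (t : RealExpr) : Test :=
  .and (.not (.and (.natLe curQ curV) (.natLe curV curQ)))
    (.and
      (.realLe (.const 0) (.mul (.add (diff 0 curQ rootIdx) (.mul t (diff 1 curQ rootIdx)))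
        (.add (diff 0 curV curQ) (.mul t (diff 1 curV curQ)))))
      (.realLe (.const 0) (.mul (.sub (diff 1 curQ rootIdx) (.mul t (diff 0 curQ rootIdx)))
        (.sub (diff 1 curV curQ) (.mul t (diff 0 curV curQ))))))

lemma pairTest_holds (s : Mem) (t : RealExpr) : (pairTest t).Holds s ↔
    s.nat 11 (s.nat 6 0) ≠ s.nat 10 (s.nat 6 0) ∧ InRectAt (s.real 0) (s.real 1) (s.nat 0 1)
      (s.nat 10 (s.nat 6 0)) (s.nat 11 (s.nat 6 0)) (t.eval s) := by
  simp only [pairTest, Test.Holds, NatExpr.eval, RealExpr.eval, InRectAt, Aligned, Nat.cast_zero,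
    ← le_antisymm_iff, ne_eq]

/-- Assign the value of the current pair in the system of slope `t`. -/
def setVal (a : ℕ) (i : NatExpr) (t : RealExpr) : Prog :=
  .ite (pairTest t) (.setReal a i (distExpr curV curQ)) (.setReal a i (distExpr curV rootIdx))

lemma exec_setVal (s : Mem) (a : ℕ) (i : NatExpr) (t : RealExpr) :
    (setVal a i t).exec s = s.setReal a (i.eval s) (leafVal (s.real 0) (s.real 1) (s.nat 0 1)
      (s.nat 10 (s.nat 6 0)) (s.nat 11 (s.nat 6 0)) (t.eval s)) := by
  rw [setVal, Prog.exec, leafVal]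
  by_cases h : (pairTest t).Holds s
  · rw [if_pos h, if_pos ((pairTest_holds s t).mp h)]
    rfl
  · rw [if_neg h, if_neg (fun h' => h ((pairTest_holds s t).mpr h'))]
    rfl

/-- Assign the critical slope of the vector `(x, y)`. -/
def setCritSlope (a : ℕ) (x y : RealExpr) : Prog :=
  .ite (.realLe (.const 0) (.mul x y)) (.setReal a (.const 0) (.div y x))
    (.setReal a (.const 0) (.div (.sub (.const 0) x) y))

lemma exec_setCritSlope (s : Mem) (a : ℕ) (x y : RealExpr) :
    (setCritSlope a x y).exec s = s.setReal a 0 (critSlope (x.eval s) (y.eval s)) := by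
  simp only [setCritSlope, Prog.exec, Test.Holds, RealExpr.eval, NatExpr.eval, critSlope,
    Nat.cast_zero, zero_sub]
  split_ifs <;> rfl

/-- Assign a slope after `x` and before or at `y`. -/
def setNextSample (a : ℕ) (x y : RealExpr) : Prog :=
  .ite (.realLe y x) (.setReal a (.const 0) (.add x (.const 1)))
    (.setReal a (.const 0) (.div (.add x y) (.const 2)))

lemma exec_setNextSample (s : Mem) (a : ℕ) (x y : RealExpr) :
    (setNextSample a x y).exec s = s.setReal a 0 (nextSample (x.eval s) (y.eval s)) := by
  simp only [setNextSample, Prog.exec, Test.Holds, RealExpr.eval, NatExpr.eval, nextSample,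
    Nat.cast_one, Nat.cast_ofNat]
  split_ifs with h h' h'
  · exact absurd h (not_le.mpr h')
  · rfl
  · rfl
  · exact absurd (not_le.mp h) h'

/-- The identifier of the event number `g` of the current pair. -/
def eventId : ℕ → NatExpr
  | 0 => reg 6
  | g + 1 => .add (eventId g) (reg 7)

/-- Compute the events of the current pair. -/
def eventStep : Prog :=
  block [setCritSlope 4 (diff 0 curQ rootIdx) (diff 1 curQ rootIdx),
    setCritSlope 5 (diff 0 curV curQ) (diff 1 curV curQ),
    .setReal 7 (eventId 0) (rreg 4), .setReal 7 (eventId 1) (rreg 5),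
    .setReal 7 (eventId 2) (rreg 4), .setReal 7 (eventId 3) (rreg 5),
    .setNat 14 (eventId 0) (reg 6), .setNat 14 (eventId 1) (reg 6),
    .setNat 14 (eventId 2) (reg 6), .setNat 14 (eventId 3) (reg 6),
    setVal 8 (eventId 0) (rreg 4), setVal 8 (eventId 1) (rreg 5),
    setNextSample 6 (rreg 4) (rreg 5), setVal 8 (eventId 2) (rreg 6),
    setNextSample 6 (rreg 5) (rreg 4), setVal 8 (eventId 3) (rreg 6),
    setVal 9 (reg 6) (.const 0),
    .setReal 12 (.const 0) (.add (.add (rreg 12) (rreg 4)) (.add (rreg 5) (.const 1))),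
    .setNat 6 (.const 0) (.add (reg 6) (.const 1))]

/-- The sweep data of a rooted point set, given by its coordinates. -/
noncomputable def sweepOf (n r : ℕ) (X Y : ℕ → ℝ) : Sweep where
  N := n * n
  sa p := critSlope (X (p % n) - X r) (Y (p % n) - Y r)
  sc p := critSlope (X (p / n) - X (p % n)) (Y (p / n) - Y (p % n))
  f p := leafVal X Y r (p / n) (p % n)
  sa_nonneg _ := critSlope_nonneg _ _
  sc_nonneg _ := critSlope_nonneg _ _
  controls p := controls_leafVal X Y r (p / n) (p % n)

/-- The events of the pairs below `k` have been computed. -/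
def EventTable (S : Sweep) (s : Mem) (k : ℕ) : Prop :=
  (∀ p < k, ∀ g < 4, s.real 7 (p + g * S.N) = S.slope (p + g * S.N)) ∧
    (∀ p < k, ∀ g < 4, s.real 8 (p + g * S.N) = S.newVal (p + g * S.N)) ∧
    (∀ p < k, ∀ g < 4, s.nat 14 (p + g * S.N) = (p + g * S.N) % S.N) ∧
    (∀ p < k, s.real 9 p = S.f p 0) ∧
    0 ≤ s.real 12 0 ∧ ∀ p < k, S.sa p < s.real 12 0 ∧ S.sc p < s.real 12 0

/-- The identifiers `k + g * N` with `k < N` have distinct remainders for distinct pairs and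
distinct quotients for distinct kinds, so no write hits an earlier entry. -/
lemma update_four {α : Type*} {F G : ℕ → α} {N k : ℕ} (hk : k < N) {x₀ x₁ x₂ x₃ : α}
    (hF : ∀ p < k, ∀ g < 4, F (p + g * N) = G (p + g * N)) (h₀ : x₀ = G (k + 0 * N))
    (h₁ : x₁ = G (k + 1 * N)) (h₂ : x₂ = G (k + 2 * N)) (h₃ : x₃ = G (k + 3 * N)) :
    ∀ p < k + 1, ∀ g < 4, Function.update (Function.update (Function.update (Function.update F
      k x₀) (k + N) x₁) (k + N + N) x₂) (k + N + N + N) x₃ (p + g * N) = G (p + g * N) := by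
  intro p hp g hg
  rcases (Nat.lt_succ_iff.mp hp).eq_or_lt with rfl | hp'
  · simp only [Function.update_apply]
    interval_cases g
    · rw [if_neg (by omega), if_neg (by omega), if_neg (by omega), if_pos (by omega), h₀]
    · rw [if_neg (by omega), if_neg (by omega), if_pos (by omega), h₁]
    · rw [if_neg (by omega), if_pos (by omega), h₂]
    · rw [if_pos (by omega), h₃]
  · rw [← hF p hp' g hg]
    simp only [Function.update_apply]
    interval_cases g <;>
      rw [if_neg (by omega), if_neg (by omega), if_neg (by omega), if_neg (by omega)]

lemma eventLoop_spec {s : Mem} {n r : ℕ} {X Y : ℕ → ℝ} (hr : s.nat 0 1 = r) (hX : s.real 0 = X)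
    (hY : s.real 1 = Y) (h7 : s.nat 7 0 = n * n) (h6 : s.nat 6 0 = 0) (hB : s.real 12 0 = 0)
    (hT : PairTable n s (n * n)) :
    Ends (.while pairsLeft eventStep) s
      (n * n * (pairsLeft.time + eventStep.maxTime) + pairsLeft.time)
      fun s' => EventTable (sweepOf n r X Y) s' (n * n) := by
  set S := sweepOf n r X Y with hS
  have hN : S.N = n * n := rfl
  have hw : ∀ {s' : Mem}, Frame eventStep s s' → s'.nat 0 1 = r ∧ s'.real 0 = X ∧ s'.real 1 = Y ∧
      s'.nat 7 0 = n * n ∧ PairTable n s' (n * n) := by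
    intro s' hf
    have hn : ∀ a, a ≠ 6 → a ≠ 14 → s'.nat a = s.nat a := fun a h h' => hf.1 a (by
      simp [eventStep, block, Prog.WritesNat, setCritSlope, setNextSample, setVal, h, h'])
    have hr' : ∀ a, a < 4 → s'.real a = s.real a := fun a h => hf.2 a (by
      interval_cases a <;>
        simp [eventStep, block, Prog.WritesReal, setCritSlope, setNextSample, setVal])
    refine ⟨by rw [hn 0 (by simp) (by simp), hr], by rw [hr' 0 (by simp), hX],
      by rw [hr' 1 (by simp), hY], by rw [hn 7 (by simp) (by simp), h7], fun p hp => ?_⟩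
    rw [hn 10 (by simp) (by simp), hn 11 (by simp) (by simp), hn 12 (by simp) (by simp),
      hn 13 (by simp) (by simp)]
    exact hT p hp
  refine Ends.mono (ends_while (n * n) eventStep.maxTime (fun k s' =>
    s'.nat 6 0 = k ∧ EventTable S s' k) ?_ ?_ ?_) le_rfl (fun _ _ h => h.2)
  · exact ⟨h6, by simp, by simp, by simp, by simp, hB.ge, by simp⟩
  · rintro k s' hk hf ⟨g6, gT⟩
    obtain ⟨gr, gX, gY, g7, gP⟩ := hw hf
    obtain ⟨p1, p2, -, -⟩ := gP k hk
    refine ⟨by simpa [Test.Holds, NatExpr.eval, g7, g6] using hk, ?_⟩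
    refine ends_of_loopFree (by
      simp [eventStep, block, Prog.LoopFree, setCritSlope, setNextSample, setVal]) ?_
    have e1 : critSlope (X (k % n) - X r) (Y (k % n) - Y r) = S.sa k := rfl
    have e2 : critSlope (X (k / n) - X (k % n)) (Y (k / n) - Y (k % n)) = S.sc k := rfl
    have e3 : ∀ t, leafVal X Y r (k / n) (k % n) t = S.f k t := fun _ => rfl
    simp only [eventStep, block, Prog.exec, exec_setVal, exec_setCritSlope, exec_setNextSample,
      RealExpr.eval, NatExpr.eval, eventId]
    simp only [ne_eq, not_false_eq_true, Mem.setNat_nat_self,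
      Mem.setNat_nat_of_ne, Mem.setReal_real_self, Mem.setReal_real_of_ne, Mem.setNat_real,
      Mem.setReal_nat, Nat.reduceEqDiff, OfNat.zero_ne_ofNat, OfNat.one_ne_ofNat,
      Function.update_self, gr, gX, gY, g7, g6, p1, p2, e1, e2, e3, Nat.cast_zero, Nat.cast_one]
    obtain ⟨t1, t2, t3, t4, t5, t6⟩ := gT
    have hs : ∀ g, S.slope (k + g * (n * n)) = _ := fun g => S.slope_add (p := k) g hk
    have hv : ∀ g, S.newVal (k + g * (n * n)) = _ := fun g => S.newVal_add (p := k) g hk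
    refine ⟨trivial, ?_, ?_, ?_, ?_, ?_, ?_⟩
    all_goals
      simp only [ne_eq, not_false_eq_true, Mem.setNat_nat_self,
        Mem.setNat_nat_of_ne, Mem.setReal_real_self, Mem.setReal_real_of_ne, Mem.setNat_real,
        Mem.setReal_nat, Nat.reduceEqDiff,
        Function.update_self]
    · exact update_four hk t1 (by rw [hs]; rfl) (by rw [hs]; rfl) (by rw [hs]; rfl)
        (by rw [hs]; rfl)
    · exact update_four hk t2 (by rw [hv]; rfl) (by rw [hv]; rfl) (by rw [hv]; rfl)
        (by rw [hv]; rfl)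
    · exact update_four (G := fun e => e % S.N) hk t3 (Sweep.add_mul_mod_eq _ hk).symm
        (Sweep.add_mul_mod_eq _ hk).symm
        (Sweep.add_mul_mod_eq _ hk).symm (Sweep.add_mul_mod_eq _ hk).symm
    · intro p hp
      rcases (Nat.lt_succ_iff.mp hp).eq_or_lt with rfl | hp'
      · simp
      · rw [Function.update_of_ne hp'.ne, t4 p hp']
    · linarith [S.sa_nonneg k, S.sc_nonneg k]
    · intro p hp
      have := S.sa_nonneg k
      have := S.sc_nonneg k
      rcases (Nat.lt_succ_iff.mp hp).eq_or_lt with rfl | hp'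
      · constructor <;> linarith
      · constructor <;> linarith [t6 p hp']
  · rintro s' hf ⟨g6, -⟩
    obtain ⟨gr, gX, gY, g7, gP⟩ := hw hf
    simp [Test.Holds, NatExpr.eval, g7, g6]

end RealRAM

namespace RealRAM

/-! ### The sweep -/

/-- The results of the preparatory loops, which are not changed afterwards. -/
structure Prepared (n r : ℕ) (X Y : ℕ → ℝ) (s : Mem) : Prop where
  numPts : s.nat 0 0 = n
  root : s.nat 0 1 = r
  coordX : s.real 0 = X
  coordY : s.real 1 = Y
  pairs : s.nat 7 0 = n * n
  events : s.nat 8 0 = 4 * (n * n)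
  pairTable : PairTable n s (n * n)
  halfTable : HalfTable s (8 * (n * n))
  eventTable : EventTable (sweepOf n r X Y) s (n * n)

lemma Prepared.of_frame {n r : ℕ} {X Y : ℕ → ℝ} {s s' : Mem} {p : Prog} (h : Prepared n r X Y s)
    (hf : Frame p s s') (hn : ∀ a ∈ [0, 7, 8, 10, 11, 12, 13, 14, 15], ¬ p.WritesNat a)
    (hr : ∀ a ∈ [0, 1, 7, 8, 9, 12], ¬ p.WritesReal a) : Prepared n r X Y s' := by
  have hn' := fun a ha => hf.1 a (hn a ha)
  have hr' := fun a ha => hf.2 a (hr a ha)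
  simp only [List.mem_cons, List.not_mem_nil, or_false, forall_eq_or_imp, forall_eq] at hn' hr'
  obtain ⟨n0, n7, n8, n10, n11, n12, n13, n14, n15⟩ := hn'
  obtain ⟨r0, r1, r7, r8, r9, r12⟩ := hr'
  obtain ⟨h1, h2, h3, h4, h5, h6, h7, h8, h9⟩ := h
  refine ⟨by rwa [n0], by rwa [n0], by rwa [r0], by rwa [r1], by rwa [n7], by rwa [n8], ?_, ?_, ?_⟩
  · unfold PairTable
    rwa [n10, n11, n12, n13]
  · unfold HalfTable
    rwa [n15]
  · unfold EventTable
    rwa [r7, r8, r9, r12, n14]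

/-- Increment the counter. -/
def incr : Prog := .setNat 6 (.const 0) (.add (reg 6) (.const 1))

/-- Insert the event with the number of the counter into the tree of events. -/
def treeHead : Prog :=
  block [.setReal 11 (.add (reg 8) (reg 6)) (.get 7 (reg 6)),
    .setNat 19 (.add (reg 8) (reg 6)) (reg 6), .setNat 16 (.const 0) (.const 0),
    .setNat 17 (.const 0) (.add (reg 8) (reg 6))]

/-- One step of the construction of the tree of events. -/
def treeStep : Prog := .seq treeHead (.seq (sift 11 19) incr)

/-- The blank memory is already a tournament tree, so trees can be built by changing one leaf at a
time. -/
lemma isTournament_const (N : ℕ) (c : ℝ ×ₗ ℕ) : IsTournament (fun _ => c) N (fun _ => c) :=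
  ⟨fun _ _ _ => (min_self c).symm, fun _ _ => rfl⟩

lemma Prepared.treeStep {n r : ℕ} {X Y : ℕ → ℝ} {s s' : Mem} (h : Prepared n r X Y s)
    (hf : Frame treeStep s s') : Prepared n r X Y s' :=
  h.of_frame hf
    (by simp [RealRAM.treeStep, treeHead, incr, block, Prog.WritesNat, sift, siftStep])
    (by simp [RealRAM.treeStep, treeHead, incr, block, Prog.WritesReal, sift, siftStep])

/-- The register `12` accumulates all critical slopes plus `1` for each pair. As slopes are
nonnegative, it exceeds all of them and can play the role of infinity. -/
lemma Sweep.slope_lt {S : Sweep} {s : Mem} (h : EventTable S s S.N) {e : ℕ} (he : e < 4 * S.N) :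
    S.slope e < s.real 12 0 := by
  have hN : 0 < S.N := by omega
  have := h.2.2.2.2.2 _ (Nat.mod_lt e hN)
  unfold Sweep.slope
  split_ifs
  · exact this.1
  · exact this.2

lemma EventTable.of_lt {S : Sweep} {s : Mem} (h : EventTable S s S.N) {e : ℕ} (he : e < 4 * S.N) :
    s.real 7 e = S.slope e ∧ s.real 8 e = S.newVal e ∧ s.nat 14 e = e % S.N := by
  have hN : 0 < S.N := by omega
  obtain ⟨g, hg, hge⟩ := Sweep.exists_eq_add he
  have hlt := Nat.mod_lt e hN
  have h1 := h.1 _ hlt g hg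
  have h2 := h.2.1 _ hlt g hg
  have h3 := h.2.2.1 _ hlt g hg
  rw [← hge] at h1 h2 h3
  exact ⟨h1, h2, h3⟩

/-- Leaves not yet inserted hold the blank entry `(0, 0)`. The tree is a tournament at every stage,
although its minimum has no meaning before the last insertion. -/
lemma treeLoop_spec {n r : ℕ} {X Y : ℕ → ℝ} {s : Mem} (h : Prepared n r X Y s)
    (h6 : s.nat 6 0 = 0) (h11 : ∀ a, s.real 11 a = 0) (h19 : ∀ a, s.nat 19 a = 0) :
    Ends (.while eventsLeft treeStep) s
      (4 * (n * n) * (eventsLeft.time +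
        (treeHead.maxTime + (siftTime 11 19 (8 * (n * n)) + incr.maxTime))) + eventsLeft.time)
      fun s' => Prepared n r X Y s' ∧ IsTournament (s'.node 11 19 0) (4 * (n * n))
        (sweepOf n r X Y).key := by
  set S := sweepOf n r X Y with hS
  have hN : S.N = n * n := rfl
  refine Ends.mono (ends_while (4 * (n * n)) _ (fun k s' => s'.nat 6 0 = k ∧
    IsTournament (s'.node 11 19 0) (4 * (n * n)) (fun e => if e < k then S.key e else toLex (0, 0)))
    ?_ ?_ ?_) le_rfl ?_
  · refine ⟨h6, ?_⟩
    have : s.node 11 19 0 = fun _ => toLex (0, 0) := by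
      funext j
      simp [Mem.node, h11, h19]
    rw [this]
    simpa using isTournament_const (4 * (n * n)) (toLex ((0 : ℝ), 0))
  · rintro k s' hk hf ⟨g6, gT⟩
    have hp := h.treeStep hf
    refine ⟨by simpa [Test.Holds, NatExpr.eval, hp.events, g6] using hk, ?_⟩
    have hsl : s'.real 7 k = S.slope k := (EventTable.of_lt hp.eventTable hk).1
    refine Ends.seq (Q := fun s₁ =>
      (∀ j, j ≠ 4 * (n * n) + k → s₁.node 11 19 0 j = s'.node 11 19 0 j)
      ∧ s₁.node 11 19 0 (4 * (n * n) + k) = S.key k ∧ s₁.nat 16 0 = 0 ∧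
      s₁.nat 17 0 = 4 * (n * n) + k)
      (ends_of_loopFree (by simp [treeHead, block, Prog.LoopFree]) ?_) ?_
    · simp only [treeHead, block, Prog.exec, RealExpr.eval, NatExpr.eval, g6, hp.events]
      refine ⟨fun j hj => ?_, ?_, ?_, ?_⟩ <;>
        simp_all [Mem.node, Sweep.key, hp.events]
    · rintro s₁ hf₁ ⟨q1, q2, q3, q4⟩
      have hH : HalfTable s₁ (8 * (n * n)) := by
        unfold HalfTable
        rw [hf₁.1 15 (by simp [treeHead, block, Prog.WritesNat])]
        exact hp.halfTable
      refine Ends.seq (sift_update (s₀ := s') (by simp) (by simp) (by simp) q3 q4 hk (by omega) hH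
        gT (fun j _ _ hj => q1 j hj)) ?_
      rintro s₂ hf₂ ⟨w1, -⟩
      refine ends_of_loopFree (by simp [incr, Prog.LoopFree]) ?_
      have w6 : s₂.nat 6 0 = k := by
        rw [hf₂.1 6 (by simp [sift, siftStep, Prog.WritesNat]),
          hf₁.1 6 (by simp [treeHead, block, Prog.WritesNat]), g6]
      refine ⟨by simp [incr, Prog.exec, NatExpr.eval, w6], ?_⟩
      have : (incr.exec s₂).node 11 19 0 = s₂.node 11 19 0 := by
        funext j
        simp [incr, Prog.exec, Mem.node]
      rw [this]
      convert w1 using 1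
      funext e
      rw [q2, Function.update_apply]
      split_ifs with h1 h2 h2 <;> first | rfl | omega | rw [h2]
  · rintro s' hf ⟨g6, -⟩
    simp [Test.Holds, NatExpr.eval, (h.treeStep hf).events, g6]
  · rintro s' hf ⟨g6, gT⟩
    refine ⟨h.treeStep hf, gT.1, fun x hx => ?_⟩
    exact (gT.2 x hx).trans (if_pos hx)

/-! ### The cost as a sum of tournament minima -/

/-- The sum over all `v` of the least value of a pair of `v`. -/
noncomputable def totalCost (n : ℕ) (L : ℕ → ℝ) : ℝ :=
  ∑ v ∈ Finset.range n, ⨅ q : Fin n, L (v * n + q)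

/-- The trees of all points hold the values `L`, and the register of the cost holds the sum of
the values of their roots. -/
def CostTrees (n : ℕ) (s : Mem) (L : ℕ → ℝ) : Prop :=
  (∀ v < n, IsTournament (s.node 10 18 (v * (2 * n))) n fun q => toLex (L (v * n + q), 0)) ∧
    s.real 13 0 = ∑ v ∈ Finset.range n, s.real 10 (v * (2 * n) + 1)

/-- The tags of all leaves are `0`, so the lexicographic minimum at the root of a tree is the
minimum of the real values. -/
lemma CostTrees.cost_eq {n : ℕ} {s : Mem} {L : ℕ → ℝ} (h : CostTrees n s L) :
    s.real 13 0 = totalCost n L := by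
  rw [h.2, totalCost]
  refine Finset.sum_congr rfl fun v hv => ?_
  have hT := h.1 v (Finset.mem_range.mp hv)
  have hn : 0 < n := by have := Finset.mem_range.mp hv; omega
  have : Nonempty (Fin n) := ⟨⟨0, hn⟩⟩
  refine le_antisymm (le_ciInf fun q => ?_) ?_
  · have := hT.root_le q.2
    simp only [Mem.node, Prod.Lex.toLex_le_toLex] at this
    rcases this with h | h
    · exact h.le
    · exact h.1.le
  · obtain ⟨x, hx, hxe⟩ := hT.exists_root_eq hn
    have hxe' : s.real 10 (v * (2 * n) + 1) = L (v * n + x) := congrArg (fun z => (ofLex z).1) hxe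
    rw [hxe']
    exact ciInf_le (Set.finite_range fun q : Fin n => L (v * n + q)).bddBelow ⟨x, hx⟩

lemma CostTrees.congr {n : ℕ} {s s' : Mem} {L : ℕ → ℝ} (h : CostTrees n s L)
    (h10 : s'.real 10 = s.real 10) (h13 : s'.real 13 0 = s.real 13 0) (h18 : s'.nat 18 = s.nat 18) :
    CostTrees n s' L := by
  have : ∀ β, s'.node 10 18 β = s.node 10 18 β := fun β => by
    funext j
    simp [Mem.node, h10, h18]
  unfold CostTrees
  simp only [this, h10, h13]
  exact h

/-- The first part of an update of a value. -/
def updHead : Prog :=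
  block [.setReal 13 (.const 0) (.sub (rreg 13) (.get 10 (.add (reg 16) (.const 1)))),
    .setReal 10 nodeAddr (rreg 17)]

/-- The last part of an update of a value. -/
def updTail : Prog :=
  .setReal 13 (.const 0) (.add (rreg 13) (.get 10 (.add (reg 16) (.const 1))))

/-- Change the value of a pair. -/
def updCost : Prog := .seq updHead (.seq (sift 10 18) updTail)

/-- A bound for the number of steps of an update, for trees with at most `m` nodes. -/
def updTime (m : ℕ) : ℕ := updHead.maxTime + (siftTime 10 18 m + updTail.maxTime)

/-- Only the tree of `v` changes, so the sum of the roots is corrected by subtracting the old root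
of this tree before the update and adding the new one afterwards. -/
lemma updCost_spec {n m v q : ℕ} {s : Mem} {L : ℕ → ℝ} (h : CostTrees n s L) (hv : v < n)
    (hq : q < n) (h16 : s.nat 16 0 = v * (2 * n)) (h17 : s.nat 17 0 = n + q) (hm : 2 * n ≤ m)
    (hH : HalfTable s m) :
    Ends updCost s (updTime m)
      fun s' => CostTrees n s' (Function.update L (v * n + q) (s.real 17 0)) := by
  set β := v * (2 * n) with hβ
  set x := s.real 17 0 with hx
  refine Ends.seq (Q := fun s₁ => s₁.real 13 0 = s.real 13 0 - s.real 10 (β + 1) ∧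
      s₁.real 10 = Function.update (s.real 10) (β + (n + q)) x ∧ s₁.nat = s.nat)
    (ends_of_loopFree (by simp [updHead, block, Prog.LoopFree]) ?_) ?_
  · simp only [updHead, block, Prog.exec, RealExpr.eval, NatExpr.eval]
    simp [h16, h17, hx]
  rintro s₁ hf₁ ⟨a1, a2, a3⟩
  have hH₁ : HalfTable s₁ m := by
    unfold HalfTable
    rwa [a3]
  refine Ends.seq (sift_update (s₀ := s) (x := q) (β := β) (by simp) (by simp) (by simp)
    (by rw [a3, h16]) (by rw [a3, h17]) hq hm hH₁ (h.1 v hv) ?_) ?_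
  · intro j _ _ hj
    simp [Mem.node, a2, a3, hj]
  rintro s₂ hf₂ ⟨w1, w2⟩
  refine ends_of_loopFree (by simp [updTail, Prog.LoopFree]) ?_
  have b13 : s₂.real 13 = s₁.real 13 := hf₂.2 13 (by simp [sift, siftStep, Prog.WritesReal])
  have b16 : s₂.nat 16 0 = β := by
    rw [hf₂.1 16 (by simp [sift, siftStep, Prog.WritesNat]), a3, h16]
  -- The trees occupy disjoint blocks of `2 * n` cells.
  have hother : ∀ v' < n, v' ≠ v → ∀ j, 1 ≤ j → j < 2 * n →
      s₂.real 10 (v' * (2 * n) + j) = s.real 10 (v' * (2 * n) + j) ∧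
      s₂.nat 18 (v' * (2 * n) + j) = s.nat 18 (v' * (2 * n) + j) := by
    intro v' hv' hne j hj1 hj2
    have hsep : v' * (2 * n) + j ≤ β ∨ β + 2 * n ≤ v' * (2 * n) + j := by
      rcases lt_or_gt_of_ne hne with hlt | hlt
      · exact Or.inl (by nlinarith [Nat.mul_le_mul_right (2 * n) (Nat.succ_le_of_lt hlt)])
      · exact Or.inr (by nlinarith [Nat.mul_le_mul_right (2 * n) (Nat.succ_le_of_lt hlt)])
    obtain ⟨c1, c2⟩ := w2 (v' * (2 * n) + j) (by omega)
    rw [c1, c2, a2, a3, Function.update_of_ne (by omega)]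
    exact ⟨rfl, rfl⟩
  have hexec : updTail.exec s₂ =
      s₂.setReal 13 0 (s₂.real 13 0 + s₂.real 10 (β + 1)) := by
    simp [updTail, Prog.exec, RealExpr.eval, NatExpr.eval, b16]
  have hnode : ∀ γ j, (updTail.exec s₂).node 10 18 γ j = s₂.node 10 18 γ j := by
    intro γ j
    rw [hexec]
    simp [Mem.node]
  have hpair : ∀ v' < n, ∀ q' < n, v' * n + q' = v * n + q → v' = v ∧ q' = q := by
    intro v' hv' q' hq' he
    have e1 := congrArg (· / n) he
    have e2 := congrArg (· % n) he
    simp only [Nat.mul_add_mod_self_right, Nat.mod_eq_of_lt hq, Nat.mod_eq_of_lt hq'] at e2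
    have hn : 0 < n := by omega
    simp only [mul_comm _ n, Nat.mul_add_div hn, Nat.div_eq_of_lt hq, Nat.div_eq_of_lt hq'] at e1
    exact ⟨by simpa using e1, e2⟩
  refine ⟨fun v' hv' => ?_, ?_⟩
  · by_cases hvv : v' = v
    · subst hvv
      refine (w1.congr fun j _ _ => hnode _ j).imp_right fun hleaf y hy => ?_
      refine (hleaf y hy).trans ?_
      beta_reduce
      have hy18 : (s.node 10 18 β (n + q)) = toLex (L (v' * n + q), 0) := (h.1 v' hv').2 q hq
      have h18 : s.nat 18 (β + (n + q)) = 0 := congrArg (fun z => (ofLex z).2) hy18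
      by_cases hyq : y = q
      · subst hyq
        simp [Mem.node, a2, a3, h18]
      · rw [Function.update_of_ne hyq, Function.update_of_ne]
        intro he
        exact hyq (hpair _ hv' _ hy he).2
    · have := (h.1 v' hv').congr (A' := (updTail.exec s₂).node 10 18 (v' * (2 * n)))
        (fun j hj1 hj2 => by
          obtain ⟨c1, c2⟩ := hother v' hv' hvv j hj1 hj2
          rw [hnode, Mem.node, Mem.node, c1, c2])
      refine this.imp_right fun hleaf y hy => ?_
      rw [hleaf y hy]
      beta_reduce
      rw [Function.update_of_ne]
      intro he
      exact hvv (hpair _ hv' _ hy he).1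
  · have e1 : (updTail.exec s₂).real 10 = s₂.real 10 := by
      rw [hexec]
      simp
    have e2 : (updTail.exec s₂).real 13 0 =
        s.real 13 0 - s.real 10 (β + 1) + s₂.real 10 (β + 1) := by
      rw [hexec]
      simp [b13, a1]
    rw [e1, e2, h.2, ← Finset.add_sum_erase _ (fun v => s.real 10 (v * (2 * n) + 1))
        (Finset.mem_range.mpr hv),
      ← Finset.add_sum_erase _ (fun v => s₂.real 10 (v * (2 * n) + 1))
        (Finset.mem_range.mpr hv)]
    have : ∑ v' ∈ (Finset.range n).erase v, s₂.real 10 (v' * (2 * n) + 1) =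
        ∑ v' ∈ (Finset.range n).erase v, s.real 10 (v' * (2 * n) + 1) := by
      refine Finset.sum_congr rfl fun v' hv' => ?_
      rw [Finset.mem_erase, Finset.mem_range] at hv'
      exact (hother v' hv'.2 hv'.1 1 le_rfl (by omega)).1
    rw [this]
    ring

/-- Prepare the update of the value of the pair with the number of the counter. -/
def costHead : Prog :=
  block [.setReal 17 (.const 0) (.get 9 (reg 6)), .setNat 16 (.const 0) (.get 12 (reg 6)),
    .setNat 17 (.const 0) (.get 13 (reg 6))]

/-- One step of the construction of the trees of all points. -/
def costStep : Prog := .seq costHead (.seq updCost incr)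

lemma Prepared.costStep {n r : ℕ} {X Y : ℕ → ℝ} {s s' : Mem} (h : Prepared n r X Y s)
    (hf : Frame costStep s s') : Prepared n r X Y s' :=
  h.of_frame hf
    (by simp [RealRAM.costStep, costHead, updCost, updHead, updTail, incr, block, Prog.WritesNat,
      sift, siftStep])
    (by simp [RealRAM.costStep, costHead, updCost, updHead, updTail, incr, block, Prog.WritesReal,
      sift, siftStep])

/-- In the blank memory the trees hold the values `0` and their roots have sum `0`; the pairs are
then updated one by one to their values at slope `0`. -/
lemma costLoop_spec {n r : ℕ} {X Y : ℕ → ℝ} {s : Mem} (h : Prepared n r X Y s)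
    (h6 : s.nat 6 0 = 0) (h10 : ∀ a, s.real 10 a = 0) (h13 : s.real 13 0 = 0)
    (h18 : ∀ a, s.nat 18 a = 0) :
    Ends (.while pairsLeft costStep) s
      (n * n * (pairsLeft.time +
        (costHead.maxTime + (updTime (8 * (n * n)) + incr.maxTime))) + pairsLeft.time)
      fun s' => Prepared n r X Y s' ∧ ∃ L, CostTrees n s' L ∧
        ∀ p < n * n, L p = (sweepOf n r X Y).f p 0 := by
  set S := sweepOf n r X Y with hS
  refine Ends.mono (ends_while (n * n) _ (fun k s' => s'.nat 6 0 = k ∧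
    ∃ L, CostTrees n s' L ∧ ∀ p < k, L p = S.f p 0) ?_ ?_ ?_) le_rfl ?_
  · refine ⟨h6, fun _ => 0, ⟨fun v _ => ?_, by simp [h13, h10]⟩, by simp⟩
    have : s.node 10 18 (v * (2 * n)) = fun _ => toLex (0, 0) := by
      funext j
      simp [Mem.node, h10, h18]
    rw [this]
    exact isTournament_const _ _
  · rintro k s' hk hf ⟨g6, L, gC, gL⟩
    have hp := h.costStep hf
    refine ⟨by simpa [Test.Holds, NatExpr.eval, hp.pairs, g6] using hk, ?_⟩
    have hn : 0 < n := Nat.pos_of_ne_zero fun h => by simp [h] at hk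
    obtain ⟨-, -, p3, p4⟩ := hp.pairTable k hk
    have p5 : s'.real 9 k = S.f k 0 := hp.eventTable.2.2.2.1 k hk
    refine Ends.seq (Q := fun s₁ => s₁.real 17 0 = S.f k 0 ∧ s₁.nat 16 0 = k / n * (2 * n) ∧
      s₁.nat 17 0 = n + k % n ∧ s₁.real 10 = s'.real 10 ∧ s₁.real 13 = s'.real 13)
      (ends_of_loopFree (by simp [costHead, block, Prog.LoopFree]) ?_) ?_
    · simp only [costHead, block, Prog.exec, RealExpr.eval, NatExpr.eval]
      simp [g6, p3, p4, p5]
    rintro s₁ hf₁ ⟨q1, q2, q3, q4, q5⟩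
    have hH : HalfTable s₁ (8 * (n * n)) := by
      unfold HalfTable
      rw [hf₁.1 15 (by simp [costHead, block, Prog.WritesNat])]
      exact hp.halfTable
    have hC₁ : CostTrees n s₁ L := gC.congr q4 (by rw [q5])
      (hf₁.1 18 (by simp [costHead, block, Prog.WritesNat]))
    refine Ends.seq (updCost_spec hC₁ (Nat.div_lt_of_lt_mul hk) (Nat.mod_lt k hn) q2 q3
      (by nlinarith) hH) ?_
    intro s₂ hf₂ hC₂
    refine ends_of_loopFree (by simp [incr, Prog.LoopFree]) ?_
    have w6 : s₂.nat 6 0 = k := by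
      rw [hf₂.1 6 (by simp [updCost, updHead, updTail, block, sift, siftStep, Prog.WritesNat]),
        hf₁.1 6 (by simp [costHead, block, Prog.WritesNat]), g6]
    refine ⟨by simp [incr, Prog.exec, NatExpr.eval, w6], _, hC₂.congr rfl rfl ?_, ?_⟩
    · simp [incr, Prog.exec]
    · intro p hp
      rw [mul_comm, Nat.div_add_mod, q1, Function.update_apply]
      split_ifs with hpk
      · rw [hpk]
      · exact gL p (by omega)
  · rintro s' hf ⟨g6, -⟩
    simp [Test.Holds, NatExpr.eval, (h.costStep hf).pairs, g6]
  · rintro s' hf ⟨g6, gT⟩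
    exact ⟨h.costStep hf, gT⟩

end RealRAM

/-! ### Processing the events in order -/

namespace RealRAM

/-- Fetch the next event, and prepare the update of the value of its pair. -/
def sweepHead : Prog :=
  block [.setNat 20 (.const 0) (.get 19 (.const 1)), .setReal 16 (.const 0) (.get 11 (.const 1)),
    .setReal 17 (.const 0) (.get 8 (reg 20)), .setNat 16 (.const 0) (.get 12 (.get 14 (reg 20))),
    .setNat 17 (.const 0) (.get 13 (.get 14 (reg 20)))]

/-- Record the cost if it is the least one so far, and remove the event. -/
def sweepMid : Prog :=
  block [.ite (.realLe (rreg 14) (rreg 13)) .skip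
      (.seq (.setReal 14 (.const 0) (rreg 13)) (.setReal 15 (.const 0) (rreg 16))),
    .setReal 11 (.add (reg 8) (reg 20)) (rreg 12), .setNat 16 (.const 0) (.const 0),
    .setNat 17 (.const 0) (.add (reg 8) (reg 20))]

/-- Process one event. -/
def sweepStep : Prog := .seq sweepHead (.seq updCost (.seq sweepMid (.seq (sift 11 19) incr)))

/-- A bound for the number of steps that an event takes, for trees with at most `m` nodes. -/
def sweepTime (m : ℕ) : ℕ :=
  sweepHead.maxTime + (updTime m + (sweepMid.maxTime + (siftTime 11 19 m + incr.maxTime)))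

lemma Prepared.sweepStep {n r : ℕ} {X Y : ℕ → ℝ} {s s' : Mem} (h : Prepared n r X Y s)
    (hf : Frame sweepStep s s') : Prepared n r X Y s' :=
  h.of_frame hf
    (by simp [RealRAM.sweepStep, sweepHead, sweepMid, updCost, updHead, updTail, incr, block,
      Prog.WritesNat, sift, siftStep])
    (by simp [RealRAM.sweepStep, sweepHead, sweepMid, updCost, updHead, updTail, incr, block,
      Prog.WritesReal, sift, siftStep])

/-- The least cost of a spanning tree in the system of slope `t`. -/
noncomputable def slopeCost (n r : ℕ) (X Y : ℕ → ℝ) (t : ℝ) : ℝ :=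
  totalCost n fun p => (sweepOf n r X Y).f p t

lemma totalCost_mono {n : ℕ} {L L' : ℕ → ℝ} (h : ∀ p < n * n, L p ≤ L' p) :
    totalCost n L ≤ totalCost n L' := by
  refine Finset.sum_le_sum fun v hv => ciInf_mono (Set.finite_range _).bddBelow fun q => h _ ?_
  have hv := Finset.mem_range.mp hv
  have := q.2
  nlinarith

/-- The leaves of the tree of events when the events in `D` have been removed. -/
noncomputable def eventLeaf (S : Sweep) (B : ℝ) (D : Finset ℕ) (e : ℕ) : ℝ ×ₗ ℕ :=
  if e ∈ D then toLex (B, e) else S.key e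

/-- The state of the sweep after the events in `D`. -/
structure SweepInv (n r : ℕ) (X Y : ℕ → ℝ) (s : Mem) (D : Finset ℕ) : Prop where
  isPrefix : (sweepOf n r X Y).IsPrefix D
  tree : IsTournament (s.node 11 19 0) (4 * (n * n))
    (eventLeaf (sweepOf n r X Y) (s.real 12 0) D)
  values : ∃ L, CostTrees n s L ∧ ∀ p < n * n, (sweepOf n r X Y).State D p (L p)
  slope_nonneg : 0 ≤ s.real 15 0
  slopeCost_le : slopeCost n r X Y (s.real 15 0) ≤ s.real 14 0
  best_le : ∀ D' ⊆ D, (sweepOf n r X Y).IsPrefix D' →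
    ∃ L, (∀ p < n * n, (sweepOf n r X Y).State D' p (L p)) ∧ s.real 14 0 ≤ totalCost n L

/-- Removed events have been moved to `B`, above all slopes. As long as an event remains, the
minimum is thus the first remaining one. -/
lemma isNext_root {S : Sweep} {B : ℝ} {D : Finset ℕ} {A : ℕ → ℝ ×ₗ ℕ}
    (hA : IsTournament A (4 * S.N) (eventLeaf S B D)) (hcard : D.card < 4 * S.N)
    (hB : ∀ e < 4 * S.N, S.slope e < B) :
    ∃ e, S.IsNext D e ∧ A 1 = S.key e := by
  obtain ⟨x, hx, hxe⟩ := hA.exists_root_eq (by omega)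
  have hex : ∃ y < 4 * S.N, y ∉ D := by
    by_contra! hall
    have : Finset.range (4 * S.N) ⊆ D := fun y hy => hall y (Finset.mem_range.mp hy)
    have := Finset.card_le_card this
    rw [Finset.card_range] at this
    omega
  have hxD : x ∉ D := by
    intro hmem
    obtain ⟨y, hy, hyD⟩ := hex
    have := hA.root_le hy
    rw [hxe, eventLeaf, eventLeaf, if_pos hmem, if_neg hyD] at this
    have hlt : S.key y < toLex (B, x) := by
      rw [Sweep.key, Prod.Lex.toLex_lt_toLex]
      exact Or.inl (hB y hy)
    exact absurd this (not_le.mpr hlt)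
  have hroot : A 1 = S.key x := by rw [hxe, eventLeaf, if_neg hxD]
  refine ⟨x, ⟨hx, hxD, fun y hy hyD => ?_⟩, hroot⟩
  have := hA.root_le hy
  rwa [hroot, eventLeaf, if_neg hyD] at this

/-- The cost after the event is an upper bound for the cost at the slope of the event, even if the
value just assigned is one for later slopes. Recording this slope together with that cost therefore
keeps `slopeCost_le` true. -/
lemma sweepStep_spec {n r : ℕ} {X Y : ℕ → ℝ} {s : Mem} (h : Prepared n r X Y s) {D : Finset ℕ}
    (hI : SweepInv n r X Y s D) (hcard : D.card < 4 * (n * n)) :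
    Ends sweepStep s (sweepTime (8 * (n * n))) fun s' =>
      s'.nat 6 0 = s.nat 6 0 + 1 ∧ ∃ D', D'.card = D.card + 1 ∧ SweepInv n r X Y s' D' := by
  set S := sweepOf n r X Y with hS
  obtain ⟨hD, hT, ⟨L, hC, hL⟩, ht, hle, hbest⟩ := hI
  have hB : ∀ e < 4 * S.N, S.slope e < s.real 12 0 := fun e he => Sweep.slope_lt h.eventTable he
  obtain ⟨e, he, hroot⟩ := isNext_root hT hcard hB
  have heM : e < 4 * (n * n) := he.1
  have h11 : s.real 11 1 = S.slope e := by
    have := congrArg (fun z => (ofLex z).1) hroot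
    simpa [Mem.node, Sweep.key] using this
  have h19 : s.nat 19 1 = e := by
    have := congrArg (fun z => (ofLex z).2) hroot
    simpa [Mem.node, Sweep.key] using this
  have hn : 0 < n := Nat.pos_of_ne_zero fun h => by simp [h] at heM
  set p := e % (n * n) with hp
  have hpn : p < n * n := Nat.mod_lt _ (by positivity)
  obtain ⟨-, h8, h14⟩ : _ ∧ s.real 8 e = S.newVal e ∧ s.nat 14 e = p :=
    EventTable.of_lt h.eventTable heM
  obtain ⟨-, -, h12, h13⟩ := h.pairTable p hpn
  refine Ends.seq (Q := fun s₁ => s₁.nat 20 0 = e ∧ s₁.real 16 0 = S.slope e ∧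
      s₁.real 17 0 = S.newVal e ∧ s₁.nat 16 0 = p / n * (2 * n) ∧ s₁.nat 17 0 = n + p % n)
      (ends_of_loopFree (by simp [sweepHead, block, Prog.LoopFree]) ?_) ?_
  · simp only [sweepHead, block, Prog.exec, RealExpr.eval, NatExpr.eval]
    simp [h11, h19, h8, h14, h12, h13]
  rintro s₁ hf₁ ⟨a1, a2, a3, a4, a5⟩
  have hn₁ : ∀ a, a ≠ 16 → a ≠ 17 → a ≠ 20 → s₁.nat a = s.nat a := fun a b1 b2 b3 =>
    hf₁.1 a (by simp [sweepHead, block, Prog.WritesNat, b1, b2, b3])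
  have hr₁ : ∀ a, a ≠ 16 → a ≠ 17 → s₁.real a = s.real a := fun a b1 b2 =>
    hf₁.2 a (by simp [sweepHead, block, Prog.WritesReal, b1, b2])
  have hH₁ : HalfTable s₁ (8 * (n * n)) := by
    unfold HalfTable
    rw [hn₁ 15 (by simp) (by simp) (by simp)]
    exact h.halfTable
  have hC₁ : CostTrees n s₁ L := hC.congr (hr₁ _ (by simp) (by simp))
    (by rw [hr₁ _ (by simp) (by simp)]) (hn₁ _ (by simp) (by simp) (by simp))
  refine Ends.seq (updCost_spec hC₁ (Nat.div_lt_of_lt_mul hpn) (Nat.mod_lt p hn) a4 a5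
    (by nlinarith) hH₁) ?_
  intro s₂ hf₂ hC₂
  rw [mul_comm, Nat.div_add_mod, a3] at hC₂
  set L' := Function.update L p (S.newVal e) with hL'
  have hn₂ : ∀ a, a ≠ 16 → a ≠ 17 → a ≠ 20 → a ≠ 18 → s₂.nat a = s.nat a :=
    fun a b1 b2 b3 b4 => (hf₂.1 a (by
      simp [updCost, updHead, updTail, block, sift, siftStep, Prog.WritesNat, b2, b4])).trans
      (hn₁ a b1 b2 b3)
  have hr₂ : ∀ a, a ≠ 16 → a ≠ 17 → a ≠ 10 → a ≠ 13 → s₂.real a = s.real a :=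
    fun a b1 b2 b3 b4 => (hf₂.2 a (by
      simp [updCost, updHead, updTail, block, sift, siftStep, Prog.WritesReal, b3, b4])).trans
      (hr₁ a b1 b2)
  have c20 : s₂.nat 20 0 = e := by
    rw [hf₂.1 20 (by simp [updCost, updHead, updTail, block, sift, siftStep, Prog.WritesNat]), a1]
  have c16 : s₂.real 16 0 = S.slope e := by
    rw [hf₂.2 16 (by simp [updCost, updHead, updTail, block, sift, siftStep, Prog.WritesReal]), a2]
  have c8 : s₂.nat 8 0 = 4 * (n * n) := by
    rw [hn₂ 8 (by simp) (by simp) (by simp) (by simp), h.events]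
  have c13 : s₂.real 13 0 = totalCost n L' := hC₂.cost_eq
  have hstate : ∀ p' < n * n, S.State (insert e D) p' (L' p') := by
    intro p' hp'
    by_cases hpp : p' = p
    · rw [hpp, hL', Function.update_self]
      exact Sweep.state_insert hD he
    · rw [hL', Function.update_of_ne hpp]
      exact (hL p' hp').insert_of_ne fun h => hpp h.symm
  have hcost : slopeCost n r X Y (S.slope e) ≤ totalCost n L' :=
    totalCost_mono fun p' hp' => (hstate p' hp').le (Sweep.isPrefix_insert hD he)
      (Finset.mem_insert_self _ _) (hD.key_le_of_isNext he) hp'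
  refine Ends.seq (Q := fun s₃ => s₃.nat 16 0 = 0 ∧ s₃.nat 17 0 = 4 * (n * n) + e ∧
      s₃.real 11 = Function.update (s₂.real 11) (4 * (n * n) + e) (s.real 12 0) ∧
      0 ≤ s₃.real 15 0 ∧ slopeCost n r X Y (s₃.real 15 0) ≤ s₃.real 14 0 ∧
      s₃.real 14 0 ≤ s.real 14 0 ∧ s₃.real 14 0 ≤ totalCost n L')
      (ends_of_loopFree (by simp [sweepMid, block, Prog.LoopFree]) ?_) ?_
  · have d14 : s₂.real 14 0 = s.real 14 0 := by rw [hr₂ _ (by simp) (by simp) (by simp) (by simp)]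
    have d15 : s₂.real 15 0 = s.real 15 0 := by rw [hr₂ _ (by simp) (by simp) (by simp) (by simp)]
    have d12 : s₂.real 12 0 = s.real 12 0 := by rw [hr₂ _ (by simp) (by simp) (by simp) (by simp)]
    simp only [sweepMid, block, Prog.exec, Test.Holds, RealExpr.eval, NatExpr.eval]
    by_cases hcmp : s.real 14 0 ≤ totalCost n L'
    · have hcmp' : s.real 14 0 ≤ s₂.real 13 0 := hcmp.trans_eq c13.symm
      simp [c8, c20, d12, d14, d15, ht, hle, hcmp, hcmp']
    · simp [c8, c20, d12, d14, c16, c13, hcost, hcmp, (not_le.mp hcmp).le,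
        Sweep.slope_nonneg]
  rintro s₃ hf₃ ⟨b16, b17, b11, b15, bcost, bbest, bbest'⟩
  have hn₃ : ∀ a, a ≠ 16 → a ≠ 17 → s₃.nat a = s₂.nat a := fun a b1 b2 =>
    hf₃.1 a (by simp [sweepMid, block, Prog.WritesNat, b1, b2])
  have hr₃ : ∀ a, a ≠ 11 → a ≠ 14 → a ≠ 15 → s₃.real a = s₂.real a := fun a b1 b2 b3 =>
    hf₃.2 a (by simp [sweepMid, block, Prog.WritesReal, b1, b2, b3])
  have hH₃ : HalfTable s₃ (8 * (n * n)) := by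
    unfold HalfTable
    rw [hn₃ 15 (by simp) (by simp), hn₂ 15 (by simp) (by simp) (by simp) (by simp)]
    exact h.halfTable
  have hnode : ∀ j, j ≠ 4 * (n * n) + e → s₃.node 11 19 0 j = s.node 11 19 0 j := by
    intro j hj
    simp [Mem.node, b11, hj, hn₃ 19, hn₂ 19, hr₂ 11]
  have hleaf : s₃.node 11 19 0 (4 * (n * n) + e) = toLex (s.real 12 0, e) := by
    have := hT.2 e heM
    rw [eventLeaf, if_neg he.2.1] at this
    have h19e : s.nat 19 (4 * (n * n) + e) = e := by
      have := congrArg (fun z => (ofLex z).2) this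
      simpa [Mem.node, Sweep.key] using this
    simp [Mem.node, b11, hn₃ 19, hn₂ 19, h19e]
  refine Ends.seq (sift_update (s₀ := s) (by simp) (by simp) (by simp) b16 b17 heM (by omega) hH₃
    hT (fun j _ _ hj => hnode j hj)) ?_
  rintro s₄ hf₄ ⟨w1, -⟩
  refine ends_of_loopFree (by simp [incr, Prog.LoopFree]) ?_
  have hn₄ : ∀ a, a ≠ 17 → a ≠ 19 → s₄.nat a = s₃.nat a := fun a b1 b2 =>
    hf₄.1 a (by simp [sift, siftStep, Prog.WritesNat, b1, b2])
  have hr₄ : ∀ a, a ≠ 11 → s₄.real a = s₃.real a := fun a b1 =>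
    hf₄.2 a (by simp [sift, siftStep, Prog.WritesReal, b1])
  have d6 : s₄.nat 6 0 = s.nat 6 0 := by
    rw [hn₄ 6 (by simp) (by simp), hn₃ 6 (by simp) (by simp),
      hn₂ 6 (by simp) (by simp) (by simp) (by simp)]
  have d12 : s₄.real 12 = s.real 12 := by
    rw [hr₄ 12 (by simp), hr₃ 12 (by simp) (by simp) (by simp),
      hr₂ 12 (by simp) (by simp) (by simp) (by simp)]
  have hreal : (incr.exec s₄).real = s₄.real := rfl
  refine ⟨by simp [incr, Prog.exec, NatExpr.eval, d6], insert e D,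
    Finset.card_insert_of_notMem he.2.1, Sweep.isPrefix_insert hD he, ?_, ⟨L', ?_, hstate⟩, ?_, ?_,
    ?_⟩
  · have hnode₄ : (incr.exec s₄).node 11 19 0 = s₄.node 11 19 0 := by
      funext j
      simp [incr, Prog.exec, Mem.node]
    rw [hnode₄, hreal, d12]
    convert w1 using 1
    funext x
    rw [hleaf, Function.update_apply, eventLeaf, eventLeaf]
    by_cases hx : x = e
    · subst hx
      simp
    · simp [hx]
  · refine hC₂.congr ?_ ?_ ?_
    · rw [hreal, hr₄ 10 (by simp), hr₃ 10 (by simp) (by simp) (by simp)]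
    · rw [hreal, hr₄ 13 (by simp), hr₃ 13 (by simp) (by simp) (by simp)]
    · rw [← hn₃ 18 (by simp) (by simp), ← hn₄ 18 (by simp) (by simp)]
      simp [incr, Prog.exec]
  · rwa [hreal, hr₄ 15 (by simp)]
  · rwa [hreal, hr₄ 15 (by simp), hr₄ 14 (by simp)]
  · intro D' hD' hpre
    rw [hreal, hr₄ 14 (by simp)]
    -- The only new prefix is the full set of processed events, and its cost has just been compared
    -- with the record.
    rcases hD.subset_or_eq hpre he hD' with hsub | rfl
    · obtain ⟨L₀, hL₀, hle₀⟩ := hbest D' hsub hpre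
      exact ⟨L₀, hL₀, bbest.trans hle₀⟩
    · exact ⟨L', hstate, bbest'⟩

/-- For each `t ≥ 0` the events up to `t` form a prefix whose cost is exactly the cost at `t`, and
the recorded cost is at most the cost of every prefix. -/
lemma sweepLoop_spec {n r : ℕ} {X Y : ℕ → ℝ} {s : Mem} (h : Prepared n r X Y s)
    (h6 : s.nat 6 0 = 0) (hI : SweepInv n r X Y s ∅) :
    Ends (.while eventsLeft sweepStep) s
      (4 * (n * n) * (eventsLeft.time + sweepTime (8 * (n * n))) + eventsLeft.time)
      fun s' => Prepared n r X Y s' ∧ 0 ≤ s'.real 15 0 ∧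
        ∀ t, 0 ≤ t → slopeCost n r X Y (s'.real 15 0) ≤ slopeCost n r X Y t := by
  set S := sweepOf n r X Y with hS
  refine Ends.mono (ends_while (4 * (n * n)) _ (fun k s' => s'.nat 6 0 = k ∧
    ∃ D, D.card = k ∧ SweepInv n r X Y s' D) ?_ ?_ ?_) le_rfl ?_
  · exact ⟨h6, ∅, rfl, hI⟩
  · rintro k s' hk hf ⟨g6, D, hcard, gI⟩
    have hp := h.sweepStep hf
    refine ⟨by simpa [Test.Holds, NatExpr.eval, hp.events, g6] using hk, ?_⟩
    refine (sweepStep_spec hp gI (by omega)).mono le_rfl ?_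
    rintro s'' hf' ⟨e1, D', e2, e3⟩
    exact ⟨by omega, D', by omega, e3⟩
  · rintro s' hf ⟨g6, -⟩
    simp [Test.Holds, NatExpr.eval, (h.sweepStep hf).events, g6]
  · rintro s' hf ⟨g6, D, hcard, gI⟩
    refine ⟨h.sweepStep hf, gI.slope_nonneg, fun t ht => ?_⟩
    -- After `4 * (n * n)` steps all events have been processed, by counting.
    have hD : Finset.range (4 * (n * n)) ⊆ D := by
      refine (Finset.eq_of_subset_of_card_le (fun d hd => ?_) ?_).ge
      · exact Finset.mem_range.mpr (gI.isPrefix.1 d hd)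
      · rw [Finset.card_range, hcard]
    have hsub : S.eventsUpTo t ⊆ D := fun e he =>
      hD (Finset.mem_range.mpr (Sweep.mem_eventsUpTo.mp he).1)
    obtain ⟨L, hL, hle⟩ := gI.best_le _ hsub (Sweep.isPrefix_eventsUpTo t)
    refine gI.slopeCost_le.trans (hle.trans (totalCost_mono fun p hp => ?_))
    exact ((hL p hp).eq_of_eventsUpTo ht hp).le

end RealRAM

namespace RealRAM

/-! ### Parents, output, and the whole program -/

/-- Make the root the parent of the point with the number of the counter. -/
def initStep : Prog := .seq (.setNat 21 (reg 6) rootIdx) incr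

/-- The counter is less than the number of points. -/
abbrev pointsLeft : Test := .not (.natLe numPts (reg 6))

lemma Prepared.initStep {n r : ℕ} {X Y : ℕ → ℝ} {s s' : Mem} (h : Prepared n r X Y s)
    (hf : Frame initStep s s') : Prepared n r X Y s' :=
  h.of_frame hf (by simp [RealRAM.initStep, incr, Prog.WritesNat])
    (by simp [RealRAM.initStep, incr, Prog.WritesReal])

lemma initLoop_spec {n r : ℕ} {X Y : ℕ → ℝ} {s : Mem} (h : Prepared n r X Y s)
    (h6 : s.nat 6 0 = 0) :
    Ends (.while pointsLeft initStep) s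
      (n * (pointsLeft.time + initStep.maxTime) + pointsLeft.time)
      fun s' => ∀ v < n, s'.nat 21 v = r := by
  refine Ends.mono (ends_while n _ (fun k s' => s'.nat 6 0 = k ∧ ∀ v < k, s'.nat 21 v = r)
    ⟨h6, by simp⟩ ?_ ?_) le_rfl fun _ _ h => h.2
  · rintro k s' hk hf ⟨g6, gQ⟩
    have hp := h.initStep hf
    refine ⟨by simpa [Test.Holds, NatExpr.eval, hp.numPts, g6] using hk, ?_⟩
    refine ends_of_loopFree (by simp [initStep, incr, Prog.LoopFree]) ?_
    simp only [initStep, incr, Prog.exec, NatExpr.eval, hp.root, g6]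
    refine ⟨by simp [g6], fun v hv => ?_⟩
    simp only [ne_eq, not_false_eq_true, Mem.setNat_nat_self, Mem.setNat_nat_of_ne,
      Nat.reduceEqDiff, Function.update_apply]
    split_ifs with hvk
    · rfl
    · exact gQ v (by omega)
  · rintro s' hf ⟨g6, -⟩
    simp [Test.Holds, NatExpr.eval, (h.initStep hf).numPts, g6]

/-- Replace the parent of the first point of the current pair by the second point of the pair, if
this is permitted and shortens the edge. -/
def parentStep : Prog :=
  .seq (.ite (.and (pairTest (rreg 15))
      (.not (.realLe (distExpr curV (.get 21 curV)) (distExpr curV curQ))))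
    (.setNat 21 curV curQ) .skip) incr

lemma Prepared.parentStep {n r : ℕ} {X Y : ℕ → ℝ} {s s' : Mem} (h : Prepared n r X Y s)
    (hf : Frame parentStep s s') : Prepared n r X Y s' :=
  h.of_frame hf (by simp [RealRAM.parentStep, incr, Prog.WritesNat])
    (by simp [RealRAM.parentStep, incr, Prog.WritesReal])

/-- The point `q` is the root, or it may precede `v` in the system of slope `t`. -/
def MayPrecede (X Y : ℕ → ℝ) (r v q : ℕ) (t : ℝ) : Prop := q = r ∨ q ≠ v ∧ InRectAt X Y r v q t

/-- The search starts from the root, which is always permitted. The invariant keeps the distance at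
most that of the root, which covers the default value in `leafVal`. -/
lemma parentLoop_spec {n r : ℕ} {X Y : ℕ → ℝ} {s : Mem} (h : Prepared n r X Y s) (hr : r < n)
    (h6 : s.nat 6 0 = 0) (h21 : ∀ v < n, s.nat 21 v = r) :
    Ends (.while pairsLeft parentStep) s
      (n * n * (pairsLeft.time + parentStep.maxTime) + pairsLeft.time)
      fun s' => ∀ v < n, s'.nat 21 v < n ∧ MayPrecede X Y r v (s'.nat 21 v) (s.real 15 0) ∧
        ∀ q < n, ptDist X Y v (s'.nat 21 v) ≤ leafVal X Y r v q (s.real 15 0) := by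
  set t := s.real 15 0 with ht
  refine Ends.mono (ends_while (n * n) _ (fun k s' => s'.nat 6 0 = k ∧ ∀ v < n, s'.nat 21 v < n ∧
    MayPrecede X Y r v (s'.nat 21 v) t ∧ ptDist X Y v (s'.nat 21 v) ≤ ptDist X Y v r ∧
    ∀ q < n, v * n + q < k → q ≠ v → InRectAt X Y r v q t →
      ptDist X Y v (s'.nat 21 v) ≤ ptDist X Y v q) ?_ ?_ ?_) le_rfl ?_
  · refine ⟨h6, fun v hv => ?_⟩
    rw [h21 v hv]
    exact ⟨hr, Or.inl rfl, le_rfl, fun q _ hq => by omega⟩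
  · rintro k s' hk hf ⟨g6, gQ⟩
    have hp := h.parentStep hf
    have g15 : s'.real 15 0 = t := by
      rw [hf.2 15 (by simp [parentStep, incr, Prog.WritesReal])]
    refine ⟨by simpa [Test.Holds, NatExpr.eval, hp.pairs, g6] using hk, ?_⟩
    refine ends_of_loopFree (by simp [parentStep, incr, Prog.LoopFree]) ?_
    obtain ⟨p1, p2, -, -⟩ := hp.pairTable k hk
    have hn : 0 < n := Nat.pos_of_ne_zero fun h => by simp [h] at hk
    have hv : k / n < n := Nat.div_lt_of_lt_mul hk
    have hq : k % n < n := Nat.mod_lt k hn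
    have hkk : ∀ v q, q < n → v * n + q = k → v = k / n ∧ q = k % n := by
      rintro v q hlt rfl
      rw [mul_comm, Nat.mul_add_div hn, Nat.div_eq_of_lt hlt, Nat.mul_add_mod,
        Nat.mod_eq_of_lt hlt]
      exact ⟨rfl, rfl⟩
    obtain ⟨c1, c2, c3, c4⟩ := gQ (k / n) hv
    set v₀ := k / n
    set q₀ := k % n
    have htest : (Test.and (pairTest (rreg 15))
        (.not (.realLe (distExpr curV (.get 21 curV)) (distExpr curV curQ)))).Holds s' ↔
        (q₀ ≠ v₀ ∧ InRectAt X Y r v₀ q₀ t) ∧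
          ptDist X Y v₀ q₀ < ptDist X Y v₀ (s'.nat 21 v₀) := by
      simp only [Test.Holds, pairTest_holds, eval_distExpr, NatExpr.eval, RealExpr.eval, g6, p1, p2,
        hp.root, hp.coordX, hp.coordY, g15, not_le]
    have hincr : ∀ s₁ : Mem, (incr.exec s₁).nat 6 0 = s₁.nat 6 0 + 1 ∧
        (incr.exec s₁).nat 21 = s₁.nat 21 := fun s₁ => by
      simp [incr, Prog.exec, NatExpr.eval]
    rw [parentStep, Prog.exec, (hincr _).1, (hincr _).2, Prog.exec]
    by_cases hc : (q₀ ≠ v₀ ∧ InRectAt X Y r v₀ q₀ t) ∧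
        ptDist X Y v₀ q₀ < ptDist X Y v₀ (s'.nat 21 v₀)
    · rw [if_pos (htest.mpr hc)]
      simp only [Prog.exec, NatExpr.eval, g6, p1, p2]
      refine ⟨by simp [g6], fun v hv' => ?_⟩
      simp only [Mem.setNat_nat_self, Function.update_apply]
      split_ifs with hvv
      · subst hvv
        refine ⟨hq, Or.inr hc.1, hc.2.le.trans c3, fun q hq' hlt hne hrect => ?_⟩
        rcases (Nat.lt_succ_iff.mp hlt).lt_or_eq with hlt' | heq
        · exact hc.2.le.trans (c4 q hq' hlt' hne hrect)
        · rw [(hkk _ q hq' heq).2]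
      · obtain ⟨d1, d2, d3, d4⟩ := gQ v hv'
        refine ⟨d1, d2, d3, fun q hq' hlt => d4 q hq' ?_⟩
        refine lt_of_le_of_ne (Nat.lt_succ_iff.mp hlt) fun heq => hvv (hkk v q hq' heq).1
    · rw [if_neg (fun h' => hc (htest.mp h'))]
      simp only [Prog.exec]
      refine ⟨by rw [g6], fun v hv' => ?_⟩
      obtain ⟨d1, d2, d3, d4⟩ := gQ v hv'
      refine ⟨d1, d2, d3, fun q hq' hlt hne hrect => ?_⟩
      rcases (Nat.lt_succ_iff.mp hlt).lt_or_eq with hlt' | heq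
      · exact d4 q hq' hlt' hne hrect
      · obtain ⟨rfl, rfl⟩ := hkk v q hq' heq
        by_contra! hlt'
        exact hc ⟨⟨hne, hrect⟩, hlt'⟩
  · rintro s' hf ⟨g6, -⟩
    simp [Test.Holds, NatExpr.eval, (h.parentStep hf).pairs, g6]
  · rintro s' hf ⟨g6, gQ⟩ v hv
    obtain ⟨d1, d2, d3, d4⟩ := gQ v hv
    refine ⟨d1, d2, fun q hq => ?_⟩
    rw [leafVal]
    split_ifs with hc
    · exact d4 q hq (by nlinarith) hc.1 hc.2
    · exact d3

/-- Write one edge. -/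
def outStep : Prog :=
  .seq (.ite (.natLe rootIdx (reg 6))
    (.seq (.setNat 2 (reg 6) (.add (reg 6) (.const 1)))
      (.setNat 3 (reg 6) (.get 21 (.add (reg 6) (.const 1)))))
    (.seq (.setNat 2 (reg 6) (reg 6)) (.setNat 3 (reg 6) (.get 21 (reg 6))))) incr

/-- The counter is less than the number of edges. -/
abbrev edgesLeft : Test := .not (.natLe numPts (.add (reg 6) (.const 1)))

lemma Prepared.outStep {n r : ℕ} {X Y : ℕ → ℝ} {s s' : Mem} (h : Prepared n r X Y s)
    (hf : Frame outStep s s') : Prepared n r X Y s' :=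
  h.of_frame hf (by simp [RealRAM.outStep, incr, Prog.WritesNat])
    (by simp [RealRAM.outStep, incr, Prog.WritesReal])

/-- There is one edge per vertex other than the root: edge `j` belongs to vertex `j` below the root
index, and to vertex `j + 1` from there on. -/
lemma outLoop_spec {n r : ℕ} {X Y : ℕ → ℝ} {s : Mem} (h : Prepared n r X Y s) (hr : r < n)
    (h6 : s.nat 6 0 = 0) :
    Ends (.while edgesLeft outStep) s
      (n * (edgesLeft.time + outStep.maxTime) + edgesLeft.time)
      fun s' => s'.nat 6 0 + 1 = n ∧ ∀ j < n - 1, s'.nat 2 j = (if r ≤ j then j + 1 else j) ∧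
        s'.nat 3 j = s.nat 21 (if r ≤ j then j + 1 else j) := by
  refine Ends.mono (ends_while (n - 1) outStep.maxTime (fun k s' => s'.nat 6 0 = k ∧
    ∀ j < k, s'.nat 2 j = (if r ≤ j then j + 1 else j) ∧
        s'.nat 3 j = s.nat 21 (if r ≤ j then j + 1 else j)) ⟨h6, by simp⟩ ?_ ?_) ?_ ?_
  · rintro k s' hk hf ⟨g6, gQ⟩
    have hp := h.outStep hf
    have g21 : s'.nat 21 = s.nat 21 := hf.1 21 (by simp [outStep, incr, Prog.WritesNat])
    refine ⟨?_, ?_⟩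
    · simp only [Test.Holds, NatExpr.eval, hp.numPts, g6]
      omega
    refine ends_of_loopFree (by simp [outStep, incr, Prog.LoopFree]) ?_
    have hincr : ∀ s₁ : Mem, (incr.exec s₁).nat 6 0 = s₁.nat 6 0 + 1 ∧
        (incr.exec s₁).nat 2 = s₁.nat 2 ∧ (incr.exec s₁).nat 3 = s₁.nat 3 := fun s₁ => by
      simp [incr, Prog.exec, NatExpr.eval]
    rw [outStep, Prog.exec, (hincr _).1, (hincr _).2.1, (hincr _).2.2, Prog.exec]
    have htest : (Test.natLe rootIdx (reg 6)).Holds s' ↔ r ≤ k := by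
      simp only [Test.Holds, NatExpr.eval, hp.root, g6]
    by_cases hc : r ≤ k
    · rw [if_pos (htest.mpr hc)]
      simp only [Prog.exec, NatExpr.eval]
      refine ⟨by simp [g6], fun j hj => ?_⟩
      rcases (Nat.lt_succ_iff.mp hj).eq_or_lt with rfl | hj'
      · simp [g6, hc, g21]
      · simpa [g6, hj'.ne] using gQ j hj'
    · rw [if_neg (fun h' => hc (htest.mp h'))]
      simp only [Prog.exec, NatExpr.eval]
      refine ⟨by simp [g6], fun j hj => ?_⟩
      rcases (Nat.lt_succ_iff.mp hj).eq_or_lt with rfl | hj'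
      · simp [g6, hc, g21]
      · simpa [g6, hj'.ne] using gQ j hj'
  · rintro s' hf ⟨g6, -⟩
    simp only [Test.Holds, NatExpr.eval, (h.outStep hf).numPts, g6]
    omega
  · gcongr
    omega
  · rintro s' hf ⟨g6, gQ⟩
    exact ⟨by omega, gQ⟩

/-- The length of the vector `(1, t)`, where `t` is the best slope. -/
abbrev normExpr : RealExpr := .sqrt (.add (.const 1) (.mul (rreg 15) (rreg 15)))

/-- Write the number of edges and the axes. -/
def outTail : Prog :=
  block [.setNat 1 (.const 0) (reg 6), .setReal 2 (.const 0) (.div (.const 1) normExpr),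
    .setReal 2 (.const 1) (.div (rreg 15) normExpr),
    .setReal 3 (.const 0) (.div (.sub (.const 0) (rreg 15)) normExpr),
    .setReal 3 (.const 1) (.div (.const 1) normExpr)]

/-- Reset the counter. -/
def reset : Prog := .setNat 6 (.const 0) (.const 0)

/-- The preparatory loops. -/
def prepare : Prog :=
  .seq pairLoop (.seq setSizes (.seq (.while eventsLeft halfStep)
    (.seq reset (.seq (.while pairsLeft eventStep) reset))))

/-- A bound for the running time of `prepare`. -/
def prepareTime (n : ℕ) : ℕ :=
  (n * n * ((Test.not (.natLe numPts (reg 4))).time + pairStep.maxTime) +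
      (Test.not (.natLe numPts (reg 4))).time) + (setSizes.maxTime +
    ((4 * (n * n) * (eventsLeft.time + halfStep.maxTime) + eventsLeft.time) + (reset.maxTime +
      ((n * n * (pairsLeft.time + eventStep.maxTime) + pairsLeft.time) + reset.maxTime))))

lemma prepare_spec {n r : ℕ} {X Y : ℕ → ℝ} {s : Mem} (hn : s.nat 0 0 = n) (hr : s.nat 0 1 = r)
    (hX : s.real 0 = X) (hY : s.real 1 = Y) (hnat : ∀ a, a ≠ 0 → ∀ i, s.nat a i = 0)
    (hreal : ∀ a, 2 ≤ a → ∀ i, s.real a i = 0) :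
    Ends prepare s (prepareTime n) fun s' => Prepared n r X Y s' ∧ s'.nat 6 0 = 0 := by
  refine Ends.seq (pairLoop_spec hn (hnat _ (by simp) _) (hnat _ (by simp) _) (hnat _ (by simp) _)
    (hnat _ (by simp) _)) ?_
  rintro s₁ hf₁ ⟨a6, aT⟩
  have hn₁ : ∀ a, a < 4 → s₁.nat a = s.nat a := fun a ha => hf₁.1 a (by
    interval_cases a <;> simp [pairLoop, pairStep, block, Prog.WritesNat])
  have hr₁ : s₁.real = s.real := by
    funext a
    exact hf₁.2 a (by simp [pairLoop, pairStep, block, Prog.WritesReal])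
  refine Ends.seq (Q := fun s₂ => s₂.nat 7 0 = n * n ∧ s₂.nat 8 0 = 4 * (n * n) ∧ s₂.nat 6 0 = 0)
    (ends_of_loopFree (by simp [setSizes, block, Prog.LoopFree]) ?_) ?_
  · simp only [setSizes, block, Prog.exec, NatExpr.eval]
    simp [a6]
    ring
  rintro s₂ hf₂ ⟨b7, b8, b6⟩
  refine Ends.seq (halfLoop_spec b8 b6) ?_
  intro s₃ hf₃ cH
  refine Ends.seq (Q := fun s₄ => s₄.nat 6 0 = 0)
    (ends_of_loopFree (by simp [reset, Prog.LoopFree])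
      (by simp [reset, Prog.exec, NatExpr.eval])) ?_
  intro s₄ hf₄ d6
  have hn₄ : ∀ a, a ≠ 6 → a ≠ 7 → a ≠ 8 → a ≠ 15 → s₄.nat a = s₁.nat a := fun a c1 c2 c3 c4 => by
    rw [hf₄.1 a (by simp [reset, Prog.WritesNat, c1]),
      hf₃.1 a (by simp [halfStep, block, Prog.WritesNat, c1, c4]),
      hf₂.1 a (by simp [setSizes, block, Prog.WritesNat, c1, c2, c3])]
  have hr₄ : s₄.real = s.real := by
    funext a
    rw [hf₄.2 a (by simp [reset, Prog.WritesReal]),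
      hf₃.2 a (by simp [halfStep, block, Prog.WritesReal]),
      hf₂.2 a (by simp [setSizes, block, Prog.WritesReal]), hr₁]
  have d7 : s₄.nat 7 0 = n * n := by
    rw [hf₄.1 7 (by simp [reset, Prog.WritesNat]),
      hf₃.1 7 (by simp [halfStep, block, Prog.WritesNat]), b7]
  have d8 : s₄.nat 8 0 = 4 * (n * n) := by
    rw [hf₄.1 8 (by simp [reset, Prog.WritesNat]),
      hf₃.1 8 (by simp [halfStep, block, Prog.WritesNat]), b8]
  have dT : PairTable n s₄ (n * n) := by
    unfold PairTable
    rw [hn₄ 10 (by simp) (by simp) (by simp) (by simp),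
      hn₄ 11 (by simp) (by simp) (by simp) (by simp),
      hn₄ 12 (by simp) (by simp) (by simp) (by simp),
      hn₄ 13 (by simp) (by simp) (by simp) (by simp)]
    exact aT
  have d0 : s₄.nat 0 = s.nat 0 := by
    rw [hn₄ 0 (by simp) (by simp) (by simp) (by simp), hn₁ 0 (by simp)]
  have dH : HalfTable s₄ (8 * (n * n)) := by
    unfold HalfTable
    rw [hf₄.1 15 (by simp [reset, Prog.WritesNat])]
    rw [show 8 * (n * n) = 2 * (4 * (n * n)) by ring]
    exact cH
  refine Ends.seq (eventLoop_spec (r := r) (X := X) (Y := Y) (by rw [d0, hr]) (by rw [hr₄, hX])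
    (by rw [hr₄, hY]) d7 d6 (by rw [hr₄]; exact hreal _ (by simp) _) dT) ?_
  intro s₅ hf₅ eT
  have hn₅ : ∀ a, a ≠ 6 → a ≠ 14 → s₅.nat a = s₄.nat a := fun a c1 c2 => hf₅.1 a (by
    simp [eventStep, block, Prog.WritesNat, setCritSlope, setNextSample, setVal, c1, c2])
  refine ends_of_loopFree (by simp [reset, Prog.LoopFree]) ?_
  have hP : Prepared n r X Y s₅ := by
    refine ⟨by rw [hn₅ 0 (by simp) (by simp), d0, hn], by rw [hn₅ 0 (by simp) (by simp), d0, hr],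
      ?_, ?_, by rw [hn₅ 7 (by simp) (by simp), d7], by rw [hn₅ 8 (by simp) (by simp), d8], ?_, ?_,
      eT⟩
    · rw [hf₅.2 0 (by
        simp [eventStep, block, Prog.WritesReal, setCritSlope, setNextSample, setVal]), hr₄, hX]
    · rw [hf₅.2 1 (by
        simp [eventStep, block, Prog.WritesReal, setCritSlope, setNextSample, setVal]), hr₄, hY]
    · unfold PairTable
      rw [hn₅ 10 (by simp) (by simp), hn₅ 11 (by simp) (by simp), hn₅ 12 (by simp) (by simp),
        hn₅ 13 (by simp) (by simp)]
      exact dT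
    · unfold HalfTable
      rw [hn₅ 15 (by simp) (by simp)]
      exact dH
  exact ⟨hP.of_frame (p := reset) (Runs.setNat _ _ _ _).frame (by simp [reset, Prog.WritesNat])
    (by simp [reset, Prog.WritesReal]), by simp [reset, Prog.exec, NatExpr.eval]⟩

/-- Start the sweep. -/
def sweepStart : Prog :=
  block [.setReal 14 (.const 0) (rreg 13), .setReal 15 (.const 0) (.const 0), reset]

/-- The loops that find the best slope. -/
def optimize : Prog :=
  .seq (.while eventsLeft treeStep) (.seq reset (.seq (.while pairsLeft costStep)
    (.seq sweepStart (.while eventsLeft sweepStep))))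

/-- A bound for the running time of `optimize`. -/
def optimizeTime (n : ℕ) : ℕ :=
  (4 * (n * n) * (eventsLeft.time +
      (treeHead.maxTime + (siftTime 11 19 (8 * (n * n)) + incr.maxTime))) + eventsLeft.time) +
    (reset.maxTime + ((n * n * (pairsLeft.time +
        (costHead.maxTime + (updTime (8 * (n * n)) + incr.maxTime))) + pairsLeft.time) +
      (sweepStart.maxTime +
        (4 * (n * n) * (eventsLeft.time + sweepTime (8 * (n * n))) + eventsLeft.time))))

lemma Prepared.reset {n r : ℕ} {X Y : ℕ → ℝ} {s s' : Mem} (h : Prepared n r X Y s)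
    (hf : Frame reset s s') : Prepared n r X Y s' :=
  h.of_frame hf (by simp [RealRAM.reset, Prog.WritesNat]) (by simp [RealRAM.reset, Prog.WritesReal])

lemma reset_spec (s : Mem) : Ends reset s reset.maxTime fun s' => s'.nat 6 0 = 0 :=
  ends_of_loopFree (by simp [reset, Prog.LoopFree]) (by simp [reset, Prog.exec, NatExpr.eval])

/-- The sweep starts with slope `0` and its cost as the record. This settles the empty prefix, the
only one not reached by an event. -/
lemma optimize_spec {n r : ℕ} {X Y : ℕ → ℝ} {s : Mem} (h : Prepared n r X Y s)
    (h6 : s.nat 6 0 = 0) (h18 : ∀ a, s.nat 18 a = 0) (h19 : ∀ a, s.nat 19 a = 0)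
    (h10 : ∀ a, s.real 10 a = 0) (h11 : ∀ a, s.real 11 a = 0) (h13 : s.real 13 0 = 0) :
    Ends optimize s (optimizeTime n) fun s' => Prepared n r X Y s' ∧ 0 ≤ s'.real 15 0 ∧
        ∀ t, 0 ≤ t → slopeCost n r X Y (s'.real 15 0) ≤ slopeCost n r X Y t := by
  refine Ends.seq (treeLoop_spec h h6 h11 h19) ?_
  rintro s₁ hf₁ ⟨aP, aT⟩
  refine Ends.seq (reset_spec s₁) ?_
  intro s₂ hf₂ b6
  have hn₂ : s₂.nat 18 = s.nat 18 := by
    rw [hf₂.1 18 (by simp [reset, Prog.WritesNat]), hf₁.1 18 (by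
      simp [treeStep, treeHead, incr, block, Prog.WritesNat, sift, siftStep])]
  have hr₂ : ∀ a, a ≠ 11 → s₂.real a = s.real a := fun a ha => by
    rw [hf₂.2 a (by simp [reset, Prog.WritesReal]), hf₁.2 a (by
      simp [treeStep, treeHead, incr, block, Prog.WritesReal, sift, siftStep, ha])]
  have aT₂ : IsTournament (s₂.node 11 19 0) (4 * (n * n)) (sweepOf n r X Y).key := by
    refine aT.congr fun j _ _ => ?_
    rw [Mem.node, Mem.node, hf₂.2 11 (by simp [reset, Prog.WritesReal]),
      hf₂.1 19 (by simp [reset, Prog.WritesNat])]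
  refine Ends.seq (costLoop_spec (aP.reset hf₂) b6 (by rw [hr₂ 10 (by simp)]; exact h10)
    (by rw [hr₂ 13 (by simp)]; exact h13) (by rw [hn₂]; exact h18)) ?_
  rintro s₃ hf₃ ⟨cP, L, cL, hL⟩
  have aT₃ : IsTournament (s₃.node 11 19 0) (4 * (n * n)) (sweepOf n r X Y).key := by
    refine aT₂.congr fun j _ _ => ?_
    rw [Mem.node, Mem.node, hf₃.2 11 (by
      simp [costStep, costHead, updCost, updHead, updTail, incr, block, Prog.WritesReal, sift,
        siftStep]), hf₃.1 19 (by
      simp [costStep, costHead, updCost, updHead, updTail, incr, block, Prog.WritesNat, sift,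
        siftStep])]
  refine Ends.seq (Q := fun s₄ => s₄.nat 6 0 = 0 ∧ s₄.real 14 0 = s₃.real 13 0 ∧ s₄.real 15 0 = 0)
    (ends_of_loopFree (by simp [sweepStart, reset, block, Prog.LoopFree]) ?_) ?_
  · simp [sweepStart, reset, block, Prog.exec, NatExpr.eval, RealExpr.eval]
  rintro s₄ hf₄ ⟨d6, d14, d15⟩
  have dP : Prepared n r X Y s₄ := cP.of_frame hf₄
    (by simp [sweepStart, RealRAM.reset, block, Prog.WritesNat])
    (by simp [sweepStart, RealRAM.reset, block, Prog.WritesReal])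
  have hn₄ : ∀ a, a ≠ 6 → s₄.nat a = s₃.nat a := fun a ha =>
    hf₄.1 a (by simp [sweepStart, reset, block, Prog.WritesNat, ha])
  have hr₄ : ∀ a, a ≠ 14 → a ≠ 15 → s₄.real a = s₃.real a := fun a ha ha' =>
    hf₄.2 a (by simp [sweepStart, reset, block, Prog.WritesReal, ha, ha'])
  have hcost : s₄.real 14 0 = slopeCost n r X Y 0 := by
    rw [d14, cL.cost_eq]
    exact le_antisymm (totalCost_mono fun p hp => (hL p hp).le)
      (totalCost_mono fun p hp => (hL p hp).ge)
  refine sweepLoop_spec dP d6 ⟨Sweep.isPrefix_empty, ?_, ⟨L, ?_, fun p hp => ?_⟩, d15.ge, ?_, ?_⟩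
  · refine (aT₃.congr fun j _ _ => ?_).imp_right fun hleaf x hx => ?_
    · rw [Mem.node, Mem.node, hn₄ 19 (by simp), hr₄ 11 (by simp) (by simp)]
    · rw [hleaf x hx, eventLeaf, if_neg (by simp)]
  · exact cL.congr (hr₄ _ (by simp) (by simp)) (by rw [hr₄ 13 (by simp) (by simp)])
      (hn₄ _ (by simp))
  · rw [hL p hp]
    exact Sweep.state_empty p
  · rw [d15, hcost]
  · intro D' hD' _
    rw [Finset.subset_empty.mp hD']
    exact ⟨fun p => (sweepOf n r X Y).f p 0, fun p _ => Sweep.state_empty p, hcost.le⟩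

/-- The loops that write the output. -/
def output : Prog :=
  .seq reset (.seq (.while pointsLeft initStep) (.seq reset (.seq (.while pairsLeft parentStep)
    (.seq reset (.seq (.while edgesLeft outStep) outTail)))))

/-- A bound for the running time of `output`. -/
def outputTime (n : ℕ) : ℕ :=
  reset.maxTime + ((n * (pointsLeft.time + initStep.maxTime) + pointsLeft.time) +
    (reset.maxTime + ((n * n * (pairsLeft.time + parentStep.maxTime) + pairsLeft.time) +
      (reset.maxTime + ((n * (edgesLeft.time + outStep.maxTime) + edgesLeft.time) +
        outTail.maxTime)))))

/-- The final state holds the graph in which every point `v` but the root is joined to `par v`,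
and the axes of the system of slope `t`. -/
structure IsOutput (n r : ℕ) (s : Mem) (par : ℕ → ℕ) (t : ℝ) : Prop where
  edgeCount : outputEdgeCount s + 1 = n
  edges : ∀ j < n - 1, s.nat 2 j = (if r ≤ j then j + 1 else j) ∧
    s.nat 3 j = par (if r ≤ j then j + 1 else j)
  axes : outputAxes s = ![!₂[1 / √(1 + t * t), t / √(1 + t * t)],
    !₂[-t / √(1 + t * t), 1 / √(1 + t * t)]]

lemma output_spec {n r : ℕ} {X Y : ℕ → ℝ} {s : Mem} (h : Prepared n r X Y s) (hr : r < n) :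
    Ends output s (outputTime n) fun s' => ∃ par : ℕ → ℕ, IsOutput n r s' par (s.real 15 0) ∧
      ∀ v < n, par v < n ∧ MayPrecede X Y r v (par v) (s.real 15 0) ∧
        ∀ q < n, ptDist X Y v (par v) ≤ leafVal X Y r v q (s.real 15 0) := by
  set t := s.real 15 0 with ht
  refine Ends.seq (reset_spec s) fun s₁ hf₁ a6 => ?_
  have aP := h.reset hf₁
  refine Ends.seq (initLoop_spec aP a6) fun s₂ hf₂ b21 => ?_
  have bP := aP.initStep hf₂
  refine Ends.seq (reset_spec s₂) fun s₃ hf₃ c6 => ?_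
  have cP := bP.reset hf₃
  have c21 : ∀ v < n, s₃.nat 21 v = r := by
    rw [hf₃.1 21 (by simp [reset, Prog.WritesNat])]
    exact b21
  have c15 : s₃.real 15 0 = t := by
    rw [hf₃.2 15 (by simp [reset, Prog.WritesReal]),
      hf₂.2 15 (by simp [initStep, incr, Prog.WritesReal]),
      hf₁.2 15 (by simp [reset, Prog.WritesReal])]
  refine Ends.seq (parentLoop_spec cP hr c6 c21) fun s₄ hf₄ hpar => ?_
  rw [c15] at hpar
  have dP := cP.parentStep hf₄
  refine Ends.seq (reset_spec s₄) fun s₅ hf₅ e6 => ?_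
  have eP := dP.reset hf₅
  refine Ends.seq (outLoop_spec eP hr e6) ?_
  rintro s₆ hf₆ ⟨g6, gE⟩
  have e21 : s₅.nat 21 = s₄.nat 21 := hf₅.1 21 (by simp [reset, Prog.WritesNat])
  rw [e21] at gE
  have g15 : s₆.real 15 0 = t := by
    rw [hf₆.2 15 (by simp [outStep, incr, Prog.WritesReal]),
      hf₅.2 15 (by simp [reset, Prog.WritesReal]),
      hf₄.2 15 (by simp [parentStep, incr, Prog.WritesReal]), c15]
  refine ends_of_loopFree (by simp [outTail, block, Prog.LoopFree]) ⟨s₄.nat 21, ⟨?_, ?_, ?_⟩, hpar⟩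
  · simpa [outTail, block, Prog.exec, NatExpr.eval, outputEdgeCount] using g6
  · intro j hj
    simpa [outTail, block, Prog.exec, NatExpr.eval] using gE j hj
  · simp [outTail, block, Prog.exec, NatExpr.eval, RealExpr.eval, outputAxes, g15]

/-- The program that computes a rooted uniform 2D-monotone minimum spanning tree. -/
def mstProg : Prog := .seq prepare (.seq optimize output)

lemma mstProg_spec {n r : ℕ} {X Y : ℕ → ℝ} {s : Mem} (hr' : r < n) (hn : s.nat 0 0 = n)
    (hr : s.nat 0 1 = r) (hX : s.real 0 = X) (hY : s.real 1 = Y)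
    (hnat : ∀ a, a ≠ 0 → ∀ i, s.nat a i = 0) (hreal : ∀ a, 2 ≤ a → ∀ i, s.real a i = 0) :
    Ends mstProg s (prepareTime n + (optimizeTime n + outputTime n)) fun s' =>
      ∃ (par : ℕ → ℕ) (t : ℝ), IsOutput n r s' par t ∧ 0 ≤ t ∧
        (∀ t', 0 ≤ t' → slopeCost n r X Y t ≤ slopeCost n r X Y t') ∧
        ∀ v < n, par v < n ∧ MayPrecede X Y r v (par v) t ∧
          ∀ q < n, ptDist X Y v (par v) ≤ leafVal X Y r v q t := by
  refine Ends.seq (prepare_spec hn hr hX hY hnat hreal) ?_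
  rintro s₁ hf₁ ⟨aP, a6⟩
  have hn₁ : ∀ a, 18 ≤ a → s₁.nat a = s.nat a := fun a ha => hf₁.1 a (by
    simp only [prepare, pairLoop, pairStep, setSizes, halfStep, eventStep, reset, setCritSlope,
      setNextSample, setVal, block, Prog.WritesNat, or_false, false_or]
    omega)
  have hr₁ : ∀ a ∈ [10, 11, 13], s₁.real a = s.real a := fun a ha => hf₁.2 a (by
    revert a
    simp [prepare, pairLoop, pairStep, setSizes, halfStep, eventStep, reset, setCritSlope,
      setNextSample, setVal, block, Prog.WritesReal])
  refine Ends.seq (optimize_spec aP a6 (fun a => ?_) (fun a => ?_) (fun a => ?_) (fun a => ?_)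
    ?_) ?_
  · rw [hn₁ 18 (by simp)]; exact hnat _ (by simp) _
  · rw [hn₁ 19 (by simp)]; exact hnat _ (by simp) _
  · rw [hr₁ 10 (by simp)]; exact hreal _ (by simp) _
  · rw [hr₁ 11 (by simp)]; exact hreal _ (by simp) _
  · rw [hr₁ 13 (by simp)]; exact hreal _ (by simp) _
  rintro s₂ hf₂ ⟨bP, bt, bmin⟩
  refine (output_spec bP hr').mono le_rfl ?_
  rintro s₃ hf₃ ⟨par, c1, c2⟩
  exact ⟨par, _, c1, bt, bmin, c2⟩

/-! ### The running time -/

/-- `f n` is at most a constant times `log n`. -/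
def LogBound (f : ℕ → ℕ) : Prop := ∃ c, ∀ n, f n ≤ c * (Nat.log 2 (8 * (n * n)) + 1)

/-- `f n` is at most a constant times `n² log n`. -/
def SqLogBound (f : ℕ → ℕ) : Prop :=
  ∃ c, ∀ n, 1 ≤ n → f n ≤ c * (n * n * (Nat.log 2 (8 * (n * n)) + 1))

lemma LogBound.const (k : ℕ) : LogBound fun _ => k :=
  ⟨k, fun _ => Nat.le_mul_of_pos_right k (Nat.succ_pos _)⟩

lemma LogBound.add {f g : ℕ → ℕ} (hf : LogBound f) (hg : LogBound g) :
    LogBound fun n => f n + g n := by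
  obtain ⟨c, hc⟩ := hf
  obtain ⟨d, hd⟩ := hg
  refine ⟨c + d, fun n => ?_⟩
  rw [add_mul]
  exact Nat.add_le_add (hc n) (hd n)

lemma LogBound.siftTime (tA iA : ℕ) : LogBound fun n => siftTime tA iA (8 * (n * n)) := by
  refine LogBound.add (f := fun n => Nat.log 2 (8 * (n * n)) *
    ((Test.natLe (.const 2) (reg 17)).time + (siftStep tA iA).maxTime)) ?_ (LogBound.const _)
  generalize (Test.natLe (.const 2) (reg 17)).time + (siftStep tA iA).maxTime = k
  exact ⟨k, fun n => by nlinarith⟩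

lemma SqLogBound.add {f g : ℕ → ℕ} (hf : SqLogBound f) (hg : SqLogBound g) :
    SqLogBound fun n => f n + g n := by
  obtain ⟨c, hc⟩ := hf
  obtain ⟨d, hd⟩ := hg
  refine ⟨c + d, fun n hn => ?_⟩
  rw [add_mul]
  exact Nat.add_le_add (hc n hn) (hd n hn)

lemma SqLogBound.mul_of_logBound {f g : ℕ → ℕ} (hf : LogBound f) (k : ℕ)
    (hg : ∀ n, 1 ≤ n → g n ≤ k * (n * n)) : SqLogBound fun n => g n * f n := by
  obtain ⟨c, hc⟩ := hf
  refine ⟨k * c, fun n hn => ?_⟩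
  calc g n * f n ≤ k * (n * n) * (c * (Nat.log 2 (8 * (n * n)) + 1)) :=
        Nat.mul_le_mul (hg n hn) (hc n)
    _ = k * c * (n * n * (Nat.log 2 (8 * (n * n)) + 1)) := by ring

lemma SqLogBound.const (k : ℕ) : SqLogBound fun _ => k := by
  simpa using mul_of_logBound (g := fun _ => 1) (LogBound.const k) 1
    (fun n hn => by nlinarith)

lemma sqLogBound_time : SqLogBound fun n => prepareTime n + (optimizeTime n + outputTime n) := by
  have h1 : ∀ {f : ℕ → ℕ} (k : ℕ), LogBound f → SqLogBound fun n => n * n * f n + k :=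
    fun k hf => (SqLogBound.mul_of_logBound hf 1 (fun n _ => by simp)).add (.const k)
  have h4 : ∀ {f : ℕ → ℕ} (k : ℕ), LogBound f → SqLogBound fun n => 4 * (n * n) * f n + k :=
    fun k hf => (SqLogBound.mul_of_logBound hf 4 (fun n _ => le_rfl)).add (.const k)
  have h0 : ∀ {f : ℕ → ℕ} (k : ℕ), LogBound f → SqLogBound fun n => n * f n + k :=
    fun k hf => (SqLogBound.mul_of_logBound hf 1 (fun n _ => by nlinarith)).add (.const k)
  have hu : LogBound fun n => updTime (8 * (n * n)) :=
    (LogBound.const _).add ((LogBound.siftTime _ _).add (LogBound.const _))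
  have hs : LogBound fun n => sweepTime (8 * (n * n)) :=
    (LogBound.const _).add (hu.add ((LogBound.const _).add
      ((LogBound.siftTime _ _).add (LogBound.const _))))
  refine SqLogBound.add ?_ (SqLogBound.add ?_ ?_)
  · exact (h1 _ (.const _)).add ((SqLogBound.const _).add ((h4 _ (.const _)).add
      ((SqLogBound.const _).add ((h1 _ (.const _)).add (.const _)))))
  · exact (h4 _ ((LogBound.const _).add ((LogBound.const _).add
      ((LogBound.siftTime _ _).add (.const _))))).add ((SqLogBound.const _).add
      ((h1 _ ((LogBound.const _).add ((LogBound.const _).add (hu.add (.const _))))).add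
        ((SqLogBound.const _).add (h4 _ ((LogBound.const _).add hs)))))
  · exact (SqLogBound.const _).add ((h0 _ (.const _)).add ((SqLogBound.const _).add
      ((h1 _ (.const _)).add ((SqLogBound.const _).add ((h0 _ (.const _)).add (.const _))))))

/-- The integer logarithm of `8 n²` is at most `3 + 2 log n / log 2`. -/
lemma SqLogBound.exists_real {f : ℕ → ℕ} (hf : SqLogBound f) :
    ∃ C : ℝ, ∀ n, 2 ≤ n → (f n : ℝ) ≤ C * ((n : ℝ) ^ 2 * Real.log n) := by
  obtain ⟨c, hc⟩ := hf
  -- For `n ≥ 2` one has `4 log 2 + 2 log n ≤ 6 log n`, which gives the factor `6`.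
  refine ⟨c * (6 / Real.log 2), fun n hn => ?_⟩
  have hn0 : (2 : ℝ) ≤ n := by exact_mod_cast hn
  have hl2 : 0 < Real.log 2 := Real.log_pos (by norm_num)
  have hln : Real.log 2 ≤ Real.log n := Real.log_le_log (by norm_num) hn0
  have hlog : (Nat.log 2 (8 * (n * n)) : ℝ) * Real.log 2 ≤ 3 * Real.log 2 + 2 * Real.log n := by
    have h1 : (2 : ℝ) ^ Nat.log 2 (8 * (n * n)) ≤ 8 * (n * n) := by
      exact_mod_cast Nat.pow_log_le_self 2 (by positivity)
    have h2 := Real.log_le_log (by positivity) h1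
    rw [Real.log_pow, Real.log_mul (by norm_num) (by positivity),
      Real.log_mul (by positivity) (by positivity), show (8 : ℝ) = 2 ^ 3 by norm_num,
      Real.log_pow] at h2
    push_cast at h2
    linarith
  have hlog' : (Nat.log 2 (8 * (n * n)) : ℝ) + 1 ≤ 6 / Real.log 2 * Real.log n := by
    rw [div_mul_eq_mul_div, le_div_iff₀ hl2]
    linarith
  have h3 : (f n : ℝ) ≤ c * (n * n * ((Nat.log 2 (8 * (n * n)) : ℝ) + 1)) := by
    exact_mod_cast hc n (by omega)
  calc (f n : ℝ) ≤ c * (n * n * ((Nat.log 2 (8 * (n * n)) : ℝ) + 1)) := h3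
    _ ≤ c * (n * n * (6 / Real.log 2 * Real.log n)) := by gcongr
    _ = c * (6 / Real.log 2) * ((n : ℝ) ^ 2 * Real.log n) := by ring

end RealRAM

namespace RealRAM

/-! ### Cartesian systems and slopes -/

lemma inner_plane (p q : Plane) : inner ℝ p q = p 0 * q 0 + p 1 * q 1 := by
  rw [PiLp.inner_apply, Fin.sum_univ_two]
  simp [mul_comm]

/-- The second axis is the first one turned by a right angle, up to the sign `d`. Products of two
coordinates along it contain `d * d = 1`, so the first axis alone determines the rectangles. -/
lemma inRect_iff (b : CartesianSystem) (r q v : Plane) : InRect b r q v ↔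
    0 ≤ (b 0 0 * (q 0 - r 0) + b 0 1 * (q 1 - r 1)) * (b 0 0 * (v 0 - q 0) + b 0 1 * (v 1 - q 1)) ∧
    0 ≤ (b 0 0 * (q 1 - r 1) - b 0 1 * (q 0 - r 0)) *
      (b 0 0 * (v 1 - q 1) - b 0 1 * (v 0 - q 0)) := by
  have h00 : inner ℝ (b 0) (b 0) = (1 : ℝ) := by simp
  have h11 : inner ℝ (b 1) (b 1) = (1 : ℝ) := by simp
  have h01 : inner ℝ (b 0) (b 1) = (0 : ℝ) := b.inner_eq_zero (by simp)
  simp only [inner_plane] at h00 h11 h01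
  simp only [InRect, Fin.forall_fin_two, inner_plane, PiLp.sub_apply]
  set x := b 0 0
  set y := b 0 1
  set z := b 1 0
  set w := b 1 1
  set d := x * w - y * z with hd
  have hz : z = -(d * y) := by linear_combination (-z) * h00 + x * h01
  have hw : w = d * x := by linear_combination (-w) * h00 + y * h01
  have hd2 : d * d = 1 := by
    rw [hz, hw] at h11
    linear_combination h11 - d * d * h00
  refine and_congr_right fun _ => ?_
  have : ∀ a₁ a₂ c₁ c₂ : ℝ, (z * a₁ + w * a₂) * (z * c₁ + w * c₂) =
      (x * a₂ - y * a₁) * (x * c₂ - y * c₁) := fun a₁ a₂ c₁ c₂ => by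
    rw [hz, hw]
    linear_combination (x * a₂ - y * a₁) * (x * c₂ - y * c₁) * hd2
  rw [this]

/-- Every Cartesian system induces the same rectangles as the one of some nonnegative slope. -/
lemma exists_slope (b : CartesianSystem) : ∃ t : ℝ, 0 ≤ t ∧ ∀ r q v : Plane,
    InRect b r q v ↔ Aligned (q 0 - r 0) (q 1 - r 1) (v 0 - q 0) (v 1 - q 1) t := by
  refine ⟨critSlope (b 0 0) (b 0 1), critSlope_nonneg _ _, fun r q v => ?_⟩
  have h00 : inner ℝ (b 0) (b 0) = (1 : ℝ) := by simp
  rw [inner_plane] at h00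
  rw [inRect_iff, Aligned]
  set x := b 0 0
  set y := b 0 1
  generalize q 0 - r 0 = a₁
  generalize q 1 - r 1 = a₂
  generalize v 0 - q 0 = c₁
  generalize v 1 - q 1 = c₂
  have hs : ∀ {k A B : ℝ}, 0 < k * k → (0 ≤ k * A * (k * B) ↔ 0 ≤ A * B) := fun {k A B} hk => by
    rw [mul_mul_mul_comm]
    exact mul_nonneg_iff_of_pos_left hk
  unfold critSlope
  split_ifs with hxy
  -- A vertical first axis gives the slope `0`, by `y / 0 = 0`, with the axes exchanged. If `x ≠ 0`,
  -- the first axis is a multiple of `(1, t)` with `t = y / x`.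
  · by_cases hx : x = 0
    · have hy : 0 < y * y := by rw [hx] at h00; linarith
      simp only [hx, div_zero, zero_mul, zero_add, add_zero, zero_sub, sub_zero]
      rw [← neg_mul, ← neg_mul, hs hy, hs (by simpa using hy)]
      exact and_comm
    · have h1 : ∀ a₁ a₂ : ℝ, x * a₁ + y * a₂ = x * (a₁ + y / x * a₂) := fun _ _ => by
        field_simp
      have h2 : ∀ a₁ a₂ : ℝ, x * a₂ - y * a₁ = x * (a₂ - y / x * a₁) := fun _ _ => by
        field_simp
      rw [h1, h1, h2, h2, hs (mul_self_pos.mpr hx), hs (mul_self_pos.mpr hx)]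
  -- Now `x * y < 0`, and the first axis is a multiple of `(-t, 1)` with `t = -x / y`; again the
  -- axes are exchanged.
  · have hy : y ≠ 0 := by
      intro hy
      simp [hy] at hxy
    have h1 : ∀ a₁ a₂ : ℝ, x * a₁ + y * a₂ = y * (a₂ - -x / y * a₁) := fun _ _ => by
      field_simp
      ring
    have h2 : ∀ a₁ a₂ : ℝ, x * a₂ - y * a₁ = -y * (a₁ + -x / y * a₂) := fun _ _ => by
      field_simp
      ring
    have hy2 : 0 < -y * -y := by
      rw [neg_mul_neg]
      exact mul_self_pos.mpr hy
    rw [h1, h1, h2, h2, hs (mul_self_pos.mpr hy), hs hy2]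
    exact and_comm

/-- The Cartesian system of slope `t`. -/
lemma exists_cartesianSystem (t : ℝ) : ∃ b : CartesianSystem,
    (b : Fin 2 → Plane) = ![!₂[1 / √(1 + t * t), t / √(1 + t * t)],
      !₂[-t / √(1 + t * t), 1 / √(1 + t * t)]] ∧
    ∀ r q v : Plane, InRect b r q v ↔
      Aligned (q 0 - r 0) (q 1 - r 1) (v 0 - q 0) (v 1 - q 1) t := by
  have h0 : 0 < 1 + t * t := by nlinarith [mul_self_nonneg t]
  have hm : √(1 + t * t) * √(1 + t * t) = 1 + t * t := Real.mul_self_sqrt h0.le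
  set m := √(1 + t * t) with hm'
  have hm0 : 0 < m := Real.sqrt_pos.mpr h0
  set f : Fin 2 → Plane := ![!₂[1 / m, t / m], !₂[-t / m, 1 / m]] with hf
  have hnorm : 1 / m * (1 / m) + t / m * (t / m) = 1 := by
    field_simp
    linear_combination (-1) * hm
  have g00 : inner ℝ (f 0) (f 0) = (1 : ℝ) := by
    rw [inner_plane]
    exact hnorm
  have g11 : inner ℝ (f 1) (f 1) = (1 : ℝ) := by
    rw [inner_plane]
    change -t / m * (-t / m) + 1 / m * (1 / m) = 1
    linear_combination hnorm
  have g01 : inner ℝ (f 0) (f 1) = (0 : ℝ) := by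
    rw [inner_plane]
    change 1 / m * (-t / m) + t / m * (1 / m) = 0
    ring
  have hon : Orthonormal ℝ f := by
    rw [orthonormal_iff_ite]
    simp only [Fin.forall_fin_two, g00, g11, g01, (real_inner_comm (f 0) (f 1)).trans g01]
    simp
  have hspan : ⊤ ≤ Submodule.span ℝ (Set.range f) := by
    rw [hon.linearIndependent.span_eq_top_of_card_eq_finrank (by simp)]
  refine ⟨OrthonormalBasis.mk hon hspan, OrthonormalBasis.coe_mk hon hspan, fun r q v => ?_⟩
  rw [inRect_iff, OrthonormalBasis.coe_mk, Aligned]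
  have e0 : f 0 0 = 1 / m := rfl
  have e1 : f 0 1 = t / m := rfl
  rw [e0, e1]
  generalize q 0 - r 0 = a₁
  generalize q 1 - r 1 = a₂
  generalize v 0 - q 0 = c₁
  generalize v 1 - q 1 = c₂
  have hk : 0 < 1 / m * (1 / m) := by positivity
  have hs : ∀ {A B : ℝ}, 0 ≤ 1 / m * A * (1 / m * B) ↔ 0 ≤ A * B := fun {A B} => by
    rw [mul_mul_mul_comm]
    exact mul_nonneg_iff_of_pos_left hk
  have h1 : ∀ a₁ a₂ : ℝ, 1 / m * a₁ + t / m * a₂ = 1 / m * (a₁ + t * a₂) := fun _ _ => by ring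
  have h2 : ∀ a₁ a₂ : ℝ, 1 / m * a₂ - t / m * a₁ = 1 / m * (a₂ - t * a₁) := fun _ _ => by ring
  rw [h1, h1, h2, h2, hs, hs]

/-! ### Reading the input and the output as geometry -/

section

variable {n : ℕ} (P : RootedPointSet n)

lemma input_real_zero (i : Fin n) : (input P).real 0 i = P.pt i 0 := by simp [input]

lemma input_real_one (i : Fin n) : (input P).real 1 i = P.pt i 1 := by simp [input]

lemma ptDist_input (i j : Fin n) :
    ptDist ((input P).real 0) ((input P).real 1) i j = dist (P.pt i) (P.pt j) := by
  rw [ptDist, input_real_zero, input_real_zero, input_real_one, input_real_one,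
    EuclideanSpace.dist_eq, Fin.sum_univ_two, Real.dist_eq, Real.dist_eq, sq_abs, sq_abs, pow_two,
    pow_two]

lemma inRectAt_input (r v q : Fin n) (t : ℝ) :
    InRectAt ((input P).real 0) ((input P).real 1) r v q t ↔
      Aligned (P.pt q 0 - P.pt r 0) (P.pt q 1 - P.pt r 1) (P.pt v 0 - P.pt q 0)
        (P.pt v 1 - P.pt q 1) t := by
  simp only [InRectAt, input_real_zero, input_real_one]

lemma slopeCost_eq (n r : ℕ) (X Y : ℕ → ℝ) (t : ℝ) :
    slopeCost n r X Y t = ∑ v : Fin n, ⨅ q : Fin n, leafVal X Y r v q t := by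
  rw [slopeCost, totalCost, ← Fin.sum_univ_eq_sum_range (fun v => ⨅ q : Fin n, _)]
  refine Finset.sum_congr rfl fun v _ => iInf_congr fun q => ?_
  have hn : 0 < n := v.pos
  have h1 : ((v : ℕ) * n + q) / n = v := by
    rw [mul_comm, Nat.mul_add_div hn, Nat.div_eq_of_lt q.2, add_zero]
  have h2 : ((v : ℕ) * n + q) % n = q := by
    rw [mul_comm, Nat.mul_add_mod, Nat.mod_eq_of_lt q.2]
  simp only [sweepOf, h1, h2]

lemma leafVal_nonneg (X Y : ℕ → ℝ) (r v q : ℕ) (t : ℝ) : 0 ≤ leafVal X Y r v q t := by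
  unfold leafVal
  split_ifs <;> exact Real.sqrt_nonneg _

/-- The edge of vertex `i` stands at position `i` if `i` is below the root, and at position `i - 1`
if it is above. -/
lemma outputGraph_eq {s : Mem} {par : ℕ → ℕ} {t : ℝ} (h : IsOutput n P.root s par t)
    {par' : Fin n → Fin n} (hpar : ∀ v : Fin n, (par' v : ℕ) = par v) :
    outputGraph n s = P.parentGraph par' := by
  have hrel : ∀ i j : Fin n, (∃ k < outputEdgeCount s, s.nat 2 k = (i : ℕ) ∧ s.nat 3 k = (j : ℕ)) ↔
      i ≠ P.root ∧ par' i = j := by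
    intro i j
    have hc := h.edgeCount
    rw [Fin.ext_iff, hpar, Ne, Fin.ext_iff]
    have hi := i.2
    have hr := P.root.2
    constructor
    · rintro ⟨k, hk, h2, h3⟩
      obtain ⟨e2, e3⟩ := h.edges k (by omega)
      rw [← e2, h2] at e3
      refine ⟨?_, by rw [← e3, h3]⟩
      rw [h2] at e2
      split_ifs at e2 <;> omega
    · rintro ⟨h1, h2⟩
      rcases lt_or_gt_of_ne h1 with hlt | hlt
      · obtain ⟨e2, e3⟩ := h.edges i (by omega)
        rw [if_neg (by omega)] at e2 e3
        exact ⟨i, by omega, e2, e3.trans h2⟩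
      · obtain ⟨e2, e3⟩ := h.edges (i - 1) (by omega)
        rw [if_pos (by omega), show (i : ℕ) - 1 + 1 = i by omega] at e2 e3
        exact ⟨i - 1, by omega, e2, e3.trans h2⟩
  simp only [outputGraph, RootedPointSet.parentGraph, hrel]

end

end RealRAM

/-! ### The main theorem -/

open RealRAM in
theorem mainTheorem4 :
    ∃ (prog : RealRAM.Prog) (C : ℝ), ∀ (n : ℕ) (P : RootedPointSet n),
      ∃ (s : RealRAM.Mem) (t : ℕ),
        RealRAM.Runs prog (RealRAM.input P) s t ∧
        (2 ≤ n → (t : ℝ) ≤ C * ((n : ℝ) ^ 2 * Real.log n)) ∧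
        RealRAM.outputEdgeCount s + 1 = n ∧
        P.IsUniform2DMonotoneMST (RealRAM.outputGraph n s) ∧
        ∃ b : CartesianSystem, (b : Fin 2 → Plane) = RealRAM.outputAxes s ∧
          P.RootedXYMonotone b (RealRAM.outputGraph n s) := by
  obtain ⟨C, hC⟩ := sqLogBound_time.exists_real
  refine ⟨mstProg, C, fun n P => ?_⟩
  set X := (input P).real 0 with hX
  set Y := (input P).real 1 with hY
  obtain ⟨s, time, hruns, htime, par, t, hout, ht, hmin, hpar⟩ :=
    mstProg_spec (s := input P) (r := P.root) (X := X) (Y := Y) P.root.2 (by simp [input])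
      (by simp [input]) rfl rfl (fun a ha i => by simp [input, ha])
      (fun a ha i => by
        simp only [input]
        split_ifs <;> first | rfl | omega)
  refine ⟨s, time, hruns, fun hn => le_trans (by exact_mod_cast htime) (hC n hn), hout.edgeCount,
    ?_⟩
  set par' : Fin n → Fin n := fun v => ⟨par v, (hpar v v.2).1⟩ with hpar'
  rw [outputGraph_eq P hout (par' := par') fun _ => rfl]
  obtain ⟨b, hb, hrect⟩ := exists_cartesianSystem t
  have hgood : ∀ v, v ≠ P.root →
      par' v ≠ v ∧ InRect b (P.pt P.root) (P.pt (par' v)) (P.pt v) := by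
    intro v hv
    rcases (hpar v v.2).2.1 with h | ⟨h1, h2⟩
    -- The root lies in the rectangle of every point, since one factor of each product vanishes.
    · have h' : par' v = P.root := Fin.ext h
      rw [h']
      refine ⟨hv.symm, fun i => ?_⟩
      simp
    · exact ⟨fun h => h1 (congrArg Fin.val h),
        (hrect _ _ _).mpr ((inRectAt_input P P.root v (par' v) t).mp h2)⟩
  refine ⟨?_, b, hb.trans hout.axes.symm, P.rootedXYMonotone_parentGraph hgood⟩
  choose slope hslope0 hslope using exists_slope
  have : Nonempty (Fin n) := ⟨P.root⟩
  have hbdd : ∀ (v : Fin n) (t : ℝ),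
      BddBelow (Set.range fun q : Fin n => leafVal X Y P.root v q t) :=
    fun v t => (Set.finite_range _).bddBelow
  -- The lower bound for a system `b'` is the minimum of the pair values at the slope that induces
  -- the same rectangles.
  refine P.isUniform2DMonotoneMST_parentGraph
    (fun b' v => ⨅ q : Fin n, leafVal X Y P.root v q (slope b')) hgood ?_ fun b' => ?_
  · intro b' v q hv hq h
    refine (ciInf_le (hbdd v _) q).trans_eq ?_
    rw [leafVal, if_pos, hX, hY, ptDist_input]
    exact ⟨fun h => hq (Fin.ext h),
      (inRectAt_input P P.root v q _).mpr ((hslope b' _ _ _).mp h)⟩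
  · have hle := hmin (slope b') (hslope0 b')
    rw [slopeCost_eq, slopeCost_eq, ← Finset.add_sum_erase _ _ (Finset.mem_univ P.root),
      ← Finset.add_sum_erase _ _ (Finset.mem_univ P.root)] at hle
    -- The term of the root is nonnegative on the left of `hle` and at most `0` on the right, so it
    -- can be dropped from the comparison of the sums.
    have h1 : 0 ≤ ⨅ q : Fin n, leafVal X Y P.root P.root q t :=
      le_ciInf fun q => leafVal_nonneg _ _ _ _ _ _
    have h2 : ⨅ q : Fin n, leafVal X Y P.root P.root q (slope b') ≤ 0 := by
      refine (ciInf_le (hbdd P.root _) P.root).trans_eq ?_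
      rw [leafVal, if_neg (by simp)]
      simp [ptDist]
    have h3 : ∑ v ∈ Finset.univ.erase P.root, dist (P.pt v) (P.pt (par' v)) ≤
        ∑ v ∈ Finset.univ.erase P.root, ⨅ q : Fin n, leafVal X Y P.root v q t := by
      refine Finset.sum_le_sum fun v _ => le_ciInf fun q => ?_
      rw [← ptDist_input]
      exact (hpar v v.2).2.2 q q.2
    linarith
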